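/- Let $M,N$ be smooth finite-dimensional Riemannian manifolds (without boundary) with $\dim M=m\ge n=\dim N$, with distances $d_M,d_N$, and let $F:M\to N$ be locally Lipschitz. Write $B_r(x)$ for the open metric ball. If two points $x,y$ of $M$ (or of $N$) are joined by a unique minimal geodesic segment, let $\tau^x_y$ be the parallel translation $T_x\to T_y$ along it (Levi-Civita connection). Let $E_F$ be the set of points at which $F$ is not differentiable. For $x\in M$ let $K_F(x)$ be the set of all limits in $\mathcal L(T_xM,T_{F(x)}N)$ of sequences $\tau^{F(x_i)}_{F(x)}\circ dF_{x_i}\circ\tau^{x}_{x_i}$ with $x_i\to x$, $x_i\notin E_F$ and both parallel translations defined; let $\partial F(x)$ be the convex hull of $K_F(x)$ (the generalized differential), and $\{\partial F(x)\}^*=\{g^*: g\in\partial F(x)\}$, where $g^*$ is the adjoint of $g$ for the Riemannian inner products. A point $x$ is nonsingular for $F$ if every $g\in\partial F(x)$ has rank $\min\{m,n\}$. Call $B_\alpha(x)$, $\alpha>0$, a Whitehead ball if (a) any two points of its closure are joined by a minimal geodesic segment $\gamma:[0,1]\to X$ with $\gamma((0,1))\subset B_\alpha(x)$, and $\gamma$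 is both the only geodesic segment joining them whose interior lies in $B_\alpha(x)$ and their only minimal geodesic segment (the two points being distinct, or equal and in $B_\alpha(x)$), and (b) $\exp_x$ is defined on the open $\alpha$-ball about the origin of $T_xX$ and restricts to a diffeomorphism from it onto $B_\alpha(x)$. Let $p\in M$ be nonsingular for $F$. Then $F(p)$ is the center of some Whitehead ball in $N$, and for every $t>0$ (in particular for every $t$ such that $B_t(F(p))$ is a Whitehead ball) there are $\lambda>0$ and $\delta>0$ such that: (i) $B_{2\lambda}(p)$ is a Whitehead ball; (ii) $F$ restricted to $B_{2\lambda}(p)$ is a Lipschitz map into $B_t(F(p))$; (iii) for every $x\in B_{2\lambda}(p)$ the parallel translation $\tau^{F(p)}_{F(x)}$ is defined, and for every unit vector $u\in T_{F(p)}N$ there is a unit vector $V\in T_xM$ with $\langle V,g^*(\tau^{F(p)}_{F(x)}u)\rangle\ge\delta$ for all $g^*\in\{\partial F(x)\}^*$; in particular, if $x\notin E_F$, then $\langle V,(dF_x)^*(\tau^{F(p)}_{F(x)}u)\rangle\ge\delta$; (iv) every $x\in B_{2\lambda}(p)$ is nonsingular for $F$. -/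

import Mathlib

open Set Filter Topology Bundle Manifold
open scoped ContDiff ENNReal NNReal

noncomputable section

namespace Clarke

section Riemannian

variable {E : Type*} [NormedAddCommGroup E] [NormedSpace ℝ E]
  {M : Type*} [EMetricSpace M] [ChartedSpace E M]

/-- The coordinates, in the chart around `c`, of a tangent vector `ξ`. -/
def chartVec (c : M) (ξ : TangentBundle 𝓘(ℝ, E) M) : E :=
  mfderiv 𝓘(ℝ, E) 𝓘(ℝ, E) (extChartAt 𝓘(ℝ, E) c) ξ.proj ξ.snd

variable [RiemannianBundle (fun x : M ↦ TangentSpace 𝓘(ℝ, E) x)]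

/-- The coefficients `g_y(v, w)` of the Riemannian metric in the chart around `c`. -/
def chartMetric (c : M) (y v w : E) : ℝ :=
  inner ℝ (mfderiv 𝓘(ℝ, E) 𝓘(ℝ, E) (extChartAt 𝓘(ℝ, E) c).symm y v)
    (mfderiv 𝓘(ℝ, E) 𝓘(ℝ, E) (extChartAt 𝓘(ℝ, E) c).symm y w)

/-- The Christoffel symbols of the first kind in the chart around `c`:
`Γ_y(v, w; z) = (∂_v g(w, z) + ∂_w g(v, z) - ∂_z g(v, w)) / 2`. -/
def christoffel (c : M) (y v w z : E) : ℝ :=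
  (fderiv ℝ (fun y' ↦ chartMetric c y' w z) y v
    + fderiv ℝ (fun y' ↦ chartMetric c y' v z) y w
    - fderiv ℝ (fun y' ↦ chartMetric c y' v w) y z) / 2

/-- `Z`, a vector field along the curve `t ↦ (Z t).proj`, is parallel on `s` for the Levi-Civita
connection: its covariant derivative vanishes. In every chart `c` this reads
`g(X', z) + Γ(γ', X; z) = 0` for all `z`, where `γ` and `X` are the coordinates of the curve and
of the field. -/
def IsParallelOn (Z : ℝ → TangentBundle 𝓘(ℝ, E) M) (s : Set ℝ) : Prop :=
  ∀ t ∈ s, ∀ c : M, (Z t).proj ∈ (chartAt E c).source →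
    ∃ X' : E, HasDerivWithinAt (fun τ ↦ chartVec c (Z τ)) X' s t ∧
      ∀ z : E, chartMetric c (extChartAt 𝓘(ℝ, E) c (Z t).proj) X' z
        + christoffel c (extChartAt 𝓘(ℝ, E) c (Z t).proj)
            (derivWithin (fun τ ↦ extChartAt 𝓘(ℝ, E) c (Z τ).proj) s t)
            (chartVec c (Z t)) z = 0

/-- The velocity field of `γ : [0, 1] → M` (one-sided at the end points). -/
def velocity (γ : ℝ → M) (t : ℝ) : TangentBundle 𝓘(ℝ, E) M :=
  ⟨γ t, mfderivWithin 𝓘(ℝ, ℝ) 𝓘(ℝ, E) γ (Icc 0 1) t (1 : ℝ)⟩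

variable (E) in
/-- `γ` restricted to `[0, 1]` is a geodesic segment from `x` to `y`: a `C¹` curve whose
velocity field is parallel (hence a smooth curve). -/
structure IsGeodesicSegment (γ : ℝ → M) (x y : M) : Prop where
  contMDiffOn : ContMDiffOn 𝓘(ℝ, ℝ) 𝓘(ℝ, E) 1 γ (Icc 0 1)
  parallel : IsParallelOn (velocity (E := E) γ) (Icc 0 1)
  source : γ 0 = x
  target : γ 1 = y

variable (E) in
/-- A geodesic segment from `x` to `y` whose length is the distance between `x` and `y`. -/
structure IsMinimalGeodesic (γ : ℝ → M) (x y : M) : Prop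
    extends IsGeodesicSegment E γ x y where
  length_eq : pathELength 𝓘(ℝ, E) γ 0 1 = edist x y

/-- `P` is the parallel translation `T_x M → T_y M` along the unique minimal geodesic segment
from `x` to `y`; the existence and uniqueness of that segment are part of the assertion. -/
def IsParallelTranslation (x y : M)
    (P : TangentSpace 𝓘(ℝ, E) x →L[ℝ] TangentSpace 𝓘(ℝ, E) y) : Prop :=
  ∃ γ : ℝ → M, IsMinimalGeodesic E γ x y ∧
    (∀ η : ℝ → M, IsMinimalGeodesic E η x y → EqOn η γ (Icc 0 1)) ∧
    ∀ v : TangentSpace 𝓘(ℝ, E) x, ∃ Z : ℝ → TangentBundle 𝓘(ℝ, E) M,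
      (∀ t ∈ Icc (0 : ℝ) 1, (Z t).proj = γ t) ∧ IsParallelOn Z (Icc 0 1) ∧
      Z 0 = ⟨x, v⟩ ∧ Z 1 = ⟨y, P v⟩

variable (E) in
/-- The set `B` is strongly convex: any two points of its closure are joined by a minimal geodesic
segment whose interior lies in `B`, and it is the only geodesic segment joining them with
interior in `B`, and the only minimal one at all. (Two equal points count only if they lie
in `B`: the constant curve at a boundary point does not run through `B`.) -/
def IsStronglyConvex (B : Set M) : Prop :=
  ∀ p ∈ closure B, ∀ q ∈ closure B, (p ≠ q ∨ p ∈ B) →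
    ∃ γ : ℝ → M, IsMinimalGeodesic E γ p q ∧ MapsTo γ (Ioo 0 1) B ∧
      (∀ η : ℝ → M, IsGeodesicSegment E η p q → MapsTo η (Ioo 0 1) B → EqOn η γ (Icc 0 1)) ∧
      (∀ η : ℝ → M, IsMinimalGeodesic E η p q → EqOn η γ (Icc 0 1))

/-- `y = exp_x v`: the geodesic issuing from `x` with initial velocity `v` is defined on `[0, 1]`
and reaches `y` at time `1`. -/
def IsExp (x : M) (v : TangentSpace 𝓘(ℝ, E) x) (y : M) : Prop :=
  ∃ γ : ℝ → M, IsGeodesicSegment E γ x y ∧ velocity γ 0 = ⟨x, v⟩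

variable (E) in
/-- `exp_x` is defined on the open ball of radius `α` about the origin of `T_x M` and restricts to
a diffeomorphism `Φ` from it onto the open ball of radius `α` about `x`. -/
def ExpIsDiffeoOnBall (x : M) (α : ℝ) : Prop :=
  ∃ Φ : OpenPartialHomeomorph (TangentSpace 𝓘(ℝ, E) x) M,
    Φ.source = Metric.ball 0 α ∧ Φ.target = Metric.eball x (ENNReal.ofReal α) ∧
    ContMDiffOn 𝓘(ℝ, TangentSpace 𝓘(ℝ, E) x) 𝓘(ℝ, E) ∞ Φ Φ.source ∧
    ContMDiffOn 𝓘(ℝ, E) 𝓘(ℝ, TangentSpace 𝓘(ℝ, E) x) ∞ Φ.symm Φ.target ∧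
    ∀ v ∈ Φ.source, IsExp x v (Φ v)

variable (E) in
/-- The two properties of the balls in Whitehead's convexity theorem. -/
structure IsWhiteheadBall (x : M) (α : ℝ) : Prop where
  stronglyConvex : IsStronglyConvex E (Metric.eball x (ENNReal.ofReal α))
  exp_diffeo : ExpIsDiffeoOnBall E x α

end Riemannian

section GeneralizedDifferential

variable {E : Type*} [NormedAddCommGroup E] [NormedSpace ℝ E] [FiniteDimensional ℝ E]
  {M : Type*} [EMetricSpace M] [ChartedSpace E M]
  [RiemannianBundle (fun x : M ↦ TangentSpace 𝓘(ℝ, E) x)]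
  {E' : Type*} [NormedAddCommGroup E'] [NormedSpace ℝ E'] [FiniteDimensional ℝ E']
  {N : Type*} [EMetricSpace N] [ChartedSpace E' N]
  [RiemannianBundle (fun y : N ↦ TangentSpace 𝓘(ℝ, E') y)]

/-- The adjoint of a linear map between tangent spaces, for the Riemannian inner products. -/
def tangentAdjoint {x : M} {y : N}
    (g : TangentSpace 𝓘(ℝ, E) x →L[ℝ] TangentSpace 𝓘(ℝ, E') y) :
    TangentSpace 𝓘(ℝ, E') y →L[ℝ] TangentSpace 𝓘(ℝ, E) x :=
  haveI : FiniteDimensional ℝ (TangentSpace 𝓘(ℝ, E) x) := inferInstanceAs (FiniteDimensional ℝ E)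
  haveI : FiniteDimensional ℝ (TangentSpace 𝓘(ℝ, E') y) := inferInstanceAs (FiniteDimensional ℝ E')
  haveI := FiniteDimensional.complete ℝ (TangentSpace 𝓘(ℝ, E) x)
  haveI := FiniteDimensional.complete ℝ (TangentSpace 𝓘(ℝ, E') y)
  ContinuousLinearMap.adjoint g

/-- The mixture `K_F(p)` of the differential: all limits of `τ ∘ dF_{x_i} ∘ τ`, where the `x_i`
are points of differentiability of `F` tending to `p` and the `τ` are the parallel translations
`T_p M → T_{x_i} M` and `T_{F(x_i)} N → T_{F(p)} N`. -/
def mixture (F : M → N) (p : M) :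
    Set (TangentSpace 𝓘(ℝ, E) p →L[ℝ] TangentSpace 𝓘(ℝ, E') (F p)) :=
  {G | ∃ (x : ℕ → M)
      (P : ∀ i, TangentSpace 𝓘(ℝ, E) p →L[ℝ] TangentSpace 𝓘(ℝ, E) (x i))
      (Q : ∀ i, TangentSpace 𝓘(ℝ, E') (F (x i)) →L[ℝ] TangentSpace 𝓘(ℝ, E') (F p)),
      Tendsto x atTop (𝓝 p) ∧
      (∀ i, MDifferentiableAt 𝓘(ℝ, E) 𝓘(ℝ, E') F (x i)) ∧
      (∀ i, IsParallelTranslation p (x i) (P i)) ∧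
      (∀ i, IsParallelTranslation (F (x i)) (F p) (Q i)) ∧
      Tendsto (fun i ↦ (Q i).comp ((mfderiv 𝓘(ℝ, E) 𝓘(ℝ, E') F (x i)).comp (P i)))
        atTop (𝓝 G)}

/-- The generalized differential `∂F(p)`: the convex hull of the mixture. -/
def genDiff (F : M → N) (p : M) :
    Set (TangentSpace 𝓘(ℝ, E) p →L[ℝ] TangentSpace 𝓘(ℝ, E') (F p)) :=
  convexHull ℝ (mixture F p)

/-- The adjoint `{∂F(p)}*` of the generalized differential. -/
def adjGenDiff (F : M → N) (p : M) :
    Set (TangentSpace 𝓘(ℝ, E') (F p) →L[ℝ] TangentSpace 𝓘(ℝ, E) p) :=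
  tangentAdjoint '' genDiff F p

variable (E E') in
/-- `p` is nonsingular for `F` in the sense of Clarke: every element of `∂F(p)` has maximal
rank. -/
def IsNonsingular (F : M → N) (p : M) : Prop :=
  ∀ g ∈ genDiff (E := E) (E' := E') F p,
    Module.finrank ℝ (LinearMap.range g.toLinearMap)
      = min (Module.finrank ℝ E) (Module.finrank ℝ E')

end GeneralizedDifferential

end Clarke

end

/-! Everything is read in the charts around `p` and `F p`. There the metrics are uniformly
equivalent to norms, so `F` has bounded Jacobians near `p`. Parallel translation along a short
minimal geodesic is close to the identity, because the coefficient of its linear equation is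
proportional to the velocity. Composing a Jacobian with such translations therefore changes it
little. Two consequences follow. Every cluster point at `p` of the coordinate Jacobians represents
an element of the mixture (`limitJacobians_subset`). Near `p` the whole of `∂F(x)`, as well as
`dF_x` where it exists, lies in a prescribed neighbourhood of the convex hull `𝒞` of these cluster
points (`eventually_coordRep_mem_cthickening`). Rademacher's theorem plays no role: an empty `𝒞` is
harmless.

The set `𝒞` is compact and convex, and nonsingularity together with `n ≤ m` makes its elements
surjective. For a covector `ℓ ≠ 0` the compact convex set of all `ℓ ∘ A`, `A ∈ 𝒞`, misses `0`, so
Hahn–Banach yields a vector `v` with `ℓ (A v)` bounded below by a positive number on `𝒞`. This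
survives small changes of `ℓ` and a small thickening of `𝒞`, and compactness of a shell of covectors
makes the constants uniform (`exists_uniform_pos_le_apply`). The covectors `⟨τ u, ·⟩` with `u` a
unit vector lie in such a shell. Normalizing `v` and passing to adjoints gives (iii). The same
inequalities prevent the range of an element of `∂F(x)` from lying in a hyperplane, which gives
(iv).

The geometric input is Whitehead's theorem and the existence of parallel translations. Geodesics are
solutions of a shooting problem in a Banach space of velocity curves. Its linearization at rest is
the identity, so the inverse function theorem gives a smooth exponential map, and a second
application gives its inverse `L`. The Gauss lemma makes radial geodesics minimal. At the center the
Hessian of the squared distance is `2g`, so this function is strongly convex along geodesics in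
small balls, whence the convexity of the balls and the uniqueness of geodesics. -/

noncomputable section

set_option maxSynthPendingDepth 3
set_option linter.unusedSectionVars false

namespace Clarke

/-! ### Smoothness of superposition operators on spaces of continuous functions. -/

section Nemytskii

universe u

variable {K : Type*} [TopologicalSpace K] [CompactSpace K]
  {E F : Type u} [NormedAddCommGroup E] [NormedSpace ℝ E] [NormedAddCommGroup F] [NormedSpace ℝ F]

variable (K) in
/-- A continuous bilinear map acts pointwise on continuous functions. -/
def pointwiseCLM {G : Type*} [NormedAddCommGroup G] [NormedSpace ℝ G] (B : G →L[ℝ] E →L[ℝ] F) :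
    C(K, G) →L[ℝ] C(K, E) →L[ℝ] C(K, F) :=
  LinearMap.mkContinuous₂
    (LinearMap.mk₂ ℝ (fun (A : C(K, G)) (ζ : C(K, E)) ↦
        (⟨fun t ↦ B (A t) (ζ t), (B.continuous.comp A.continuous).clm_apply ζ.continuous⟩ :
          C(K, F)))
      (fun _ _ _ ↦ by ext; simp) (fun _ _ _ ↦ by ext; simp)
      (fun _ _ _ ↦ by ext; simp) (fun _ _ _ ↦ by ext; simp)) ‖B‖
    (fun A ζ ↦ by
      refine (ContinuousMap.norm_le _ (by positivity)).2 fun t ↦ ?_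
      refine (B.le_opNorm₂ _ _).trans ?_
      gcongr
      · exact A.norm_coe_le_norm t
      · exact ζ.norm_coe_le_norm t)

theorem norm_pointwiseCLM_le {G : Type*} [NormedAddCommGroup G] [NormedSpace ℝ G]
    (B : G →L[ℝ] E →L[ℝ] F) : ‖pointwiseCLM K B‖ ≤ ‖B‖ :=
  LinearMap.mkContinuous₂_norm_le _ (norm_nonneg _) _

/-- The mean value inequality on each segment from `ζ t` to `ζ t + h t` suffices. The estimate is
uniform in `t` because `ζ ↦ f' ∘ ζ` is continuous for the sup norm. -/
theorem hasFDerivAt_postcomp {f : C(E, F)} {f' : C(E, E →L[ℝ] F)}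
    (hf : ∀ x, HasFDerivAt f (f' x) x) (ζ : C(K, E)) :
    HasFDerivAt (fun ζ : C(K, E) ↦ f.comp ζ) (pointwiseCLM K (.id ℝ (E →L[ℝ] F)) (f'.comp ζ)) ζ := by
  rw [hasFDerivAt_iff_isLittleO_nhds_zero, Asymptotics.isLittleO_iff]
  intro ε hε
  have hc : ContinuousAt (fun ζ : C(K, E) ↦ f'.comp ζ) ζ :=
    (ContinuousMap.continuous_postcomp f').continuousAt
  obtain ⟨δ, hδ, H⟩ := Metric.continuousAt_iff.1 hc ε hε
  filter_upwards [Metric.ball_mem_nhds 0 hδ] with h hh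
  rw [mem_ball_zero_iff] at hh
  refine (ContinuousMap.norm_le _ (by positivity)).2 fun t ↦ ?_
  have key : ‖f (ζ t + h t) - f (ζ t) - f' (ζ t) ((ζ t + h t) - ζ t)‖
      ≤ ε * ‖(ζ t + h t) - ζ t‖ := by
    refine (convex_segment (𝕜 := ℝ) (ζ t) (ζ t + h t)).norm_image_sub_le_of_norm_hasFDerivWithin_le'
      (fun x _ ↦ (hf x).hasFDerivWithinAt) (fun x hx ↦ ?_) (left_mem_segment _ _ _)
      (right_mem_segment _ _ _)
    rw [segment_eq_image'] at hx
    obtain ⟨s, hs, rfl⟩ := hx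
    have h1 : dist (ζ + s • h) ζ < δ := by
      rw [dist_eq_norm, add_sub_cancel_left, norm_smul, Real.norm_of_nonneg hs.1]
      exact (mul_le_of_le_one_left (norm_nonneg _) hs.2).trans_lt hh
    have h2 := (ContinuousMap.dist_apply_le_dist t).trans (H h1).le
    rw [dist_eq_norm] at h2
    simpa using h2
  rw [add_sub_cancel_left] at key
  exact key.trans (mul_le_mul_of_nonneg_left (h.norm_coe_le_norm t) hε.le)

/-- The derivative is again a superposition operator, followed by a continuous linear map. The
induction must range over the target, which passes from `F` to `E →L[ℝ] F`; hence the common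
universe. -/
theorem contDiff_postcomp_nat (n : ℕ) {F : Type u} [NormedAddCommGroup F] [NormedSpace ℝ F]
    {f : C(E, F)} (hf : ContDiff ℝ n f) :
    ContDiff ℝ n (fun ζ : C(K, E) ↦ f.comp ζ) := by
  induction n generalizing F with
  | zero => exact contDiff_zero.2 (ContinuousMap.continuous_postcomp f)
  | succ n ih =>
    obtain ⟨f', hf', hd⟩ := contDiff_succ_iff_hasFDerivAt.1 hf
    refine contDiff_succ_iff_hasFDerivAt.2 ⟨_, ?_, fun ζ ↦
      hasFDerivAt_postcomp (f' := ⟨f', hf'.continuous⟩) hd ζ⟩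
    exact (pointwiseCLM K (.id ℝ (E →L[ℝ] F))).contDiff.comp (ih (f := ⟨f', hf'.continuous⟩) hf')

/-- Composition on the left with a smooth map is smooth on the space of continuous functions. -/
theorem contDiff_postcomp {f : C(E, F)} (hf : ContDiff ℝ ∞ f) :
    ContDiff ℝ ∞ (fun ζ : C(K, E) ↦ f.comp ζ) :=
  contDiff_infty.2 fun n ↦ contDiff_postcomp_nat n (contDiff_infty.1 hf n)

end Nemytskii

/-! ### The inverse function theorem. -/

section InverseFunction

variable {X Y : Type*} [NormedAddCommGroup X] [NormedSpace ℝ X] [CompleteSpace X]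
  [NormedAddCommGroup Y] [NormedSpace ℝ Y]

/-- The inverse function theorem, with a smooth inverse on the whole target. -/
theorem exists_openPartialHomeomorph_contDiffOn {f : X → Y} {s : Set X} (hs : IsOpen s)
    (hf : ContDiffOn ℝ ∞ f s) {a : X} (ha : a ∈ s) (e : X ≃L[ℝ] Y)
    (he : HasFDerivAt f (e : X →L[ℝ] Y) a) :
    ∃ Ψ : OpenPartialHomeomorph X Y, a ∈ Ψ.source ∧ Ψ.source ⊆ s ∧ (Ψ : X → Y) = f ∧
      ContDiffOn ℝ ∞ Ψ.symm Ψ.target := by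
  have hfa : ContDiffAt ℝ ∞ f a := hf.contDiffAt (hs.mem_nhds ha)
  set Ψ := hfa.toOpenPartialHomeomorph f he (by simp) with hΨ
  have hΨf : (Ψ : X → Y) = f := hfa.toOpenPartialHomeomorph_coe he (by simp)
  have hcont : ContinuousOn (fderiv ℝ f) s := hf.continuousOn_fderiv_of_isOpen hs (by simp)
  -- Invertibility is an open condition, so the source can be shrunk to points where the derivative
  -- is an isomorphism. The inverse is then smooth at every point of the target, not just at `f a`.
  set U : Set X := s ∩ fderiv ℝ f ⁻¹' range ((↑) : (X ≃L[ℝ] Y) → X →L[ℝ] Y) with hU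
  have hUo : IsOpen U := hcont.isOpen_inter_preimage hs ContinuousLinearEquiv.isOpen
  have haU : a ∈ U := ⟨ha, e, he.fderiv.symm⟩
  refine ⟨Ψ.restrOpen U hUo, ?_, ?_, ?_, ?_⟩
  · rw [Ψ.restrOpen_source]
    exact ⟨hfa.mem_toOpenPartialHomeomorph_source he (by simp), haU⟩
  · rw [Ψ.restrOpen_source]
    exact fun x hx ↦ hx.2.1
  · exact hΨf
  · intro y hy
    have hx : (Ψ.restrOpen U hUo).symm y ∈ Ψ.source ∩ U := by
      rw [← Ψ.restrOpen_source U hUo]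
      exact (Ψ.restrOpen U hUo).map_target hy
    obtain ⟨-, hxs, e', he'⟩ := hx
    refine ((Ψ.restrOpen U hUo).contDiffAt_symm (f₀' := e') hy ?_ ?_).contDiffWithinAt
    · rw [he']
      exact ((hf.contDiffAt (hs.mem_nhds hxs)).differentiableAt (by simp)).hasFDerivAt
    · exact hf.contDiffAt (hs.mem_nhds hxs)

end InverseFunction

/-! ### Primitives of curves on the unit interval. -/

section Primitive

variable {E : Type*} [NormedAddCommGroup E]

/-- A continuous function on `[0, 1]`, extended by constants. -/
def extendIcc (w : C(Icc (0 : ℝ) 1, E)) : ℝ → E := IccExtend zero_le_one w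

theorem continuous_extendIcc (w : C(Icc (0 : ℝ) 1, E)) : Continuous (extendIcc w) :=
  w.continuous.Icc_extend'

theorem extendIcc_of_mem (w : C(Icc (0 : ℝ) 1, E)) {t : ℝ} (ht : t ∈ Icc (0 : ℝ) 1) :
    extendIcc w t = w ⟨t, ht⟩ := IccExtend_of_mem _ _ ht

theorem norm_extendIcc_le (w : C(Icc (0 : ℝ) 1, E)) (t : ℝ) : ‖extendIcc w t‖ ≤ ‖w‖ :=
  w.norm_coe_le_norm _

variable [NormedSpace ℝ E] [CompleteSpace E]

variable (E) in
/-- The primitive vanishing at `0` of a continuous function on `[0, 1]`. -/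
def primitive : C(Icc (0 : ℝ) 1, E) →L[ℝ] C(Icc (0 : ℝ) 1, E) :=
  LinearMap.mkContinuous
    { toFun := fun w ↦ ⟨fun t ↦ ∫ s in (0 : ℝ)..t, extendIcc w s,
        (intervalIntegral.continuous_primitive
          (fun a b ↦ (continuous_extendIcc w).intervalIntegrable a b) 0).comp
          continuous_subtype_val⟩
      map_add' := fun w w' ↦ by
        ext t
        exact intervalIntegral.integral_add ((continuous_extendIcc w).intervalIntegrable _ _)
          ((continuous_extendIcc w').intervalIntegrable _ _)
      map_smul' := fun r w ↦ by
        ext t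
        exact intervalIntegral.integral_smul r (extendIcc w) } 1
    (fun w ↦ by
      rw [one_mul]
      refine (ContinuousMap.norm_le _ (norm_nonneg _)).2 fun t ↦ ?_
      have := intervalIntegral.norm_integral_le_of_norm_le_const (a := (0 : ℝ)) (b := t)
        (fun s _ ↦ norm_extendIcc_le w s)
      refine this.trans ?_
      rw [sub_zero, abs_of_nonneg t.2.1]
      exact mul_le_of_le_one_right (norm_nonneg _) t.2.2)

theorem primitive_apply (w : C(Icc (0 : ℝ) 1, E)) (t : Icc (0 : ℝ) 1) :
    primitive E w t = ∫ s in (0 : ℝ)..t, extendIcc w s := rfl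

theorem norm_primitive_le : ‖primitive E‖ ≤ 1 := LinearMap.mkContinuous_norm_le _ zero_le_one _

theorem extendIcc_primitive_zero (w : C(Icc (0 : ℝ) 1, E)) : extendIcc (primitive E w) 0 = 0 := by
  rw [extendIcc_of_mem _ (left_mem_Icc.2 zero_le_one), primitive_apply]
  simp

theorem hasDerivWithinAt_extendIcc_primitive (w : C(Icc (0 : ℝ) 1, E)) {t : ℝ}
    (ht : t ∈ Icc (0 : ℝ) 1) :
    HasDerivWithinAt (extendIcc (primitive E w)) (extendIcc w t) (Icc 0 1) t := by
  have h : HasDerivAt (fun t ↦ ∫ s in (0 : ℝ)..t, extendIcc w s) (extendIcc w t) t :=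
    intervalIntegral.integral_hasDerivAt_right ((continuous_extendIcc w).intervalIntegrable _ _)
      ((continuous_extendIcc w).stronglyMeasurableAtFilter _ _)
      (continuous_extendIcc w).continuousAt
  refine h.hasDerivWithinAt.congr (fun s hs ↦ ?_) ?_
  · rw [extendIcc_of_mem _ hs]; rfl
  · rw [extendIcc_of_mem _ ht]; rfl

/-- A function on `[0, 1]` is determined by its derivative and its value at `0`. -/
theorem eqOn_Icc_of_hasDerivWithinAt {f h f' : ℝ → E}
    (hf : ∀ t ∈ Icc (0 : ℝ) 1, HasDerivWithinAt f (f' t) (Icc 0 1) t)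
    (hh : ∀ t ∈ Icc (0 : ℝ) 1, HasDerivWithinAt h (f' t) (Icc 0 1) t) (h0 : f 0 = h 0) :
    EqOn f h (Icc 0 1) := by
  intro t ht
  have key := (convex_Icc (0 : ℝ) 1).norm_image_sub_le_of_norm_hasDerivWithin_le
    (f := fun t ↦ f t - h t) (f' := fun _ ↦ 0) (C := 0)
    (fun x hx ↦ by simpa using (hf x hx).fun_sub (hh x hx)) (fun x _ ↦ by simp)
    (left_mem_Icc.2 zero_le_one) ht
  have h1 : f t - h t - (f 0 - h 0) = 0 := by simpa using key
  rw [h0, sub_self, sub_zero, sub_eq_zero] at h1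
  exact h1

end Primitive

/-! ### Riemannian metrics on a vector space and their Christoffel symbols. -/

section Metric

variable {E : Type*} [NormedAddCommGroup E] [NormedSpace ℝ E] {g : E → E →L[ℝ] E →L[ℝ] ℝ}

/-- A smooth Riemannian metric on a vector space. -/
structure IsMetric (g : E → E →L[ℝ] E →L[ℝ] ℝ) : Prop where
  contDiff : ContDiff ℝ ∞ g
  symm : ∀ y v w, g y v w = g y w v
  pos : ∀ y v, v ≠ 0 → 0 < g y v v

/-- The Christoffel symbols of the first kind of a metric on a vector space. -/
def chr (g : E → E →L[ℝ] E →L[ℝ] ℝ) (y v w z : E) : ℝ :=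
  (fderiv ℝ g y v w z + fderiv ℝ g y w v z - fderiv ℝ g y z v w) / 2

/-- The Christoffel symbols of the first kind, as a trilinear form. -/
def chrL (g : E → E →L[ℝ] E →L[ℝ] ℝ) (y : E) : E →L[ℝ] E →L[ℝ] E →L[ℝ] ℝ :=
  (1 / 2 : ℝ) • (fderiv ℝ g y + (fderiv ℝ g y).flip
    - (ContinuousLinearMap.flipₗᵢ ℝ E E ℝ).toContinuousLinearEquiv.toContinuousLinearMap ∘L
      (fderiv ℝ g y).flip)

theorem chrL_apply (y v w z : E) : chrL g y v w z = chr g y v w z := by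
  simp [chrL, chr]
  ring

/-- The Christoffel symbols of the second kind. -/
def spray (g : E → E →L[ℝ] E →L[ℝ] ℝ) (y : E) : E →L[ℝ] E →L[ℝ] E :=
  (ContinuousLinearMap.compL ℝ E (E →L[ℝ] ℝ) E (g y).inverse) ∘L chrL g y

namespace IsMetric

variable (hg : IsMetric g)
include hg

theorem hasFDerivAt (y : E) : HasFDerivAt g (fderiv ℝ g y) y :=
  (hg.contDiff.differentiable (by simp) y).hasFDerivAt

theorem nonneg (y v : E) : 0 ≤ g y v v := by
  rcases eq_or_ne v 0 with rfl | hv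
  · simp
  · exact (hg.pos y v hv).le

theorem isInvertible [FiniteDimensional ℝ E] (y : E) : (g y).IsInvertible := by
  have hinj : Function.Injective (g y).toLinearMap := by
    rw [← LinearMap.ker_eq_bot, LinearMap.ker_eq_bot']
    intro v hv
    by_contra hne
    have := hg.pos y v hne
    have h0 : g y v = 0 := hv
    rw [h0] at this
    simp at this
  have hdim : Module.finrank ℝ E = Module.finrank ℝ (E →L[ℝ] ℝ) := by
    rw [← (LinearMap.toContinuousLinearMap (𝕜 := ℝ) (E := E) (F' := ℝ)).finrank_eq]
    exact (Subspace.dual_finrank_eq (K := ℝ) (V := E)).symm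
  refine ⟨(LinearEquiv.ofInjectiveOfFinrankEq (g y).toLinearMap hinj hdim).toContinuousLinearEquiv,
    ?_⟩
  ext v w
  rfl

theorem contDiff_chrL : ContDiff ℝ ∞ (chrL g) := by
  have h : ContDiff ℝ ∞ (fderiv ℝ g) := hg.contDiff.fderiv_right (by simp)
  have h' : ContDiff ℝ ∞ (fun y ↦ (fderiv ℝ g y).flip) :=
    (ContinuousLinearMap.flipₗᵢ ℝ E E (E →L[ℝ] ℝ)).contDiff.comp h
  exact ((h.add h').sub (contDiff_const.clm_comp h')).const_smul (1 / 2 : ℝ)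

theorem contDiff_spray [FiniteDimensional ℝ E] : ContDiff ℝ ∞ (spray g) := by
  have h : ContDiff ℝ ∞ (fun y ↦ (g y).inverse) := by
    rw [contDiff_iff_contDiffAt]
    intro y
    have := FiniteDimensional.complete ℝ E
    exact (hg.isInvertible y).contDiffAt_map_inverse.comp y hg.contDiff.contDiffAt
  exact ((ContinuousLinearMap.compL ℝ E (E →L[ℝ] ℝ) E).contDiff.comp h).clm_comp hg.contDiff_chrL

theorem apply_spray [FiniteDimensional ℝ E] (y v w z : E) :
    g y (spray g y v w) z = chr g y v w z := by
  obtain ⟨e, he⟩ := hg.isInvertible y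
  have : g y (spray g y v w) = chrL g y v w := by
    simp only [spray, ContinuousLinearMap.comp_apply, ContinuousLinearMap.compL_apply]
    rw [← he, ContinuousLinearMap.inverse_equiv]
    simp
  rw [this, chrL_apply]

theorem eq_of_forall_apply_eq {y v w : E} (h : ∀ z, g y v z = g y w z) : v = w := by
  by_contra hne
  have h1 := hg.pos y (v - w) (sub_ne_zero.2 hne)
  have h2 : g y (v - w) (v - w) = 0 := by
    rw [(g y).map_sub, _root_.sub_apply, h, sub_self]
  exact h1.ne' h2

/-- Cauchy–Schwarz: the quadratic polynomial `t ↦ g y (v + t w) (v + t w)` is nonnegative, so its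
discriminant is not positive. -/
theorem apply_mul_apply_le (y v w : E) : g y v w * g y v w ≤ g y v v * g y w w := by
  have h : ∀ t : ℝ, 0 ≤ g y w w * (t * t) + 2 * g y v w * t + g y v v := by
    intro t
    have := hg.nonneg y (v + t • w)
    simp only [map_add, map_smul, _root_.add_apply, _root_.smul_apply,
      smul_eq_mul, hg.symm y w v] at this
    linarith
  have := discrim_le_zero h
  rw [discrim] at this
  linarith

theorem abs_apply_le (y v w : E) : |g y v w| ≤ √(g y v v) * √(g y w w) := by
  rw [← Real.sqrt_mul (hg.nonneg y v), ← Real.sqrt_sq_eq_abs, sq]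
  exact Real.sqrt_le_sqrt (hg.apply_mul_apply_le y v w)

/-- The norm of a metric is locally uniformly equivalent to the norm of the space. -/
theorem exists_norm_sq_bounds [FiniteDimensional ℝ E] (x₀ : E) :
    ∃ r > 0, ∃ c > 0, ∃ C > 0, ∀ y ∈ Metric.ball x₀ r, ∀ v,
      c ^ 2 * ‖v‖ ^ 2 ≤ g y v v ∧ g y v v ≤ C ^ 2 * ‖v‖ ^ 2 := by
  obtain ⟨b, hb, hbv⟩ : ∃ b > 0, ∀ v, b * ‖v‖ ^ 2 ≤ g x₀ v v := by
    rcases subsingleton_or_nontrivial E with h | h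
    · exact ⟨1, one_pos, fun v ↦ by simp [Subsingleton.elim v 0]⟩
    have := FiniteDimensional.proper ℝ E
    have hc : ContinuousOn (fun v ↦ g x₀ v v) (Metric.sphere (0 : E) 1) := by fun_prop
    obtain ⟨v₀, hv₀, hmin⟩ := (isCompact_sphere (0 : E) 1).exists_isMinOn
      (NormedSpace.sphere_nonempty.2 zero_le_one) hc
    have hv₀' : v₀ ≠ 0 := by
      rintro rfl
      simp at hv₀
    refine ⟨g x₀ v₀ v₀, hg.pos _ _ hv₀', fun v ↦ ?_⟩
    rcases eq_or_ne v 0 with rfl | hv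
    · simp
    have hn : ‖v‖ ≠ 0 := norm_ne_zero_iff.2 hv
    have hu : ‖v‖⁻¹ • v ∈ Metric.sphere (0 : E) 1 := by
      simp [norm_smul, hn]
    have h1 := isMinOn_iff.1 hmin _ hu
    simp only [map_smul, _root_.smul_apply, smul_eq_mul] at h1
    calc g x₀ v₀ v₀ * ‖v‖ ^ 2 ≤ (‖v‖⁻¹ * (‖v‖⁻¹ * g x₀ v v)) * ‖v‖ ^ 2 := by gcongr
      _ = g x₀ v v := by field_simp
  have hcont : ContinuousAt g x₀ := hg.contDiff.continuous.continuousAt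
  -- With `b` the minimum of `g x₀` on the unit sphere, moving `g` by at most `b / 2` leaves the
  -- lower bound `b / 2` and the upper bound `‖g x₀‖ + b / 2`.
  obtain ⟨r, hr, H⟩ := Metric.continuousAt_iff.1 hcont (b / 2) (by positivity)
  refine ⟨r, hr, √(b / 2), by positivity, √(‖g x₀‖ + b / 2), by positivity, fun y hy v ↦ ?_⟩
  have h1 : ‖g y - g x₀‖ ≤ b / 2 := by
    rw [← dist_eq_norm]
    exact (H hy).le
  have h2 : |g y v v - g x₀ v v| ≤ b / 2 * ‖v‖ ^ 2 := by
    have := (g y - g x₀).le_opNorm₂ v v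
    simp only [_root_.sub_apply, Real.norm_eq_abs] at this
    refine this.trans ?_
    rw [mul_assoc, ← sq]
    gcongr
  have h3 : |g x₀ v v| ≤ ‖g x₀‖ * ‖v‖ ^ 2 := by
    have := (g x₀).le_opNorm₂ v v
    rwa [mul_assoc, ← sq] at this
  rw [Real.sq_sqrt (by positivity), Real.sq_sqrt (by positivity)]
  have := abs_le.1 h2
  have := abs_le.1 h3
  have := hbv v
  constructor <;> nlinarith

end IsMetric

end Metric

/-! ### The geodesic equation. -/

section Geodesic

variable {E : Type*} [NormedAddCommGroup E] [NormedSpace ℝ E]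
  {g : E → E →L[ℝ] E →L[ℝ] ℝ} {γ w : ℝ → E}

/-- `γ` is a geodesic on `[0, 1]` for the metric `g`, with velocity `w`. -/
structure IsGeod (g : E → E →L[ℝ] E →L[ℝ] ℝ) (γ w : ℝ → E) : Prop where
  deriv : ∀ t ∈ Icc (0 : ℝ) 1, HasDerivWithinAt γ (w t) (Icc 0 1) t
  deriv₂ : ∀ t ∈ Icc (0 : ℝ) 1,
    HasDerivWithinAt w (-(spray g (γ t) (w t) (w t))) (Icc 0 1) t

namespace IsGeod

theorem continuousOn (h : IsGeod g γ w) : ContinuousOn γ (Icc 0 1) :=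
  fun t ht ↦ (h.deriv t ht).continuousWithinAt

theorem continuousOn_velocity (h : IsGeod g γ w) : ContinuousOn w (Icc 0 1) :=
  fun t ht ↦ (h.deriv₂ t ht).continuousWithinAt

theorem congr {γ' w' : ℝ → E} (h : IsGeod g γ w) (hγ : EqOn γ' γ (Icc 0 1))
    (hw : EqOn w' w (Icc 0 1)) : IsGeod g γ' w' where
  deriv t ht := by
    rw [hw ht]
    exact (h.deriv t ht).congr hγ (hγ ht)
  deriv₂ t ht := by
    rw [hw ht, hγ ht]
    exact (h.deriv₂ t ht).congr hw (hw ht)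

theorem const (x : E) : IsGeod g (fun _ ↦ x) (fun _ ↦ 0) where
  deriv t _ := hasDerivWithinAt_const _ _ _
  deriv₂ t _ := by simpa using hasDerivWithinAt_const _ _ _

/-- The spray is quadratic in the velocity, so slowing a curve down by `s` scales both sides of the
equation by `s ^ 2`. -/
theorem comp_mul (h : IsGeod g γ w) {s : ℝ} (hs : s ∈ Icc (0 : ℝ) 1) :
    IsGeod g (fun t ↦ γ (s * t)) (fun t ↦ s • w (s * t)) := by
  have hm : MapsTo (fun t ↦ s * t) (Icc (0 : ℝ) 1) (Icc 0 1) := fun t ht ↦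
    ⟨mul_nonneg hs.1 ht.1, mul_le_one₀ hs.2 ht.1 ht.2⟩
  have hd : ∀ t, HasDerivWithinAt (fun t ↦ s * t) s (Icc 0 1) t := fun t ↦ by
    simpa using (hasDerivWithinAt_id t (Icc (0 : ℝ) 1)).const_mul s
  refine ⟨fun t ht ↦ ?_, fun t ht ↦ ?_⟩
  · exact (h.deriv _ (hm ht)).scomp t (hd t) hm
  · have := ((h.deriv₂ _ (hm ht)).scomp t (hd t) hm).const_smul s
    convert! this using 1
    simp [smul_smul]

/-- The derivative is `∂_w g(w, w) - 2 Γ(w, w; w)`, and the Christoffel symbol on the diagonal is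
half of `∂_w g(w, w)`. -/
theorem energy_eq [FiniteDimensional ℝ E] (hg : IsMetric g) (h : IsGeod g γ w) {t : ℝ}
    (ht : t ∈ Icc (0 : ℝ) 1) :
    g (γ t) (w t) (w t) = g (γ 0) (w 0) (w 0) := by
  refine eqOn_Icc_of_hasDerivWithinAt (f := fun t ↦ g (γ t) (w t) (w t)) (f' := fun _ ↦ 0)
    (h := fun _ ↦ g (γ 0) (w 0) (w 0)) (fun t ht ↦ ?_)
    (fun t _ ↦ hasDerivWithinAt_const _ _ _) rfl ht
  have h1 := ((hg.hasFDerivAt (γ t)).comp_hasDerivWithinAt t (h.deriv t ht))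
  have h2 := (h1.clm_apply (h.deriv₂ t ht)).clm_apply (h.deriv₂ t ht)
  convert! h2 using 1
  simp only [map_neg, _root_.add_apply, _root_.neg_apply,
    Function.comp_apply]
  rw [hg.symm _ (w t) (spray _ _ _ _), hg.apply_spray, chr]
  ring

end IsGeod

end Geodesic

/-! ### The exponential map, by shooting in a Banach space of velocity curves. -/

section Exponential

universe u

variable {E : Type u} [NormedAddCommGroup E] [NormedSpace ℝ E] [FiniteDimensional ℝ E]
  [CompleteSpace E] {g : E → E →L[ℝ] E →L[ℝ] ℝ}

variable (E) in
/-- The curve in phase space with given velocity and starting point. -/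
def phaseCurve : E × C(Icc (0 : ℝ) 1, E) →L[ℝ] C(Icc (0 : ℝ) 1, E × E) :=
  (ContinuousLinearMap.inl ℝ E E).compLeftContinuous ℝ (Icc (0 : ℝ) 1) ∘L
      (ContinuousLinearMap.const ℝ (Icc (0 : ℝ) 1) ∘L ContinuousLinearMap.fst ℝ _ _
        + primitive E ∘L ContinuousLinearMap.snd ℝ _ _)
    + (ContinuousLinearMap.inr ℝ E E).compLeftContinuous ℝ (Icc (0 : ℝ) 1) ∘L
      ContinuousLinearMap.snd ℝ _ _

theorem phaseCurve_apply (z : E × C(Icc (0 : ℝ) 1, E)) (t : Icc (0 : ℝ) 1) :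
    phaseCurve E z t = (z.1 + primitive E z.2 t, z.2 t) := by
  simp [phaseCurve]

/-- The acceleration, up to sign, of a geodesic with given position and velocity. -/
def accel (g : E → E →L[ℝ] E →L[ℝ] ℝ) (z : E × E) : E := spray g z.1 z.2 z.2

namespace IsMetric

variable (hg : IsMetric g)
include hg

theorem contDiff_accel : ContDiff ℝ ∞ (accel g) :=
  ((hg.contDiff_spray.comp contDiff_fst).clm_apply contDiff_snd).clm_apply contDiff_snd

/-- The acceleration is quadratic in the velocity. This is what makes the linearized shooting
problem trivial. -/
theorem hasFDerivAt_accel_zero (x : E) : HasFDerivAt (𝕜 := ℝ) (accel g) 0 (x, 0) := by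
  have h0 : HasFDerivAt (spray g) (fderiv ℝ (spray g) x) x :=
    (hg.contDiff_spray.differentiable (by simp) x).hasFDerivAt
  have h1 : HasFDerivAt (fun z : E × E ↦ spray g z.1)
      (fderiv ℝ (spray g) x ∘L ContinuousLinearMap.fst ℝ E E) ((x, 0) : E × E) :=
    HasFDerivAt.comp (g := spray g) ((x, 0) : E × E) h0 hasFDerivAt_fst
  have h2 : HasFDerivAt (fun z : E × E ↦ z.2) _ ((x, 0) : E × E) := hasFDerivAt_snd (𝕜 := ℝ)
  convert! (h1.clm_apply h2).clm_apply h2 using 1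
  ext <;> simp

end IsMetric

/-- The map whose fibres over the constant functions are the geodesics. -/
def shoot (hg : IsMetric g) (z : E × C(Icc (0 : ℝ) 1, E)) : E × C(Icc (0 : ℝ) 1, E) :=
  (z.1, z.2 + primitive E
    ((⟨accel g, hg.contDiff_accel.continuous⟩ : C(E × E, E)).comp (phaseCurve E z)))

theorem contDiff_shoot (hg : IsMetric g) : ContDiff ℝ ∞ (shoot hg) := by
  refine contDiff_fst.prodMk (contDiff_snd.add ((primitive E).contDiff.comp ?_))
  exact (contDiff_postcomp (f := (⟨accel g, hg.contDiff_accel.continuous⟩ : C(E × E, E)))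
    hg.contDiff_accel).comp (phaseCurve E).contDiff

/-- At zero velocity the phase curve is constantly `(x, 0)`, where `accel` has zero derivative, so
the integral term contributes nothing. -/
theorem hasFDerivAt_shoot (hg : IsMetric g) (x : E) :
    HasFDerivAt (shoot hg)
      ((ContinuousLinearEquiv.refl ℝ (E × C(Icc (0 : ℝ) 1, E)) :
        E × C(Icc (0 : ℝ) 1, E) →L[ℝ] E × C(Icc (0 : ℝ) 1, E))) (x, 0) := by
  have hcf : Continuous (fderiv ℝ (accel g)) := hg.contDiff_accel.continuous_fderiv (by simp)
  have h1 := hasFDerivAt_postcomp (K := Icc (0 : ℝ) 1)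
    (f := (⟨accel g, hg.contDiff_accel.continuous⟩ : C(E × E, E)))
    (f' := ⟨fderiv ℝ (accel g), hcf⟩)
    (fun z ↦ (hg.contDiff_accel.differentiable (by simp) z).hasFDerivAt) (phaseCurve E (x, 0))
  have h0 : (⟨fderiv ℝ (accel g), hcf⟩ : C(E × E, E × E →L[ℝ] E)).comp (phaseCurve E (x, 0))
      = 0 := by
    ext1 t
    have : phaseCurve E (x, 0) t = (x, 0) := by simp [phaseCurve_apply]
    rw [ContinuousMap.comp_apply, this]
    exact (hg.hasFDerivAt_accel_zero x).fderiv
  rw [h0, map_zero] at h1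
  have h2 : HasFDerivAt (fun z : E × C(Icc (0 : ℝ) 1, E) ↦
      (⟨accel g, hg.contDiff_accel.continuous⟩ : C(E × E, E)).comp (phaseCurve E z)) _ (x, 0) :=
    h1.comp (x, (0 : C(Icc (0 : ℝ) 1, E))) (phaseCurve E).hasFDerivAt
  have h3 := (primitive E).hasFDerivAt.comp (x, (0 : C(Icc (0 : ℝ) 1, E))) h2
  have h4 := (hasFDerivAt_fst (𝕜 := ℝ) (p := (x, (0 : C(Icc (0 : ℝ) 1, E))))).prodMk
    ((hasFDerivAt_snd (𝕜 := ℝ) (p := (x, (0 : C(Icc (0 : ℝ) 1, E))))).add h3)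
  convert! h4 using 1
  ext <;> simp

theorem shoot_zero (hg : IsMetric g) (x : E) : shoot hg (x, 0) = (x, 0) := by
  have : (⟨accel g, hg.contDiff_accel.continuous⟩ : C(E × E, E)).comp (phaseCurve E (x, 0))
      = 0 := by
    ext t
    simp [phaseCurve_apply, accel]
  rw [shoot, this]
  simp

/-- The hypothesis says that `w` equals `v` minus the primitive of the acceleration, which is the
integrated geodesic equation for the velocity `w`. -/
theorem isGeod_of_shoot_eq (hg : IsMetric g) {x v : E} {w : C(Icc (0 : ℝ) 1, E)}
    (h : shoot hg (x, w) = (x, ContinuousMap.const _ v)) :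
    IsGeod g (fun t ↦ x + extendIcc (primitive E w) t) (extendIcc w) ∧ extendIcc w 0 = v := by
  set a := (⟨accel g, hg.contDiff_accel.continuous⟩ : C(E × E, E)).comp (phaseCurve E (x, w))
    with ha
  have hw : w + primitive E a = ContinuousMap.const _ v := (Prod.ext_iff.1 h).2
  have hw' : EqOn (extendIcc w) (fun t ↦ v - extendIcc (primitive E a) t) (Icc 0 1) := by
    intro t ht
    have := congrArg (fun ζ : C(Icc (0 : ℝ) 1, E) ↦ ζ ⟨t, ht⟩) hw
    simp only [ContinuousMap.add_apply, ContinuousMap.const_apply] at this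
    simp only [extendIcc_of_mem _ ht]
    rw [← this, add_sub_cancel_right]
  refine ⟨⟨fun t ht ↦ ?_, fun t ht ↦ ?_⟩, ?_⟩
  · exact (hasDerivWithinAt_extendIcc_primitive w ht).const_add x
  · have h1 := (hasDerivWithinAt_extendIcc_primitive a ht).const_sub v
    have h2 : extendIcc a t = spray g (x + extendIcc (primitive E w) t) (extendIcc w t)
        (extendIcc w t) := by
      simp only [extendIcc_of_mem _ ht, ha, ContinuousMap.comp_apply, phaseCurve_apply]
      rfl
    rw [h2] at h1
    exact h1.congr hw' (hw' ht)
  · rw [hw' (left_mem_Icc.2 zero_le_one)]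
    simp only
    rw [extendIcc_primitive_zero, sub_zero]

theorem IsGeod.shoot_eq (hg : IsMetric g) {γ w : ℝ → E} (h : IsGeod g γ w) :
    shoot hg (γ 0, ⟨(Icc (0 : ℝ) 1).domRestrict w, h.continuousOn_velocity.domRestrict⟩)
      = (γ 0, ContinuousMap.const _ (w 0)) := by
  set θ : C(Icc (0 : ℝ) 1, E) := ⟨(Icc (0 : ℝ) 1).domRestrict w, h.continuousOn_velocity.domRestrict⟩
    with hθ
  have hθt : ∀ t ∈ Icc (0 : ℝ) 1, extendIcc θ t = w t := fun t ht ↦ by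
    rw [extendIcc_of_mem _ ht]; rfl
  have hγ : EqOn γ (fun t ↦ γ 0 + extendIcc (primitive E θ) t) (Icc 0 1) := by
    refine eqOn_Icc_of_hasDerivWithinAt h.deriv (fun t ht ↦ ?_) ?_
    · rw [← hθt t ht]
      exact (hasDerivWithinAt_extendIcc_primitive θ ht).const_add (γ 0)
    · simp [extendIcc_primitive_zero]
  set a := (⟨accel g, hg.contDiff_accel.continuous⟩ : C(E × E, E)).comp (phaseCurve E (γ 0, θ))
    with ha
  have hat : ∀ t ∈ Icc (0 : ℝ) 1, extendIcc a t = spray g (γ t) (w t) (w t) := fun t ht ↦ by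
    rw [hγ ht, ← hθt t ht]
    simp only [extendIcc_of_mem _ ht, ha, ContinuousMap.comp_apply, phaseCurve_apply]
    rfl
  have hw : EqOn (fun t ↦ w t + extendIcc (primitive E a) t) (fun _ ↦ w 0) (Icc 0 1) := by
    refine eqOn_Icc_of_hasDerivWithinAt (f' := fun _ ↦ 0) (fun t ht ↦ ?_)
      (fun t _ ↦ hasDerivWithinAt_const _ _ _) ?_
    · have := (h.deriv₂ t ht).fun_add (hasDerivWithinAt_extendIcc_primitive a ht)
      rwa [hat t ht, neg_add_cancel] at this
    · simp [extendIcc_primitive_zero]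
  refine Prod.ext rfl ?_
  ext t
  have := hw t.2
  simp only [extendIcc_of_mem _ t.2] at this
  exact this

/-- Around every point there is a smooth exponential map, and it describes all the geodesics
of small velocity. -/
theorem IsMetric.exists_exp (hg : IsMetric g) (x₀ : E) :
    ∃ r > 0, ∃ X : E × E → E, ContDiffOn ℝ ∞ X (Metric.ball (x₀, 0) r) ∧
      (∀ z ∈ Metric.ball (x₀, (0 : E)) r, X (z.1, 0) = z.1 ∧
        ∃ w, IsGeod g (fun t ↦ X (z.1, t • z.2)) w ∧ w 0 = z.2) ∧
      ∀ γ w, IsGeod g γ w → dist (γ 0) x₀ < r → (∀ t ∈ Icc (0 : ℝ) 1, ‖w t‖ < r) →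
        ∀ t ∈ Icc (0 : ℝ) 1, γ t = X (γ 0, t • w 0) := by
  obtain ⟨Ψ, hΨ0, -, hΨf, hΨs⟩ := exists_openPartialHomeomorph_contDiffOn isOpen_univ
    (contDiff_shoot hg).contDiffOn (mem_univ (x₀, 0)) _ (hasFDerivAt_shoot hg x₀)
  obtain ⟨ε, hε, hεs⟩ := Metric.isOpen_iff.1 Ψ.open_source _ hΨ0
  have hΨ00 : Ψ (x₀, 0) = (x₀, 0) := by rw [hΨf, shoot_zero]
  have h0t : (x₀, (0 : C(Icc (0 : ℝ) 1, E))) ∈ Ψ.target := by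
    rw [← hΨ00]; exact Ψ.map_source hΨ0
  have hcont : ContinuousAt Ψ.symm (x₀, 0) := Ψ.symm.continuousAt h0t
  have hsymm0 : Ψ.symm (x₀, 0) = (x₀, 0) := by
    conv_lhs => rw [← hΨ00]
    exact Ψ.left_inv hΨ0
  obtain ⟨ρ, hρ, hρs⟩ : ∃ ρ > 0, Metric.ball (x₀, (0 : C(Icc (0 : ℝ) 1, E))) ρ ⊆
      Ψ.target ∩ Ψ.symm ⁻¹' Metric.ball (x₀, 0) ε := by
    refine Metric.mem_nhds_iff.1 (inter_mem (Ψ.open_target.mem_nhds h0t) ?_)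
    refine hcont.preimage_mem_nhds ?_
    rw [hsymm0]
    exact Metric.ball_mem_nhds _ hε
  -- constant functions as initial data
  let c : E × E →L[ℝ] E × C(Icc (0 : ℝ) 1, E) :=
    (ContinuousLinearMap.fst ℝ E E).prod
      (ContinuousLinearMap.const ℝ (Icc (0 : ℝ) 1) ∘L ContinuousLinearMap.snd ℝ E E)
  have hc : ∀ z, c z = (z.1, ContinuousMap.const _ z.2) := fun z ↦ rfl
  have hcball : ∀ r ≤ ρ, MapsTo c (Metric.ball (x₀, 0) r) (Metric.ball (x₀, 0) ρ) := by
    intro r hr z hz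
    rw [Metric.mem_ball, Prod.dist_eq, max_lt_iff] at hz ⊢
    refine ⟨hz.1.trans_le hr, ?_⟩
    have h2 : ‖z.2‖ < r := by simpa using hz.2
    rw [hc]
    simp only [dist_zero_right]
    exact (ContinuousMap.norm_lt_iff _ hρ).2 fun t ↦ h2.trans_le hr
  -- `θ z` is the velocity curve of the geodesic with initial data `z`, and `X z` below is the point
  -- it reaches at time `1`.
  let θ : E × E → C(Icc (0 : ℝ) 1, E) := fun z ↦ (Ψ.symm (c z)).2
  let X : E × E → E := fun z ↦ z.1 + primitive E (θ z) ⟨1, right_mem_Icc.2 zero_le_one⟩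
  have hθ : ∀ z ∈ Metric.ball (x₀, (0 : E)) ρ, shoot hg (z.1, θ z) = c z ∧ ‖θ z‖ < ε ∧
      dist z.1 x₀ < ε := by
    intro z hz
    obtain ⟨ht, hs⟩ := hρs (hcball ρ le_rfl hz)
    have h1 : shoot hg (Ψ.symm (c z)) = c z := by
      rw [← hΨf]; exact Ψ.right_inv ht
    have h2 : (Ψ.symm (c z)).1 = z.1 := (Prod.ext_iff.1 h1).1
    have h3 : Ψ.symm (c z) = (z.1, θ z) := Prod.ext h2 rfl
    rw [mem_preimage, h3, Metric.mem_ball, Prod.dist_eq, max_lt_iff] at hs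
    refine ⟨by rw [← h3, h1], by simpa using hs.2, hs.1⟩
  -- uniqueness of solutions of the shooting problem
  have huniq : ∀ z ∈ Metric.ball (x₀, (0 : E)) ρ, ∀ w : C(Icc (0 : ℝ) 1, E), ‖w‖ < ε →
      shoot hg (z.1, w) = c z → w = θ z := by
    intro z hz w hw hsh
    obtain ⟨h1, h2, h3⟩ := hθ z hz
    have hs : ∀ w' : C(Icc (0 : ℝ) 1, E), ‖w'‖ < ε → (z.1, w') ∈ Ψ.source := fun w' hw' ↦ by
      refine hεs ?_
      rw [Metric.mem_ball, Prod.dist_eq, max_lt_iff]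
      exact ⟨h3, by simpa using hw'⟩
    have := Ψ.injOn (hs w hw) (hs _ h2) (by rw [hΨf, hsh, h1])
    exact (Prod.ext_iff.1 this).2
  have hX : ∀ γ w, IsGeod g γ w → (γ 0, w 0) ∈ Metric.ball (x₀, (0 : E)) ρ →
      (∀ t ∈ Icc (0 : ℝ) 1, ‖w t‖ < ε) → ∀ t ∈ Icc (0 : ℝ) 1, γ t = X (γ 0, t • w 0) := by
    intro γ w hγ hball hw t ht
    -- The geodesic slowed down by `t` starts with velocity `t • w 0` and reaches `γ t` at time `1`,
    -- so the end point map `X` describes the entire curve.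
    have hgt := hγ.comp_mul ht
    have hsh := hgt.shoot_eq hg
    simp only [mul_zero] at hsh
    have hball' : (γ 0, t • w 0) ∈ Metric.ball (x₀, (0 : E)) ρ := by
      rw [Metric.mem_ball, Prod.dist_eq, max_lt_iff] at hball ⊢
      refine ⟨hball.1, ?_⟩
      simp only [dist_zero_right] at hball ⊢
      rw [norm_smul, Real.norm_of_nonneg ht.1]
      exact (mul_le_of_le_one_left (norm_nonneg _) ht.2).trans_lt hball.2
    have heq := huniq (γ 0, t • w 0) hball' _ ((ContinuousMap.norm_lt_iff _ hε).2 fun s ↦ by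
      simp only [ContinuousMap.coe_mk, domRestrict_apply]
      rw [norm_smul, Real.norm_of_nonneg ht.1]
      exact (mul_le_of_le_one_left (norm_nonneg _) ht.2).trans_lt
        (hw _ ⟨mul_nonneg ht.1 s.2.1, mul_le_one₀ ht.2 s.2.1 s.2.2⟩)) hsh
    have h1 := (isGeod_of_shoot_eq hg (hθ _ hball').1).1
    have h2 : EqOn (fun s ↦ γ (t * s))
        (fun s ↦ γ 0 + extendIcc (primitive E (θ (γ 0, t • w 0))) s) (Icc 0 1) := by
      refine eqOn_Icc_of_hasDerivWithinAt hgt.deriv (fun s hs ↦ ?_) ?_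
      · have h3 : t • w (t * s) = extendIcc (θ (γ 0, t • w 0)) s := by
          rw [← heq, extendIcc_of_mem _ hs]; rfl
        rw [h3]
        exact h1.deriv s hs
      · simp [extendIcc_primitive_zero]
    have h3 := h2 (right_mem_Icc.2 zero_le_one)
    simp only [mul_one] at h3
    rw [h3, extendIcc_of_mem _ (right_mem_Icc.2 zero_le_one)]
  refine ⟨min ρ ε, lt_min hρ hε, X, ?_, fun z hz ↦ ?_, fun γ w hγ h0 hw ↦ ?_⟩
  · have h1 : ContDiffOn ℝ ∞ (fun z ↦ Ψ.symm (c z)) (Metric.ball (x₀, 0) (min ρ ε)) :=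
      hΨs.comp c.contDiff.contDiffOn fun z hz ↦ (hρs (hcball _ (min_le_left _ _) hz)).1
    let ev : C(Icc (0 : ℝ) 1, E) →L[ℝ] E :=
      ContinuousMap.evalCLM ℝ ⟨1, right_mem_Icc.2 zero_le_one⟩
    exact contDiff_fst.contDiffOn.add
      ((ev.contDiff.comp (primitive E).contDiff).comp_contDiffOn
        (contDiff_snd.comp_contDiffOn h1))
  · have hz' := Metric.ball_subset_ball (min_le_left ρ ε) hz
    have hz1 := hz'
    rw [Metric.mem_ball, Prod.dist_eq, max_lt_iff] at hz1
    refine ⟨?_, ?_⟩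
    · have := hX (fun _ ↦ z.1) (fun _ ↦ 0) (IsGeod.const z.1) ?_ (fun t _ ↦ by simpa using hε) 0
        (left_mem_Icc.2 zero_le_one)
      · simpa using this.symm
      · rw [Metric.mem_ball, Prod.dist_eq, max_lt_iff]
        exact ⟨hz1.1, by simpa using hρ⟩
    · obtain ⟨h1, h2⟩ := isGeod_of_shoot_eq hg (hθ z hz').1
      refine ⟨extendIcc (θ z), h1.congr (fun t ht ↦ ?_) (fun t ht ↦ rfl), h2⟩
      have h0 : z.1 + extendIcc (primitive E (θ z)) 0 = z.1 := by
        rw [extendIcc_primitive_zero, add_zero]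
      have := hX _ _ h1 (by rw [h2, h0]; exact hz')
        (fun t ht ↦ (norm_extendIcc_le _ _).trans_lt (hθ z hz').2.1) t ht
      rw [h2, h0] at this
      exact this.symm
  · have hball : (γ 0, w 0) ∈ Metric.ball (x₀, (0 : E)) ρ := by
      rw [Metric.mem_ball, Prod.dist_eq, max_lt_iff]
      exact ⟨h0.trans_le (min_le_left _ _), by
        simpa using (hw 0 (left_mem_Icc.2 zero_le_one)).trans_le (min_le_left _ _)⟩
    exact hX γ w hγ hball fun t ht ↦ (hw t ht).trans_le (min_le_right _ _)

end Exponential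

/-! ### The Gauss lemma. -/

section Gauss

variable {E : Type*} [NormedAddCommGroup E] [NormedSpace ℝ E] [FiniteDimensional ℝ E]
  {g : E → E →L[ℝ] E →L[ℝ] ℝ} {e : E → E} {r : ℝ}

theorem smul_mem_ball_zero {v : E} (hv : v ∈ Metric.ball (0 : E) r) {t : ℝ}
    (ht : t ∈ Icc (0 : ℝ) 1) : t • v ∈ Metric.ball (0 : E) r := by
  rw [mem_ball_zero_iff] at hv ⊢
  rw [norm_smul, Real.norm_of_nonneg ht.1]
  exact (mul_le_of_le_one_left (norm_nonneg _) ht.2).trans_lt hv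

theorem hasDerivAt_comp_smul (he : ContDiffOn ℝ ∞ e (Metric.ball 0 r)) {v : E} {t : ℝ}
    (hv : t • v ∈ Metric.ball (0 : E) r) :
    HasDerivAt (fun t : ℝ ↦ e (t • v)) (fderiv ℝ e (t • v) v) t := by
  have h1 : HasFDerivAt e (fderiv ℝ e (t • v)) (t • v) :=
    ((he.contDiffAt (Metric.isOpen_ball.mem_nhds hv)).differentiableAt (by simp)).hasFDerivAt
  have h2 : HasDerivAt (fun t : ℝ ↦ t • v) v t := by
    simpa using (hasDerivAt_id t).smul_const v
  exact h1.comp_hasDerivAt t h2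

/-- The velocity of a radial geodesic is given by the derivative of the exponential map. -/
theorem IsGeod.of_radial (he : ContDiffOn ℝ ∞ e (Metric.ball 0 r)) {v : E} {w : ℝ → E}
    (hv : v ∈ Metric.ball (0 : E) r) (h : IsGeod g (fun t ↦ e (t • v)) w) :
    EqOn (fun t ↦ fderiv ℝ e (t • v) v) w (Icc 0 1) := by
  intro t ht
  exact (uniqueDiffOn_Icc zero_lt_one t ht).eq_deriv _
    (hasDerivAt_comp_smul he (smul_mem_ball_zero hv ht)).hasDerivWithinAt (h.deriv t ht)

set_option maxHeartbeats 1000000 in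
/-- The **Gauss lemma**, for a map `e` whose radial curves are geodesics. -/
theorem gauss_lemma (hg : IsMetric g) (he : ContDiffOn ℝ ∞ e (Metric.ball 0 r))
    (hgeod : ∀ v ∈ Metric.ball (0 : E) r,
      IsGeod g (fun t ↦ e (t • v)) (fun t ↦ fderiv ℝ e (t • v) v))
    (hid : ∀ v, fderiv ℝ e 0 v = v) {v : E} (hv : v ∈ Metric.ball (0 : E) r) (k : E) :
    g (e v) (fderiv ℝ e v v) (fderiv ℝ e v k) = g (e 0) v k := by
  have hball : ∀ u ∈ Metric.ball (0 : E) r, Metric.ball (0 : E) r ∈ 𝓝 u := fun u hu ↦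
    Metric.isOpen_ball.mem_nhds hu
  have hd : ∀ u ∈ Metric.ball (0 : E) r, HasFDerivAt e (fderiv ℝ e u) u := fun u hu ↦
    ((he.contDiffAt (hball u hu)).differentiableAt (by simp)).hasFDerivAt
  have hd2 : ∀ u ∈ Metric.ball (0 : E) r,
      HasFDerivAt (fderiv ℝ e) (fderiv ℝ (fderiv ℝ e) u) u := fun u hu ↦
    (((he.contDiffAt (hball u hu)).fderiv_right (m := ∞) (by simp)).differentiableAt
      (by simp)).hasFDerivAt
  have hsymm : ∀ u ∈ Metric.ball (0 : E) r, ∀ a b,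
      fderiv ℝ (fderiv ℝ e) u a b = fderiv ℝ (fderiv ℝ e) u b a := fun u hu a b ↦
    ((he.contDiffAt (hball u hu)).isSymmSndFDerivAt
      (by simp only [minSmoothness_of_isRCLikeNormedField]; exact ENat.LEInfty.out)).eq a b
  -- the variation of the energy
  have hvar : ∀ t ∈ Icc (0 : ℝ) 1,
      fderiv ℝ g (e (t • v)) (t • fderiv ℝ e (t • v) k) (fderiv ℝ e (t • v) v)
          (fderiv ℝ e (t • v) v)
        + 2 * g (e (t • v)) (fderiv ℝ e (t • v) v)
          (fderiv ℝ e (t • v) k + t • fderiv ℝ (fderiv ℝ e) (t • v) v k) = 2 * g (e 0) v k := by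
    intro t ht
    have htv := smul_mem_ball_zero hv ht
    have hs : HasFDerivAt (fun u : E ↦ t • u) (t • ContinuousLinearMap.id ℝ E) v :=
      (hasFDerivAt_id v).const_smul t
    have h1 : HasFDerivAt (fun u ↦ e (t • u)) _ v := (hd _ htv).comp v hs
    have h2 : HasFDerivAt (fun u ↦ fderiv ℝ e (t • u) u) _ v :=
      (HasFDerivAt.comp (g := fderiv ℝ e) v (hd2 _ htv) hs).clm_apply (hasFDerivAt_id v)
    have h3 : HasFDerivAt (fun u ↦ g (e (t • u))) _ v :=
      HasFDerivAt.comp (g := g) v (hg.hasFDerivAt (e (t • v))) h1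
    have h4 := (h3.clm_apply h2).clm_apply h2
    have h5 : HasFDerivAt (fun u ↦ g (e 0) u u) _ v :=
      ((g (e 0)).hasFDerivAt (x := v)).clm_apply (hasFDerivAt_id v)
    -- Conservation of energy at the fixed time `t`, as an identity in the initial velocity `u` near
    -- `v`. Differentiating it in the direction `k` gives `hvar`.
    have heq : (fun u ↦ g (e (t • u)) (fderiv ℝ e (t • u) u) (fderiv ℝ e (t • u) u))
        =ᶠ[𝓝 v] fun u ↦ g (e 0) u u := by
      filter_upwards [hball v hv] with u hu
      have := (hgeod u hu).energy_eq hg ht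
      simpa [hid] using this
    have h6 := (h5.congr_of_eventuallyEq heq).unique h4
    have h7 := congrArg (fun A : E →L[ℝ] ℝ ↦ A k) h6
    simp only [Function.comp_apply, _root_.add_apply, ContinuousLinearMap.flip_apply,
      ContinuousLinearMap.comp_apply, _root_.smul_apply,
      ContinuousLinearMap.id_apply, map_add, map_smul, smul_eq_mul] at h7
    rw [hsymm _ htv k v, hg.symm _ _ (fderiv ℝ e (t • v) v), hg.symm _ _ (fderiv ℝ e (t • v) v),
      hg.symm _ k v] at h7
    simp only [map_add, map_smul, _root_.smul_apply, smul_eq_mul]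
    linarith
  -- The pairing of the velocity with the variation field `t • de(k)` vanishes at `t = 0`. By the
  -- geodesic equation and `hvar` its derivative is the constant `g (e 0) v k`. The claim is its
  -- value at `t = 1`.
  have key := eqOn_Icc_of_hasDerivWithinAt
    (f := fun t ↦ g (e (t • v)) (fderiv ℝ e (t • v) v) (t • fderiv ℝ e (t • v) k))
    (f' := fun _ ↦ g (e 0) v k) (h := fun t ↦ t * g (e 0) v k) (fun t ht ↦ ?_)
    (fun t _ ↦ by simpa using (hasDerivWithinAt_id t (Icc (0 : ℝ) 1)).mul_const (g (e 0) v k))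
    (by simp) (right_mem_Icc.2 zero_le_one)
  · simpa using key
  have htv := smul_mem_ball_zero hv ht
  have h1 := (hg.hasFDerivAt (e (t • v))).comp_hasDerivWithinAt t ((hgeod v hv).deriv t ht)
  have hs : HasDerivWithinAt (fun t : ℝ ↦ t • v) v (Icc 0 1) t := by
    simpa using (hasDerivWithinAt_id t (Icc (0 : ℝ) 1)).smul_const v
  have h2 := (hasDerivWithinAt_id t (Icc (0 : ℝ) 1)).fun_smul
    (((hd2 _ htv).comp_hasDerivWithinAt t hs).clm_apply (hasDerivWithinAt_const t (Icc 0 1) k))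
  have h3 := (h1.clm_apply ((hgeod v hv).deriv₂ t ht)).clm_apply h2
  convert! h3 using 1
  have hv' := hvar t ht
  simp only [Function.comp_apply, id_eq, _root_.add_apply, map_add, map_neg, map_smul,
    _root_.neg_apply, _root_.smul_apply, smul_eq_mul, one_smul, map_zero, add_zero] at hv' ⊢
  have hsp : g (e (t • v)) (spray g (e (t • v)) (fderiv ℝ e (t • v) v) (fderiv ℝ e (t • v) v))
      (fderiv ℝ e (t • v) k) = _ := hg.apply_spray _ _ _ _
  rw [hsp, chr]
  linarith

end Gauss

/-! ### Totally normal neighbourhoods: the exponential map and its inverse. -/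

section Normal

universe u

variable {E : Type u} [NormedAddCommGroup E] [NormedSpace ℝ E] [FiniteDimensional ℝ E]
  [CompleteSpace E] {g : E → E →L[ℝ] E →L[ℝ] ℝ} {x₀ : E} {R ρ σ : ℝ} {X L : E × E → E}

/-- `X` is an exponential map for the metric `g` near `x₀`, and `L (x, y)` is the initial velocity
of the short geodesic from `x` to `y`. -/
structure IsNormal (g : E → E →L[ℝ] E →L[ℝ] ℝ) (x₀ : E) (R ρ σ : ℝ) (X L : E × E → E) : Prop where
  ρ_pos : 0 < ρ
  σ_pos : 0 < σ
  ρ_le : ρ ≤ R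
  contDiffOn_exp : ContDiffOn ℝ ∞ X (Metric.ball x₀ ρ ×ˢ Metric.ball 0 σ)
  contDiffOn_log : ContDiffOn ℝ ∞ L (Metric.ball x₀ ρ ×ˢ Metric.ball x₀ ρ)
  exp_mem : ∀ x ∈ Metric.ball x₀ ρ, ∀ v ∈ Metric.ball (0 : E) σ, X (x, v) ∈ Metric.ball x₀ R
  exp_zero : ∀ x ∈ Metric.ball x₀ ρ, X (x, 0) = x
  fderiv_exp_zero : ∀ x ∈ Metric.ball x₀ ρ, ∀ v, fderiv ℝ (fun u ↦ X (x, u)) 0 v = v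
  geod : ∀ x ∈ Metric.ball x₀ ρ, ∀ v ∈ Metric.ball (0 : E) σ,
    IsGeod g (fun t ↦ X (x, t • v)) (fun t ↦ fderiv ℝ (fun u ↦ X (x, u)) (t • v) v)
  log_exp : ∀ x ∈ Metric.ball x₀ ρ, ∀ v ∈ Metric.ball (0 : E) σ, L (x, X (x, v)) = v
  log_mem : ∀ x ∈ Metric.ball x₀ ρ, ∀ y ∈ Metric.ball x₀ ρ, L (x, y) ∈ Metric.ball (0 : E) σ
  exp_log : ∀ x ∈ Metric.ball x₀ ρ, ∀ y ∈ Metric.ball x₀ ρ, X (x, L (x, y)) = y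
  unique : ∀ γ w, IsGeod g γ w → γ 0 ∈ Metric.ball x₀ ρ → (∀ t ∈ Icc (0 : ℝ) 1, ‖w t‖ < σ) →
    ∀ t ∈ Icc (0 : ℝ) 1, γ t = X (γ 0, t • w 0)

/-- For small `v` this is the initial velocity of the radial geodesic; the general case follows by
linearity. -/
theorem fderiv_zero_eq_of_radial {e : E → E} {r : ℝ} (hr : 0 < r)
    (he : ContDiffOn ℝ ∞ e (Metric.ball 0 r))
    (h : ∀ v ∈ Metric.ball (0 : E) r, ∃ w, IsGeod g (fun t ↦ e (t • v)) w ∧ w 0 = v) (v : E) :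
    fderiv ℝ e 0 v = v := by
  have hsmall : ∀ v ∈ Metric.ball (0 : E) r, fderiv ℝ e 0 v = v := by
    intro v hv
    obtain ⟨w, hw, hw0⟩ := h v hv
    have := hw.of_radial he hv (left_mem_Icc.2 zero_le_one)
    simpa [hw0] using this
  have hpos : 0 < r / (2 * (‖v‖ + 1)) := by positivity
  have hmem : (r / (2 * (‖v‖ + 1))) • v ∈ Metric.ball (0 : E) r := by
    rw [mem_ball_zero_iff, norm_smul, Real.norm_of_nonneg hpos.le, div_mul_eq_mul_div,
      div_lt_iff₀ (by positivity)]
    nlinarith [norm_nonneg v]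
  have h1 := hsmall _ hmem
  rw [map_smul] at h1
  exact smul_right_injective E hpos.ne' h1

/-- Every point of a vector space with a metric has a totally normal neighbourhood. -/
theorem IsMetric.exists_isNormal (hg : IsMetric g) (x₀ : E) (hR : 0 < R) :
    ∃ ρ σ X L, IsNormal g x₀ R ρ σ X L := by
  obtain ⟨r, hr, X, hXs, hX, hXu⟩ := hg.exists_exp x₀
  have hmem : ∀ {x v : E}, (x, v) ∈ Metric.ball (x₀, (0 : E)) r ↔
      x ∈ Metric.ball x₀ r ∧ v ∈ Metric.ball (0 : E) r := by
    intro x v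
    rw [← ball_prod_same, mem_prod]
  have h0r : (0 : E) ∈ Metric.ball (0 : E) r := Metric.mem_ball_self hr
  have hx0r : x₀ ∈ Metric.ball x₀ r := Metric.mem_ball_self hr
  have hes : ∀ x ∈ Metric.ball x₀ r, ContDiffOn ℝ ∞ (fun u ↦ X (x, u)) (Metric.ball 0 r) :=
    fun x hx ↦ hXs.comp (contDiff_const.prodMk contDiff_id).contDiffOn fun u hu ↦ hmem.2 ⟨hx, hu⟩
  have hX0 : ∀ x ∈ Metric.ball x₀ r, X (x, 0) = x := fun x hx ↦ (hX (x, 0) (hmem.2 ⟨hx, h0r⟩)).1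
  have hrad : ∀ x ∈ Metric.ball x₀ r, ∀ v ∈ Metric.ball (0 : E) r,
      ∃ w, IsGeod g (fun t ↦ X (x, t • v)) w ∧ w 0 = v := fun x hx v hv ↦
    (hX (x, v) (hmem.2 ⟨hx, hv⟩)).2
  have hid : ∀ x ∈ Metric.ball x₀ r, ∀ v, fderiv ℝ (fun u ↦ X (x, u)) 0 v = v := fun x hx v ↦
    fderiv_zero_eq_of_radial hr (hes x hx) (hrad x hx) v
  -- the derivative of `(x, v) ↦ (x, X (x, v))`
  have hD : HasFDerivAt X (fderiv ℝ X (x₀, 0)) (x₀, 0) :=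
    ((hXs.contDiffAt (Metric.isOpen_ball.mem_nhds (hmem.2 ⟨hx0r, h0r⟩))).differentiableAt
      (by simp)).hasFDerivAt
  have hDl : ∀ h, fderiv ℝ X (x₀, 0) (h, 0) = h := by
    intro h
    have h1 : HasFDerivAt (fun x ↦ X (x, 0)) _ x₀ :=
      HasFDerivAt.comp (g := X) x₀ hD ((hasFDerivAt_id x₀).prodMk (hasFDerivAt_const (0 : E) x₀))
    have h2 : HasFDerivAt (fun x ↦ X (x, 0)) (ContinuousLinearMap.id ℝ E) x₀ := by
      refine (hasFDerivAt_id x₀).congr_of_eventuallyEq ?_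
      filter_upwards [Metric.isOpen_ball.mem_nhds hx0r] with x hx using hX0 x hx
    simpa using congrArg (fun A : E →L[ℝ] E ↦ A h) (h1.unique h2)
  have hDr : ∀ k, fderiv ℝ X (x₀, 0) (0, k) = k := by
    intro k
    have h1 : HasFDerivAt (fun u ↦ X (x₀, u)) _ (0 : E) :=
      HasFDerivAt.comp (g := X) (0 : E) hD
        ((hasFDerivAt_const x₀ (0 : E)).prodMk (hasFDerivAt_id (0 : E)))
    have h2 := hid x₀ hx0r k
    rw [h1.fderiv] at h2
    simpa using h2
  -- Since `X (x, 0) = x` and `X (x₀, ·)` has the identity as derivative at `0`, the derivative of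
  -- `(x, v) ↦ (x, X (x, v))` is `(h, k) ↦ (h, h + k)`, with inverse `(h, k) ↦ (h, k - h)`.
  let e : (E × E) ≃L[ℝ] (E × E) := ContinuousLinearEquiv.equivOfInverse
    ((ContinuousLinearMap.fst ℝ E E).prod
      (ContinuousLinearMap.fst ℝ E E + ContinuousLinearMap.snd ℝ E E))
    ((ContinuousLinearMap.fst ℝ E E).prod
      (ContinuousLinearMap.snd ℝ E E - ContinuousLinearMap.fst ℝ E E))
    (fun z ↦ by ext <;> simp) (fun z ↦ by ext <;> simp)
  have he : HasFDerivAt (fun z : E × E ↦ (z.1, X z)) (e : E × E →L[ℝ] E × E) (x₀, 0) := by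
    convert! (hasFDerivAt_fst (𝕜 := ℝ) (p := (x₀, (0 : E)))).prodMk hD using 1
    refine ContinuousLinearMap.ext fun z ↦ ?_
    have : fderiv ℝ X (x₀, 0) z = z.1 + z.2 := by
      have hz : z = (z.1, 0) + (0, z.2) := by simp
      conv_lhs => rw [hz, map_add, hDl, hDr]
    simp only [ContinuousLinearMap.prod_apply, this]
    rfl
  obtain ⟨Ψ, hΨ0, hΨsub, hΨf, hΨs⟩ := exists_openPartialHomeomorph_contDiffOn
    Metric.isOpen_ball (contDiff_fst.contDiffOn.prodMk hXs) (hmem.2 ⟨hx0r, h0r⟩) e he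
  have hΨ00 : Ψ (x₀, 0) = (x₀, x₀) := by
    rw [hΨf]
    exact Prod.ext rfl (hX0 x₀ hx0r)
  have h0t : (x₀, x₀) ∈ Ψ.target := by
    rw [← hΨ00]; exact Ψ.map_source hΨ0
  have hsymm0 : Ψ.symm (x₀, x₀) = (x₀, 0) := by
    rw [← hΨ00]; exact Ψ.left_inv hΨ0
  obtain ⟨σ₁, hσ₁, hσ₁s⟩ : ∃ σ > 0, Metric.ball (x₀, (0 : E)) σ ⊆
      Ψ.source ∩ X ⁻¹' Metric.ball x₀ R := by
    refine Metric.mem_nhds_iff.1 (inter_mem (Ψ.open_source.mem_nhds hΨ0) ?_)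
    refine hD.continuousAt.preimage_mem_nhds ?_
    rw [hX0 x₀ hx0r]
    exact Metric.ball_mem_nhds _ hR
  set σ := min σ₁ r with hσ
  have hσpos : 0 < σ := lt_min hσ₁ hr
  obtain ⟨ρ₁, hρ₁, hρ₁s⟩ : ∃ ρ > 0, Metric.ball (x₀, x₀) ρ ⊆
      Ψ.target ∩ Ψ.symm ⁻¹' Metric.ball (x₀, 0) σ := by
    refine Metric.mem_nhds_iff.1 (inter_mem (Ψ.open_target.mem_nhds h0t) ?_)
    refine (Ψ.symm.continuousAt h0t).preimage_mem_nhds ?_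
    rw [hsymm0]
    exact Metric.ball_mem_nhds _ hσpos
  set ρ := min ρ₁ (min σ R) with hρ
  have hρσ : ρ ≤ σ := (min_le_right _ _).trans (min_le_left _ _)
  have hsrc : ∀ x ∈ Metric.ball x₀ ρ, ∀ v ∈ Metric.ball (0 : E) σ,
      (x, v) ∈ Metric.ball (x₀, (0 : E)) σ₁ := by
    intro x hx v hv
    rw [← ball_prod_same]
    exact ⟨Metric.ball_subset_ball (hρσ.trans (min_le_left _ _)) hx,
      Metric.ball_subset_ball (min_le_left _ _) hv⟩
  have hxr : ∀ x ∈ Metric.ball x₀ ρ, x ∈ Metric.ball x₀ r := fun x hx ↦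
    Metric.ball_subset_ball (hρσ.trans (min_le_right _ _)) hx
  have hvr : ∀ v ∈ Metric.ball (0 : E) σ, v ∈ Metric.ball (0 : E) r := fun v hv ↦
    Metric.ball_subset_ball (min_le_right _ _) hv
  have htgt : ∀ x ∈ Metric.ball x₀ ρ, ∀ y ∈ Metric.ball x₀ ρ,
      (x, y) ∈ Ψ.target ∩ Ψ.symm ⁻¹' Metric.ball (x₀, 0) σ := by
    intro x hx y hy
    refine hρ₁s ?_
    rw [← ball_prod_same]
    exact ⟨Metric.ball_subset_ball (min_le_left _ _) hx,
      Metric.ball_subset_ball (min_le_left _ _) hy⟩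
  have hfib : ∀ z ∈ Ψ.target, (Ψ.symm z).1 = z.1 ∧ X (Ψ.symm z) = z.2 := by
    intro z hz
    have := Ψ.right_inv hz
    rw [hΨf] at this
    exact Prod.ext_iff.1 this
  refine ⟨ρ, σ, X, fun z ↦ (Ψ.symm z).2, ?_⟩
  refine ⟨lt_min hρ₁ (lt_min hσpos hR), hσpos, (min_le_right _ _).trans (min_le_right _ _),
    ?_, ?_, ?_, fun x hx ↦ hX0 x (hxr x hx), fun x hx ↦ hid x (hxr x hx), ?_, ?_, ?_, ?_, ?_⟩
  · exact hXs.mono fun z hz ↦ hmem.2 ⟨hxr _ hz.1, hvr _ hz.2⟩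
  · exact contDiff_snd.comp_contDiffOn (hΨs.mono fun z hz ↦ (htgt _ hz.1 _ hz.2).1)
  · exact fun x hx v hv ↦ (hσ₁s (hsrc x hx v hv)).2
  · intro x hx v hv
    obtain ⟨w, hw, -⟩ := hrad x (hxr x hx) v (hvr v hv)
    exact hw.congr (fun _ _ ↦ rfl) (hw.of_radial (hes x (hxr x hx)) (hvr v hv))
  · intro x hx v hv
    have := Ψ.left_inv (hσ₁s (hsrc x hx v hv)).1
    rw [hΨf] at this
    rw [this]
  · intro x hx y hy
    have := (htgt x hx y hy).2
    rw [mem_preimage, ← ball_prod_same] at this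
    exact this.2
  · intro x hx y hy
    obtain ⟨h1, h2⟩ := hfib _ (htgt x hx y hy).1
    have h3 : Ψ.symm (x, y) = (x, (Ψ.symm (x, y)).2) := Prod.ext h1 rfl
    rwa [h3] at h2
  · intro γ w hγ h0 hw
    exact hXu γ w hγ (hxr _ h0) fun t ht ↦ (hw t ht).trans_le (min_le_right _ _)

namespace IsNormal

variable (hN : IsNormal g x₀ R ρ σ X L)
include hN

theorem mem_center : x₀ ∈ Metric.ball x₀ ρ := Metric.mem_ball_self hN.ρ_pos

theorem contDiffOn_exp_right {x : E} (hx : x ∈ Metric.ball x₀ ρ) :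
    ContDiffOn ℝ ∞ (fun u ↦ X (x, u)) (Metric.ball 0 σ) :=
  hN.contDiffOn_exp.comp (contDiff_const.prodMk contDiff_id).contDiffOn fun _ hu ↦ ⟨hx, hu⟩

theorem contDiffOn_log_right {x : E} (hx : x ∈ Metric.ball x₀ ρ) :
    ContDiffOn ℝ ∞ (fun y ↦ L (x, y)) (Metric.ball x₀ ρ) :=
  hN.contDiffOn_log.comp (contDiff_const.prodMk contDiff_id).contDiffOn fun _ hu ↦ ⟨hx, hu⟩

theorem log_self {x : E} (hx : x ∈ Metric.ball x₀ ρ) : L (x, x) = 0 := by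
  have := hN.log_exp x hx 0 (Metric.mem_ball_self hN.σ_pos)
  rwa [hN.exp_zero x hx] at this

theorem hasFDerivAt_log {x y : E} (hx : x ∈ Metric.ball x₀ ρ) (hy : y ∈ Metric.ball x₀ ρ) :
    HasFDerivAt (fun y ↦ L (x, y)) (fderiv ℝ (fun y ↦ L (x, y)) y) y :=
  (((hN.contDiffOn_log_right hx).contDiffAt (Metric.isOpen_ball.mem_nhds hy)).differentiableAt
    (by simp)).hasFDerivAt

theorem fderiv_exp_fderiv_log {x y : E} (hx : x ∈ Metric.ball x₀ ρ) (hy : y ∈ Metric.ball x₀ ρ)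
    (ξ : E) :
    fderiv ℝ (fun u ↦ X (x, u)) (L (x, y)) (fderiv ℝ (fun y ↦ L (x, y)) y ξ) = ξ := by
  have h1 : HasFDerivAt (fun u ↦ X (x, u)) (fderiv ℝ (fun u ↦ X (x, u)) (L (x, y))) (L (x, y)) :=
    (((hN.contDiffOn_exp_right hx).contDiffAt
      (Metric.isOpen_ball.mem_nhds (hN.log_mem x hx y hy))).differentiableAt (by simp)).hasFDerivAt
  have h2 : HasFDerivAt (fun y ↦ X (x, L (x, y))) _ y :=
    HasFDerivAt.comp (g := fun u ↦ X (x, u)) y h1 (hN.hasFDerivAt_log hx hy)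
  have h3 : HasFDerivAt (fun y ↦ X (x, L (x, y))) (ContinuousLinearMap.id ℝ E) y := by
    refine (hasFDerivAt_id y).congr_of_eventuallyEq ?_
    filter_upwards [Metric.isOpen_ball.mem_nhds hy] with y' hy' using hN.exp_log x hx y' hy'
  exact congrArg (fun A : E →L[ℝ] E ↦ A ξ) (h2.unique h3)

theorem gauss (hg : IsMetric g) {x v : E} (hx : x ∈ Metric.ball x₀ ρ)
    (hv : v ∈ Metric.ball (0 : E) σ) (k : E) :
    g (X (x, v)) (fderiv ℝ (fun u ↦ X (x, u)) v v) (fderiv ℝ (fun u ↦ X (x, u)) v k) = g x v k := by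
  have := gauss_lemma hg (hN.contDiffOn_exp_right hx) (hN.geod x hx) (hN.fderiv_exp_zero x hx) hv k
  rwa [hN.exp_zero x hx] at this

/-- The squared distance to `x`, in normal coordinates. -/
theorem hasFDerivAt_sq {x y : E} (hx : x ∈ Metric.ball x₀ ρ) (hy : y ∈ Metric.ball x₀ ρ) :
    HasFDerivAt (fun y ↦ g x (L (x, y)) (L (x, y)))
      ((g x (L (x, y))).comp (fderiv ℝ (fun y ↦ L (x, y)) y) +
        ((g x).comp (fderiv ℝ (fun y ↦ L (x, y)) y)).flip (L (x, y))) y :=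
  (HasFDerivAt.comp (g := g x) y (g x).hasFDerivAt (hN.hasFDerivAt_log hx hy)).clm_apply
    (hN.hasFDerivAt_log hx hy)

/-- The gradient of the squared distance has norm at most twice the distance. -/
theorem abs_fderiv_sq_le (hg : IsMetric g) {x y : E} (hx : x ∈ Metric.ball x₀ ρ)
    (hy : y ∈ Metric.ball x₀ ρ) (ξ : E) :
    |fderiv ℝ (fun y ↦ g x (L (x, y)) (L (x, y))) y ξ|
      ≤ 2 * √(g x (L (x, y)) (L (x, y))) * √(g y ξ ξ) := by
  have hv := hN.log_mem x hx y hy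
  -- Every `ξ` at `y` is the image under `d exp` of its image under `dL`. The Gauss lemma thus turns
  -- the derivative into a pairing at `y` of `ξ` with the radial velocity, to which Cauchy–Schwarz
  -- applies.
  have h1 := hN.gauss hg hx hv (fderiv ℝ (fun y ↦ L (x, y)) y ξ)
  rw [hN.fderiv_exp_fderiv_log hx hy, hN.exp_log x hx y hy] at h1
  have h2 := hN.gauss hg hx hv (L (x, y))
  rw [hN.exp_log x hx y hy] at h2
  rw [(hN.hasFDerivAt_sq hx hy).fderiv]
  simp only [_root_.add_apply, ContinuousLinearMap.comp_apply, ContinuousLinearMap.flip_apply]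
  rw [hg.symm x _ (L (x, y)), ← h1, ← h2, ← two_mul, abs_mul, abs_two, mul_assoc]
  exact mul_le_mul_of_nonneg_left (hg.abs_apply_le _ _ _) zero_le_two

end IsNormal

end Normal

/-! ### Convexity of the squared distance to the center. -/

section Convexity

/-- A function on `[0, 1]` whose second derivative is at least `κ` lies below its chord. -/
theorem le_chord_of_le_deriv₂ {h a b : ℝ → ℝ} {κ : ℝ}
    (hh : ∀ t ∈ Icc (0 : ℝ) 1, HasDerivWithinAt h (a t) (Icc 0 1) t)
    (ha : ∀ t ∈ Icc (0 : ℝ) 1, HasDerivWithinAt a (b t) (Icc 0 1) t)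
    (hb : ∀ t ∈ Icc (0 : ℝ) 1, κ ≤ b t) {t : ℝ} (ht : t ∈ Icc (0 : ℝ) 1) :
    h t ≤ (1 - t) * h 0 + t * h 1 - κ / 2 * (t * (1 - t)) := by
  have hq : ∀ t, HasDerivAt (fun t : ℝ ↦ κ / 2 * t ^ 2) (κ * t) t := fun t ↦ by
    have := (hasDerivAt_pow 2 t).const_mul (κ / 2)
    convert! this using 1
    simp
    ring
  have hl : ∀ t, HasDerivAt (fun t : ℝ ↦ κ * t) κ t := fun t ↦ by
    simpa using (hasDerivAt_id t).const_mul κ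
  have hint : ∀ t ∈ interior (Icc (0 : ℝ) 1), t ∈ Icc (0 : ℝ) 1 ∧ Icc (0 : ℝ) 1 ∈ 𝓝 t := by
    intro t ht
    exact ⟨interior_subset ht, mem_interior_iff_mem_nhds.1 ht⟩
  have hd1 : ∀ t ∈ interior (Icc (0 : ℝ) 1),
      HasDerivAt (fun t ↦ h t - κ / 2 * t ^ 2) (a t - κ * t) t := fun t ht ↦
    ((hh t (hint t ht).1).hasDerivAt (hint t ht).2).sub (hq t)
  have hmono : MonotoneOn (fun t ↦ a t - κ * t) (interior (Icc (0 : ℝ) 1)) := by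
    refine (monotoneOn_of_deriv_nonneg (convex_Icc 0 1) ?_ ?_ ?_).mono interior_subset
    · exact fun t ht ↦ ((ha t ht).sub (hl t).hasDerivWithinAt).continuousWithinAt
    · exact fun t ht ↦ (((ha t (hint t ht).1).hasDerivAt (hint t ht).2).sub
        (hl t)).differentiableAt.differentiableWithinAt
    · intro t ht
      have := ((ha t (hint t ht).1).hasDerivAt (hint t ht).2).sub (hl t)
      have h2 : deriv (fun t ↦ a t - κ * t) t = b t - κ := this.deriv
      rw [h2, sub_nonneg]
      exact hb t (hint t ht).1
  -- Removing `κ t² / 2` leaves a convex function; its chord inequality produces the correction `κ /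
  -- 2 * (t - t²)`.
  have hconv : ConvexOn ℝ (Icc (0 : ℝ) 1) (fun t ↦ h t - κ / 2 * t ^ 2) := by
    refine MonotoneOn.convexOn_of_deriv (convex_Icc 0 1) ?_ ?_ ?_
    · exact fun t ht ↦ ((hh t ht).sub (hq t).hasDerivWithinAt).continuousWithinAt
    · exact fun t ht ↦ (hd1 t ht).differentiableAt.differentiableWithinAt
    · exact hmono.congr fun t ht ↦ (hd1 t ht).deriv.symm
  have := hconv.2 (left_mem_Icc.2 zero_le_one) (right_mem_Icc.2 zero_le_one)
    (sub_nonneg.2 ht.2) ht.1 (by ring)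
  simp only [smul_eq_mul, mul_zero, mul_one, zero_add] at this
  nlinarith

universe u

variable {E : Type u} [NormedAddCommGroup E] [NormedSpace ℝ E] [FiniteDimensional ℝ E]
  [CompleteSpace E] {g : E → E →L[ℝ] E →L[ℝ] ℝ} {x₀ : E} {R ρ σ : ℝ} {X L : E × E → E}

/-- The second derivative along a geodesic of the squared distance to `x₀`. -/
def hessSq (g : E → E →L[ℝ] E →L[ℝ] ℝ) (x₀ : E) (L : E × E → E) (y w : E) : ℝ :=
  2 * g x₀ (fderiv ℝ (fun y ↦ L (x₀, y)) y w) (fderiv ℝ (fun y ↦ L (x₀, y)) y w)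
    + 2 * g x₀ (L (x₀, y)) (fderiv ℝ (fderiv ℝ (fun y ↦ L (x₀, y))) y w w
      - fderiv ℝ (fun y ↦ L (x₀, y)) y (spray g y w w))

namespace IsNormal

variable (hN : IsNormal g x₀ R ρ σ X L)
include hN

theorem exists_hasDerivWithinAt_sq (hg : IsMetric g) {γ w : ℝ → E} (hγ : IsGeod g γ w)
    (hm : MapsTo γ (Icc 0 1) (Metric.ball x₀ ρ)) :
    ∃ a : ℝ → ℝ, (∀ t ∈ Icc (0 : ℝ) 1,
        HasDerivWithinAt (fun t ↦ g x₀ (L (x₀, γ t)) (L (x₀, γ t))) (a t) (Icc 0 1) t) ∧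
      ∀ t ∈ Icc (0 : ℝ) 1, HasDerivWithinAt a (hessSq g x₀ L (γ t) (w t)) (Icc 0 1) t := by
  have hx₀ := hN.mem_center
  have hs := hN.contDiffOn_log_right hx₀
  set ℓ : E → E := fun y ↦ L (x₀, y) with hℓ
  have hd2 : ∀ y ∈ Metric.ball x₀ ρ, HasFDerivAt (fderiv ℝ ℓ) (fderiv ℝ (fderiv ℝ ℓ) y) y :=
    fun y hy ↦ (((hs.contDiffAt (Metric.isOpen_ball.mem_nhds hy)).fderiv_right (m := ∞)
      (by simp)).differentiableAt (by simp)).hasFDerivAt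
  have h1 : ∀ t ∈ Icc (0 : ℝ) 1,
      HasDerivWithinAt (fun t ↦ ℓ (γ t)) (fderiv ℝ ℓ (γ t) (w t)) (Icc 0 1) t := fun t ht ↦
    (hN.hasFDerivAt_log hx₀ (hm ht)).comp_hasDerivWithinAt t (hγ.deriv t ht)
  have h2 : ∀ t ∈ Icc (0 : ℝ) 1,
      HasDerivWithinAt (fun t ↦ fderiv ℝ ℓ (γ t) (w t))
        (fderiv ℝ (fderiv ℝ ℓ) (γ t) (w t) (w t)
          + fderiv ℝ ℓ (γ t) (-(spray g (γ t) (w t) (w t)))) (Icc 0 1) t := fun t ht ↦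
    ((hd2 _ (hm ht)).comp_hasDerivWithinAt t (hγ.deriv t ht)).clm_apply (hγ.deriv₂ t ht)
  have h3 : ∀ {a b : ℝ → E} {a' b' : E} {t : ℝ}, HasDerivWithinAt a a' (Icc 0 1) t →
      HasDerivWithinAt b b' (Icc 0 1) t →
      HasDerivWithinAt (fun t ↦ g x₀ (a t) (b t)) (g x₀ a' (b t) + g x₀ (a t) b') (Icc 0 1) t :=
    fun {a b a' b' t} ha hb ↦
      ((g x₀).hasFDerivAt.comp_hasDerivWithinAt t ha).clm_apply hb
  refine ⟨fun t ↦ 2 * g x₀ (ℓ (γ t)) (fderiv ℝ ℓ (γ t) (w t)), fun t ht ↦ ?_, fun t ht ↦ ?_⟩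
  · convert! h3 (h1 t ht) (h1 t ht) using 1
    rw [hg.symm x₀ (fderiv ℝ ℓ (γ t) (w t))]
    ring
  · convert! (h3 (h1 t ht) (h2 t ht)).const_mul 2 using 1
    rw [hessSq, mul_add, map_neg, ← sub_eq_add_neg]

/-- At the center `L (x₀, ·)` vanishes and its derivative is the identity, so the Hessian there is
`2g`. The strict inequality `g < 2g` persists near `x₀`, uniformly over the compact unit sphere, and
both sides are homogeneous of degree two. -/
theorem exists_le_hessSq (hg : IsMetric g) : ∃ ρ' > 0, ρ' ≤ ρ ∧
    ∀ y ∈ Metric.ball x₀ ρ', ∀ w, g y w w ≤ hessSq g x₀ L y w := by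
  have hx₀ := hN.mem_center
  have hs := (hN.contDiffOn_log_right hx₀).contDiffAt (Metric.isOpen_ball.mem_nhds hx₀)
  have hc0 : ContinuousAt (fun y ↦ L (x₀, y)) x₀ := hs.continuousAt
  have hs1 : ContDiffAt ℝ ∞ (fderiv ℝ (fun y ↦ L (x₀, y))) x₀ :=
    hs.fderiv_right (m := ∞) (by simp)
  have hc1 : ContinuousAt (fderiv ℝ (fun y ↦ L (x₀, y))) x₀ := hs1.continuousAt
  have hc2 : ContinuousAt (fderiv ℝ (fderiv ℝ (fun y ↦ L (x₀, y)))) x₀ :=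
    (hs1.fderiv_right (m := ∞) (by simp)).continuousAt
  have hid : ∀ w, fderiv ℝ (fun y ↦ L (x₀, y)) x₀ w = w := by
    intro w
    have := hN.fderiv_exp_fderiv_log hx₀ hx₀ w
    rwa [hN.log_self hx₀, hN.fderiv_exp_zero x₀ hx₀] at this
  have hev : ∀ᶠ y in 𝓝 x₀, ∀ w ∈ Metric.sphere (0 : E) 1, g y w w < hessSq g x₀ L y w := by
    have := FiniteDimensional.proper ℝ E
    refine (isCompact_sphere (0 : E) 1).eventually_forall_of_forall_eventually fun w hw ↦ ?_
    have hpos : g x₀ w w < hessSq g x₀ L x₀ w := by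
      rw [hessSq, hid, hN.log_self hx₀]
      have hw0 : w ≠ 0 := by
        rintro rfl
        simp at hw
      have := hg.pos x₀ w hw0
      simp
      linarith
    have hf : Tendsto (fun z : E × E ↦ z.1) (𝓝 (x₀, w)) (𝓝 x₀) := continuousAt_fst
    have hsn : ContinuousAt (fun z : E × E ↦ z.2) (x₀, w) := continuousAt_snd
    have k0 : ContinuousAt (fun z : E × E ↦ L (x₀, z.1)) (x₀, w) := hc0.tendsto.comp hf
    have k1 : ContinuousAt (fun z : E × E ↦ fderiv ℝ (fun y ↦ L (x₀, y)) z.1) (x₀, w) :=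
      hc1.tendsto.comp hf
    have k2 : ContinuousAt (fun z : E × E ↦ fderiv ℝ (fderiv ℝ (fun y ↦ L (x₀, y))) z.1)
        (x₀, w) := hc2.tendsto.comp hf
    have k3 : ContinuousAt (fun z : E × E ↦ spray g z.1) (x₀, w) :=
      hg.contDiff_spray.continuous.continuousAt.tendsto.comp hf
    have k4 : ContinuousAt (fun z : E × E ↦ g z.1) (x₀, w) :=
      hg.contDiff.continuous.continuousAt.tendsto.comp hf
    have k5 := k1.clm_apply hsn
    have k6 : ContinuousAt (fun z : E × E ↦ hessSq g x₀ L z.1 z.2) (x₀, w) := by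
      have c : ∀ {u v : E × E → E}, ContinuousAt u (x₀, w) → ContinuousAt v (x₀, w) →
          ContinuousAt (fun z ↦ g x₀ (u z) (v z)) (x₀, w) := fun hu hv ↦
        ((g x₀).continuous.continuousAt.comp hu).clm_apply hv
      exact ((c k5 k5).const_mul 2).add ((c k0 (((k2.clm_apply hsn).clm_apply hsn).sub
        (k1.clm_apply ((k3.clm_apply hsn).clm_apply hsn)))).const_mul 2)
    have k7 : ContinuousAt (fun z : E × E ↦ g z.1 z.2 z.2) (x₀, w) :=
      (k4.clm_apply hsn).clm_apply hsn
    exact k7.eventually_lt k6 hpos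
  obtain ⟨ρ₁, hρ₁, H⟩ := Metric.mem_nhds_iff.1 hev
  refine ⟨min ρ₁ ρ, lt_min hρ₁ hN.ρ_pos, min_le_right _ _, fun y hy w ↦ ?_⟩
  have hy' := H (Metric.ball_subset_ball (min_le_left _ _) hy)
  rcases eq_or_ne w 0 with rfl | hw
  · simp [hessSq]
  have hn : ‖w‖ ≠ 0 := norm_ne_zero_iff.2 hw
  have hu : ‖w‖⁻¹ • w ∈ Metric.sphere (0 : E) 1 := by simp [norm_smul, hn]
  have h1 := (hy' _ hu).le
  have hsc : ∀ c : ℝ, hessSq g x₀ L y (c • w) = c ^ 2 * hessSq g x₀ L y w := by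
    intro c
    simp only [hessSq, map_smul, _root_.smul_apply, smul_eq_mul, map_sub]
    ring
  rw [hsc] at h1
  simp only [map_smul, _root_.smul_apply, smul_eq_mul] at h1
  rw [← mul_assoc, ← sq] at h1
  exact le_of_mul_le_mul_left h1 (by positivity)

end IsNormal

end Convexity

/-! ### Radial geodesics are shortest. -/

section PathLength

open MeasureTheory

universe u

variable {E : Type u} [NormedAddCommGroup E] [NormedSpace ℝ E] [FiniteDimensional ℝ E]
  [CompleteSpace E] {g : E → E →L[ℝ] E →L[ℝ] ℝ} {x₀ : E} {R ρ σ : ℝ} {X L : E × E → E}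

/-- A curve from `x` to `y` is at least as long as the geodesic from `x` to `y`. -/
theorem IsNormal.le_lintegral (hN : IsNormal g x₀ R ρ σ X L) (hg : IsMetric g) {c : ℝ → E}
    (hc : ContDiffOn ℝ 1 c (Icc 0 1)) (hm : MapsTo c (Icc 0 1) (Metric.ball x₀ ρ)) :
    ENNReal.ofReal √(g (c 0) (L (c 0, c 1)) (L (c 0, c 1))) ≤
      ∫⁻ t in Icc (0 : ℝ) 1, ENNReal.ofReal
        √(g (c t) (derivWithin c (Icc 0 1) t) (derivWithin c (Icc 0 1) t)) := by
  have h0 : (0 : ℝ) ∈ Icc (0 : ℝ) 1 := left_mem_Icc.2 zero_le_one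
  have hx := hm h0
  set x := c 0 with hxdef
  set f : E → ℝ := fun y ↦ g x (L (x, y)) (L (x, y)) with hf
  have hfnn : ∀ y, 0 ≤ f y := fun y ↦ hg.nonneg x _
  have hfs : ContDiffOn ℝ 1 f (Metric.ball x₀ ρ) := by
    have h1 : ContDiffOn ℝ 1 (fun y ↦ L (x, y)) (Metric.ball x₀ ρ) :=
      (hN.contDiffOn_log_right hx).of_le (by exact mod_cast le_top)
    exact ((g x).contDiff.comp_contDiffOn h1).clm_apply h1
  refine ENNReal.le_of_forall_pos_le_add fun ε hε _ ↦ ?_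
  have hεpos : (0 : ℝ) < ε := hε
  have hpos : ∀ y, 0 < f y + (ε : ℝ) ^ 2 := fun y ↦ add_pos_of_nonneg_of_pos (hfnn y) (by positivity)
  -- The distance `√f` to the starting point is not differentiable there. The regularization is
  -- `C¹`, still grows no faster than the arc length, and starts at `ε` instead of `0`.
  set F : ℝ → ℝ := fun t ↦ √(f (c t) + (ε : ℝ) ^ 2) with hF
  have hFs : ContDiffOn ℝ 1 F (Icc 0 1) :=
    ((hfs.comp hc hm).add contDiffOn_const).sqrt fun t _ ↦ (hpos _).ne'
  have hlen : ‖F 1 - F 0‖ₑ ≤ ∫⁻ t in Icc (0 : ℝ) 1, ENNReal.ofReal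
      √(g (c t) (derivWithin c (Icc 0 1) t) (derivWithin c (Icc 0 1) t)) := by
    refine (enorm_sub_le_lintegral_derivWithin_Icc_of_contDiffOn_Icc hFs zero_le_one).trans ?_
    refine setLIntegral_mono' measurableSet_Icc fun t ht ↦ ?_
    have hct : HasDerivWithinAt c (derivWithin c (Icc 0 1) t) (Icc 0 1) t :=
      (hc.differentiableOn one_ne_zero t ht).hasDerivWithinAt
    have hfd : HasFDerivAt f (fderiv ℝ f (c t)) (c t) :=
      ((hfs.contDiffAt (Metric.isOpen_ball.mem_nhds (hm ht))).differentiableAt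
        one_ne_zero).hasFDerivAt
    have hd : HasDerivWithinAt F _ (Icc 0 1) t :=
      (((hfd.comp_hasDerivWithinAt t hct).add_const ((ε : ℝ) ^ 2))).sqrt (hpos (c t)).ne'
    rw [hd.derivWithin (uniqueDiffOn_Icc zero_lt_one t ht), ← ofReal_norm]
    refine ENNReal.ofReal_le_ofReal ?_
    have hs : 0 < √(f (c t) + (ε : ℝ) ^ 2) := Real.sqrt_pos.2 (hpos _)
    have h1 := hN.abs_fderiv_sq_le hg hx (hm ht) (derivWithin c (Icc 0 1) t)
    have h2 : √(f (c t)) ≤ √(f (c t) + (ε : ℝ) ^ 2) :=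
      Real.sqrt_le_sqrt (le_add_of_nonneg_right (by positivity))
    rw [Function.comp_apply, Real.norm_eq_abs, abs_div, abs_of_pos (mul_pos two_pos hs),
      div_le_iff₀ (mul_pos two_pos hs)]
    refine h1.trans ?_
    rw [mul_comm _ (2 * _)]
    exact mul_le_mul_of_nonneg_right (mul_le_mul_of_nonneg_left h2 zero_le_two) (Real.sqrt_nonneg _)
  have hF0 : F 0 = ε := by
    simp only [hF, hf]
    rw [← hxdef, hN.log_self hx]
    simp
  have hF1 : √(f (c 1)) ≤ F 1 := Real.sqrt_le_sqrt (le_add_of_nonneg_right (by positivity))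
  calc ENNReal.ofReal √(f (c 1)) ≤ ENNReal.ofReal (|F 1 - F 0| + ε) := by
        refine ENNReal.ofReal_le_ofReal ?_
        have := le_abs_self (F 1 - F 0)
        rw [hF0] at this ⊢
        linarith
    _ = ‖F 1 - F 0‖ₑ + ε := by
        rw [ENNReal.ofReal_add (abs_nonneg _) hεpos.le, ENNReal.ofReal_coe_nnreal,
          ← Real.norm_eq_abs, ofReal_norm]
    _ ≤ _ := by gcongr

end PathLength

/-! ### The Riemannian metric of the manifold in a chart. -/

section Chart

variable {E : Type*} [NormedAddCommGroup E] [NormedSpace ℝ E]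
  {M : Type*} [EMetricSpace M] [ChartedSpace E M] [IsManifold 𝓘(ℝ, E) ∞ M]

theorem mdifferentiableAt_symm {c : M} {y : E} (hy : y ∈ (extChartAt 𝓘(ℝ, E) c).target) :
    MDifferentiableAt 𝓘(ℝ, E) 𝓘(ℝ, E) (extChartAt 𝓘(ℝ, E) c).symm y := by
  have := mdifferentiableWithinAt_extChartAt_symm (I := 𝓘(ℝ, E)) hy
  rwa [ModelWithCorners.Boundaryless.range_eq_univ, mdifferentiableWithinAt_univ] at this

theorem chartVec_symm {c : M} {y : E} (hy : y ∈ (extChartAt 𝓘(ℝ, E) c).target) (v : E) :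
    chartVec c ⟨(extChartAt 𝓘(ℝ, E) c).symm y,
      mfderiv 𝓘(ℝ, E) 𝓘(ℝ, E) (extChartAt 𝓘(ℝ, E) c).symm y v⟩ = v := by
  have := mfderiv_extChartAt_comp_mfderivWithin_extChartAt_symm (I := 𝓘(ℝ, E)) hy
  rw [ModelWithCorners.Boundaryless.range_eq_univ, mfderivWithin_univ] at this
  exact ContinuousLinearMap.ext_iff.1 this v

theorem mfderiv_symm_chartVec {c : M} {y : E} (hy : y ∈ (extChartAt 𝓘(ℝ, E) c).target)
    (v : TangentSpace 𝓘(ℝ, E) ((extChartAt 𝓘(ℝ, E) c).symm y)) :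
    mfderiv 𝓘(ℝ, E) 𝓘(ℝ, E) (extChartAt 𝓘(ℝ, E) c).symm y
      (chartVec (E := E) c ⟨(extChartAt 𝓘(ℝ, E) c).symm y, v⟩) = v := by
  have := mfderivWithin_extChartAt_symm_comp_mfderiv_extChartAt (I := 𝓘(ℝ, E)) hy
  rw [ModelWithCorners.Boundaryless.range_eq_univ, mfderivWithin_univ] at this
  exact ContinuousLinearMap.ext_iff.1 this v

variable [RiemannianBundle (fun x : M ↦ TangentSpace 𝓘(ℝ, E) x)]

theorem chartMetric_chartVec_symm {c : M} {y : E} (hy : y ∈ (extChartAt 𝓘(ℝ, E) c).target)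
    (v w : TangentSpace 𝓘(ℝ, E) ((extChartAt 𝓘(ℝ, E) c).symm y)) :
    chartMetric c y (chartVec c ⟨_, v⟩) (chartVec c ⟨_, w⟩) = inner ℝ v w := by
  rw [chartMetric, mfderiv_symm_chartVec hy, mfderiv_symm_chartVec hy]

theorem chartMetric_chartVec {c x : M} (hx : x ∈ (chartAt E c).source)
    (v w : TangentSpace 𝓘(ℝ, E) x) :
    chartMetric c (extChartAt 𝓘(ℝ, E) c x) (chartVec c ⟨x, v⟩) (chartVec c ⟨x, w⟩)
      = inner ℝ v w := by
  have hx' : x ∈ (extChartAt 𝓘(ℝ, E) c).source := by rwa [extChartAt_source]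
  obtain ⟨y, hy, rfl⟩ : ∃ y ∈ (extChartAt 𝓘(ℝ, E) c).target,
      (extChartAt 𝓘(ℝ, E) c).symm y = x :=
    ⟨_, (extChartAt 𝓘(ℝ, E) c).map_source hx', (extChartAt 𝓘(ℝ, E) c).left_inv hx'⟩
  rw [(extChartAt 𝓘(ℝ, E) c).right_inv hy]
  exact chartMetric_chartVec_symm hy v w

theorem chartMetric_symm (c : M) (y v w : E) : chartMetric c y v w = chartMetric c y w v :=
  real_inner_comm _ _

theorem chartMetric_pos {c : M} {y v : E} (hy : y ∈ (extChartAt 𝓘(ℝ, E) c).target) (hv : v ≠ 0) :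
    0 < chartMetric c y v v := by
  refine real_inner_self_pos.2 fun h ↦ hv ?_
  have := chartVec_symm hy v
  rw [h] at this
  rw [← this]
  exact map_zero _

variable [IsContMDiffRiemannianBundle 𝓘(ℝ, E) ∞ E (fun x : M ↦ TangentSpace 𝓘(ℝ, E) x)]

/-- The coordinate vector fields are smooth sections, being the tangent map of the inverse chart
applied to constant fields. The inner product of smooth sections is smooth. -/
theorem contDiffOn_chartMetric (c : M) (v w : E) :
    ContDiffOn ℝ ∞ (fun y ↦ chartMetric c y v w) (extChartAt 𝓘(ℝ, E) c).target := by
  have hopen : IsOpen (extChartAt 𝓘(ℝ, E) c).target := isOpen_extChartAt_target c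
  have hs : ContMDiffOn 𝓘(ℝ, E) 𝓘(ℝ, E) ∞ (extChartAt 𝓘(ℝ, E) c).symm
    (extChartAt 𝓘(ℝ, E) c).target := contMDiffOn_extChartAt_symm c
  have hsec : ∀ v : E, ContMDiffOn 𝓘(ℝ, E) (𝓘(ℝ, E).prod 𝓘(ℝ, E)) ∞
      (fun y ↦ (⟨(extChartAt 𝓘(ℝ, E) c).symm y,
        mfderiv 𝓘(ℝ, E) 𝓘(ℝ, E) (extChartAt 𝓘(ℝ, E) c).symm y v⟩ :
          TotalSpace E (fun x : M ↦ TangentSpace 𝓘(ℝ, E) x)))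
      (extChartAt 𝓘(ℝ, E) c).target := by
    intro v
    have h1 := hs.contMDiffOn_tangentMapWithin (m := ∞) (by simp) hopen.uniqueMDiffOn
    have h2 : ContMDiff 𝓘(ℝ, E) (𝓘(ℝ, E).prod 𝓘(ℝ, E)) ∞
        (fun y : E ↦ (⟨y, v⟩ : TangentBundle 𝓘(ℝ, E) E)) :=
      contMDiff_vectorSpace_iff_contDiff.2 contDiff_const
    refine (h1.comp h2.contMDiffOn fun y hy ↦ hy).congr fun y hy ↦ ?_
    simp only [Function.comp_apply, tangentMapWithin]
    rw [mfderivWithin_of_isOpen hopen hy]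
  have := ContMDiffOn.inner_bundle (F := E) (E := fun x : M ↦ TangentSpace 𝓘(ℝ, E) x)
    (b := fun y ↦ (extChartAt 𝓘(ℝ, E) c).symm y)
    (v := fun y ↦ mfderiv 𝓘(ℝ, E) 𝓘(ℝ, E) (extChartAt 𝓘(ℝ, E) c).symm y v)
    (w := fun y ↦ mfderiv 𝓘(ℝ, E) 𝓘(ℝ, E) (extChartAt 𝓘(ℝ, E) c).symm y w) (hsec v) (hsec w)
  exact this.contDiffOn

end Chart

/-! ### Christoffel symbols under a change of coordinates. -/

section ChristoffelChange

variable {E : Type*} [NormedAddCommGroup E] [NormedSpace ℝ E]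

/-- The transformation rule of the Christoffel symbols. -/
theorem chr_change {g g' : E → E →L[ℝ] E →L[ℝ] ℝ} {T : E → E} {y : E}
    (hT : ContDiffAt ℝ ∞ T y) (hg' : DifferentiableAt ℝ g' (T y))
    (hg : DifferentiableAt ℝ g y)
    (hsymm : ∀ v w, g' (T y) v w = g' (T y) w v)
    (h : ∀ᶠ z in 𝓝 y, ∀ v w, g z v w = g' (T z) (fderiv ℝ T z v) (fderiv ℝ T z w)) (v w z : E) :
    chr g y v w z = chr g' (T y) (fderiv ℝ T y v) (fderiv ℝ T y w) (fderiv ℝ T y z)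
      + g' (T y) (fderiv ℝ (fderiv ℝ T) y v w) (fderiv ℝ T y z) := by
  have hT1 : HasFDerivAt T (fderiv ℝ T y) y := (hT.differentiableAt (by simp)).hasFDerivAt
  have hT2 : HasFDerivAt (fderiv ℝ T) (fderiv ℝ (fderiv ℝ T) y) y :=
    ((hT.fderiv_right (m := ∞) (by simp)).differentiableAt (by simp)).hasFDerivAt
  have hsT : ∀ a b, fderiv ℝ (fderiv ℝ T) y a b = fderiv ℝ (fderiv ℝ T) y b a := fun a b ↦
    (hT.isSymmSndFDerivAt
      (by simp only [minSmoothness_of_isRCLikeNormedField]; exact ENat.LEInfty.out)).eq a b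
  have key : ∀ a v w, fderiv ℝ g y a v w
      = fderiv ℝ g' (T y) (fderiv ℝ T y a) (fderiv ℝ T y v) (fderiv ℝ T y w)
        + g' (T y) (fderiv ℝ (fderiv ℝ T) y a v) (fderiv ℝ T y w)
        + g' (T y) (fderiv ℝ T y v) (fderiv ℝ (fderiv ℝ T) y a w) := by
    intro a v w
    have h1 : HasFDerivAt (fun z ↦ g z v w) _ y :=
      (hg.hasFDerivAt.clm_apply (hasFDerivAt_const v y)).clm_apply (hasFDerivAt_const w y)
    have h2 : HasFDerivAt (fun z ↦ g' (T z)) _ y :=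
      HasFDerivAt.comp (g := g') y hg'.hasFDerivAt hT1
    have h3 : ∀ u, HasFDerivAt (fun z ↦ fderiv ℝ T z u) _ y := fun u ↦
      hT2.clm_apply (hasFDerivAt_const u y)
    have h4 := ((h2.clm_apply (h3 v)).clm_apply (h3 w)).congr_of_eventuallyEq
      (f₁ := fun z ↦ g z v w) (by filter_upwards [h] with z hz using hz v w)
    have h5 := ContinuousLinearMap.ext_iff.1 (h1.unique h4) a
    simp only [_root_.add_apply, ContinuousLinearMap.flip_apply, ContinuousLinearMap.comp_apply,
      _root_.zero_apply, map_zero, zero_add] at h5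
    rw [h5]
    ring
  -- By symmetry of second derivatives and of `g'`, four of the six second-order terms cancel and
  -- the other two coincide.
  rw [chr, chr, key, key, key, hsT w v, hsT z v, hsT z w, hsymm (fderiv ℝ T y w),
    hsymm (fderiv ℝ (fderiv ℝ T) y v z)]
  ring

/-- The second-order term in the derivative of the pushed-forward field is the inhomogeneous term of
`chr_change`. That is why the parallel transport equation is invariant. -/
theorem hasDerivWithinAt_pushforward {T : E → E} {a X : ℝ → E} {a' X' : E} {s : Set ℝ} {t : ℝ}
    (hT : ContDiffAt ℝ ∞ T (a t)) (ha : HasDerivWithinAt a a' s t)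
    (hX : HasDerivWithinAt X X' s t) :
    HasDerivWithinAt (fun τ ↦ T (a τ)) (fderiv ℝ T (a t) a') s t ∧
    HasDerivWithinAt (fun τ ↦ fderiv ℝ T (a τ) (X τ))
      (fderiv ℝ (fderiv ℝ T) (a t) a' (X t) + fderiv ℝ T (a t) X') s t := by
  have hT1 : HasFDerivAt T (fderiv ℝ T (a t)) (a t) :=
    (hT.differentiableAt (by simp)).hasFDerivAt
  have hT2 : HasFDerivAt (fderiv ℝ T) (fderiv ℝ (fderiv ℝ T) (a t)) (a t) :=
    ((hT.fderiv_right (m := ∞) (by simp)).differentiableAt (by simp)).hasFDerivAt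
  exact ⟨hT1.comp_hasDerivWithinAt t ha, (hT2.comp_hasDerivWithinAt t ha).clm_apply hX⟩

end ChristoffelChange

/-! ### Extension of the chart metric to the model space; independence of the chart. -/

section ChartMetric

variable {E : Type*} [NormedAddCommGroup E] [NormedSpace ℝ E] [FiniteDimensional ℝ E]
  {M : Type*} [EMetricSpace M] [ChartedSpace E M] [IsManifold 𝓘(ℝ, E) ∞ M]
  [RiemannianBundle (fun x : M ↦ TangentSpace 𝓘(ℝ, E) x)]
  [IsContMDiffRiemannianBundle 𝓘(ℝ, E) ∞ E (fun x : M ↦ TangentSpace 𝓘(ℝ, E) x)]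

/-- The Riemannian metric in the chart around `c`, as a bilinear form. -/
def chartMetricL (c : M) (y : E) : E →L[ℝ] E →L[ℝ] ℝ :=
  (LinearMap.mk₂ ℝ (fun v w : E ↦ chartMetric c y v w)
    (fun _ _ _ ↦ by simp only [chartMetric]; rw [← inner_add_left]; congr 1; exact map_add _ _ _)
    (fun r _ _ ↦ by
      simp only [chartMetric]; rw [smul_eq_mul, ← real_inner_smul_left]; congr 1
      exact map_smul _ _ _)
    (fun _ _ _ ↦ by simp only [chartMetric]; rw [← inner_add_right]; congr 1; exact map_add _ _ _)
    (fun r _ _ ↦ by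
      simp only [chartMetric]; rw [smul_eq_mul, ← real_inner_smul_right]; congr 1
      exact map_smul _ _ _)).toContinuousBilinearMap

@[simp] theorem chartMetricL_apply (c : M) (y v w : E) :
    chartMetricL c y v w = chartMetric c y v w := rfl

theorem contDiffOn_chartMetricL (c : M) :
    ContDiffOn ℝ ∞ (chartMetricL (E := E) c) (extChartAt 𝓘(ℝ, E) c).target :=
  contDiffOn_clm_apply.2 fun v ↦ contDiffOn_clm_apply.2 fun w ↦ contDiffOn_chartMetric c v w

theorem differentiableAt_chartMetricL {c : M} {y : E} (hy : y ∈ (extChartAt 𝓘(ℝ, E) c).target) :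
    DifferentiableAt ℝ (chartMetricL (E := E) c) y :=
  ((contDiffOn_chartMetricL c).contDiffAt
    ((isOpen_extChartAt_target c).mem_nhds hy)).differentiableAt (by simp)

theorem christoffel_eq_chr {c : M} {y : E} (hy : y ∈ (extChartAt 𝓘(ℝ, E) c).target) (v w z : E) :
    christoffel c y v w z = chr (chartMetricL c) y v w z := by
  have h : ∀ a v w, fderiv ℝ (fun y' ↦ chartMetric c y' v w) y a
      = fderiv ℝ (chartMetricL c) y a v w := by
    intro a v w
    have h1 : HasFDerivAt (fun y' ↦ chartMetricL c y' v w) _ y :=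
      ((differentiableAt_chartMetricL hy).hasFDerivAt.clm_apply
        (hasFDerivAt_const v y)).clm_apply (hasFDerivAt_const w y)
    simp only [chartMetricL_apply] at h1
    rw [h1.fderiv]
    simp
  rw [christoffel, chr, h, h, h]

/-- `g` extends the Riemannian metric, read in the chart around `p`, from a ball to the whole
model space. -/
structure IsChartMetric (p : M) (g : E → E →L[ℝ] E →L[ℝ] ℝ) (R : ℝ) : Prop where
  metric : IsMetric g
  R_pos : 0 < R
  ball_subset : Metric.ball (extChartAt 𝓘(ℝ, E) p p) R ⊆ (extChartAt 𝓘(ℝ, E) p).target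
  eq : ∀ y ∈ Metric.ball (extChartAt 𝓘(ℝ, E) p p) R, g y = chartMetricL p y

/-- A bump function interpolates between the chart metric and its constant value at the center.
Positive definiteness survives because it is a convex condition. The radius obtained is that of the
ball on which the bump equals `1`. -/
theorem exists_isChartMetric (p : M) : ∃ (g : E → E →L[ℝ] E →L[ℝ] ℝ) (R : ℝ),
    IsChartMetric p g R := by
  set x₀ := extChartAt 𝓘(ℝ, E) p p with hx₀
  have hx₀t : x₀ ∈ (extChartAt 𝓘(ℝ, E) p).target := mem_extChartAt_target p
  obtain ⟨R, hR, hRt⟩ := Metric.nhds_basis_closedBall.mem_iff.1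
    ((isOpen_extChartAt_target (I := 𝓘(ℝ, E)) p).mem_nhds hx₀t)
  let χ : ContDiffBump x₀ := ⟨R / 2, R, by positivity, by linarith⟩
  have hχ0 : ∀ y, y ∉ Metric.closedBall x₀ R → χ y = 0 := fun y hy ↦ by
    refine χ.zero_of_le_dist ?_
    rw [Metric.mem_closedBall, not_le] at hy
    exact hy.le
  refine ⟨fun y ↦ χ y • chartMetricL p y + (1 - χ y) • chartMetricL p x₀, R / 2, ⟨?_, ?_, ?_⟩,
    by positivity, ?_, ?_⟩
  · refine ContDiff.add ?_ ((contDiff_const.sub χ.contDiff).smul contDiff_const)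
    rw [contDiff_iff_contDiffAt]
    intro y
    by_cases hy : y ∈ (extChartAt 𝓘(ℝ, E) p).target
    · exact χ.contDiffAt.smul ((contDiffOn_chartMetricL p).contDiffAt
        ((isOpen_extChartAt_target p).mem_nhds hy))
    · have : (fun y ↦ χ y • chartMetricL p y) =ᶠ[𝓝 y] fun _ ↦ 0 := by
        filter_upwards [Metric.isClosed_closedBall.isOpen_compl.mem_nhds
          (fun h ↦ hy (hRt h) : y ∈ (Metric.closedBall x₀ R)ᶜ)] with z hz
        rw [hχ0 z hz, zero_smul]
      exact contDiffAt_const.congr_of_eventuallyEq this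
  · intro y v w
    simp only [_root_.add_apply, _root_.smul_apply, chartMetricL_apply]
    rw [chartMetric_symm p y, chartMetric_symm p x₀]
  · intro y v hv
    simp only [_root_.add_apply, _root_.smul_apply, chartMetricL_apply, smul_eq_mul]
    have h0 : 0 < chartMetric p x₀ v v := chartMetric_pos hx₀t hv
    have h1 : 0 ≤ 1 - χ y := sub_nonneg.2 χ.le_one
    by_cases hy : y ∈ Metric.closedBall x₀ R
    · have h2 : 0 < chartMetric p y v v := chartMetric_pos (hRt hy) hv
      rcases eq_or_lt_of_le (χ.nonneg (x := y)) with h | h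
      · rw [← h]
        simpa using h0
      · have := mul_pos h h2
        have := mul_nonneg h1 h0.le
        linarith
    · rw [hχ0 y hy]
      simpa using h0
  · exact fun y hy ↦ hRt (Metric.ball_subset_closedBall
      (Metric.ball_subset_ball (by linarith) hy))
  · intro y hy
    rw [χ.one_of_mem_closedBall (Metric.ball_subset_closedBall hy)]
    simp

namespace IsChartMetric

variable {p : M} {g : E → E →L[ℝ] E →L[ℝ] ℝ} {R : ℝ} (hC : IsChartMetric p g R)
include hC

theorem apply_eq {y : E} (hy : y ∈ Metric.ball (extChartAt 𝓘(ℝ, E) p p) R) (v w : E) :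
    chartMetric p y v w = g y v w := by
  rw [hC.eq y hy, chartMetricL_apply]

theorem christoffel_eq {y : E} (hy : y ∈ Metric.ball (extChartAt 𝓘(ℝ, E) p p) R) (v w z : E) :
    christoffel p y v w z = chr g y v w z := by
  have h : g =ᶠ[𝓝 y] chartMetricL p := by
    filter_upwards [Metric.isOpen_ball.mem_nhds hy] with y' hy' using hC.eq y' hy'
  rw [christoffel_eq_chr (hC.ball_subset hy), chr, chr, h.fderiv_eq]

/-- The parallel transport equation, solved for the derivative of the field. -/
theorem parallel_iff {y X' v w : E} (hy : y ∈ Metric.ball (extChartAt 𝓘(ℝ, E) p p) R) :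
    (∀ z, chartMetric p y X' z + christoffel p y v w z = 0) ↔ X' = -(spray g y v w) := by
  have h : ∀ z, chartMetric p y X' z + christoffel p y v w z = g y X' z + g y (spray g y v w) z :=
    fun z ↦ by rw [hC.apply_eq hy, hC.christoffel_eq hy, hC.metric.apply_spray]
  simp only [h]
  constructor
  · intro H
    refine hC.metric.eq_of_forall_apply_eq (y := y) fun z ↦ ?_
    rw [map_neg, _root_.neg_apply]
    linarith [H z]
  · rintro rfl z
    rw [map_neg, _root_.neg_apply, neg_add_cancel]

end IsChartMetric

/-- The coordinate change from the chart around `c` to the chart around `d`. -/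
def coordChange (c d : M) : E → E := extChartAt 𝓘(ℝ, E) d ∘ (extChartAt 𝓘(ℝ, E) c).symm

/-- The domain of the coordinate change. -/
def coordDomain (E : Type*) [NormedAddCommGroup E] [NormedSpace ℝ E] [ChartedSpace E M] (c d : M) :
    Set E :=
  (extChartAt 𝓘(ℝ, E) c).target ∩ (extChartAt 𝓘(ℝ, E) c).symm ⁻¹' (chartAt E d).source

theorem isOpen_coordDomain (c d : M) : IsOpen (coordDomain E c d) :=
  (continuousOn_extChartAt_symm c).isOpen_inter_preimage (isOpen_extChartAt_target c)
    (chartAt E d).open_source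

theorem contDiffOn_coordChange (c d : M) :
    ContDiffOn ℝ ∞ (coordChange (E := E) c d) (coordDomain E c d) := by
  refine (contDiffOn_ext_coord_change (I := 𝓘(ℝ, E)) d c).mono fun y hy ↦ ?_
  rw [PartialEquiv.trans_source, PartialEquiv.symm_source]
  refine ⟨hy.1, ?_⟩
  rw [mem_preimage, extChartAt_source]
  exact hy.2

theorem fderiv_coordChange {c d : M} {y : E} (hy : y ∈ coordDomain E c d) (v : E) :
    fderiv ℝ (coordChange c d) y v = chartVec d ⟨(extChartAt 𝓘(ℝ, E) c).symm y,
      mfderiv 𝓘(ℝ, E) 𝓘(ℝ, E) (extChartAt 𝓘(ℝ, E) c).symm y v⟩ := by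
  have h := mfderiv_comp (I := 𝓘(ℝ, E)) (I' := 𝓘(ℝ, E)) (I'' := 𝓘(ℝ, E)) y
    (mdifferentiableAt_extChartAt (I := 𝓘(ℝ, E)) (x := d) hy.2) (mdifferentiableAt_symm hy.1)
  rw [mfderiv_eq_fderiv] at h
  exact ContinuousLinearMap.ext_iff.1 h v

theorem chartVec_change {c d : M} {ξ : TangentBundle 𝓘(ℝ, E) M}
    (hc : ξ.proj ∈ (chartAt E c).source) (hd : ξ.proj ∈ (chartAt E d).source) :
    extChartAt 𝓘(ℝ, E) c ξ.proj ∈ coordDomain E c d ∧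
    chartVec d ξ = fderiv ℝ (coordChange c d) (extChartAt 𝓘(ℝ, E) c ξ.proj) (chartVec c ξ) := by
  obtain ⟨x, v⟩ := ξ
  have hx' : x ∈ (extChartAt 𝓘(ℝ, E) c).source := by rwa [extChartAt_source]
  obtain ⟨y, hy, rfl⟩ : ∃ y ∈ (extChartAt 𝓘(ℝ, E) c).target,
      (extChartAt 𝓘(ℝ, E) c).symm y = x :=
    ⟨_, (extChartAt 𝓘(ℝ, E) c).map_source hx', (extChartAt 𝓘(ℝ, E) c).left_inv hx'⟩
  simp only [(extChartAt 𝓘(ℝ, E) c).right_inv hy]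
  have hdom : y ∈ coordDomain E c d := ⟨hy, hd⟩
  refine ⟨hdom, ?_⟩
  rw [fderiv_coordChange hdom, mfderiv_symm_chartVec hy]

theorem chartMetricL_change {c d : M} {y : E} (hy : y ∈ coordDomain E c d) (v w : E) :
    chartMetricL c y v w = chartMetricL d (coordChange c d y)
      (fderiv ℝ (coordChange c d) y v) (fderiv ℝ (coordChange c d) y w) := by
  rw [fderiv_coordChange hy, fderiv_coordChange hy, chartMetricL_apply, chartMetricL_apply]
  exact (chartMetric_chartVec hy.2 _ _).symm

/-- The derivative pulls one metric back to a definite one, so it is injective, hence surjective on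
the finite-dimensional space `E`. -/
theorem surjective_fderiv_coordChange {c d : M} {y : E} (hy : y ∈ coordDomain E c d) :
    Function.Surjective (fderiv ℝ (coordChange c d) y) := by
  have hinj : Function.Injective (fderiv ℝ (coordChange c d) y).toLinearMap := by
    rw [← LinearMap.ker_eq_bot, LinearMap.ker_eq_bot']
    intro v hv
    by_contra hne
    have h1 := chartMetric_pos hy.1 hne
    rw [← chartMetricL_apply, chartMetricL_change hy] at h1
    have hv' : fderiv ℝ (coordChange c d) y v = 0 := hv
    rw [hv'] at h1
    simp at h1
  exact LinearMap.injective_iff_surjective.1 hinj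

/-- The parallel transport equation is independent of the chart. -/
theorem parallel_change {c d : M} {Z : ℝ → TangentBundle 𝓘(ℝ, E) M} {s : Set ℝ} {t : ℝ}
    (hs : UniqueDiffWithinAt ℝ s t)
    (hZ : ContinuousWithinAt (fun τ ↦ (Z τ).proj) s t)
    (hc : (Z t).proj ∈ (chartAt E c).source) (hd : (Z t).proj ∈ (chartAt E d).source) {γ' X' : E}
    (hγ : HasDerivWithinAt (fun τ ↦ extChartAt 𝓘(ℝ, E) c (Z τ).proj) γ' s t)
    (hX : HasDerivWithinAt (fun τ ↦ chartVec c (Z τ)) X' s t)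
    (h : ∀ z, chartMetric c (extChartAt 𝓘(ℝ, E) c (Z t).proj) X' z
      + christoffel c (extChartAt 𝓘(ℝ, E) c (Z t).proj) γ' (chartVec c (Z t)) z = 0) :
    ∃ Y' : E, HasDerivWithinAt (fun τ ↦ chartVec d (Z τ)) Y' s t ∧
      ∀ z : E, chartMetric d (extChartAt 𝓘(ℝ, E) d (Z t).proj) Y' z
        + christoffel d (extChartAt 𝓘(ℝ, E) d (Z t).proj)
            (derivWithin (fun τ ↦ extChartAt 𝓘(ℝ, E) d (Z τ).proj) s t)
            (chartVec d (Z t)) z = 0 := by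
  set T : E → E := coordChange c d with hTdef
  set y : E := extChartAt 𝓘(ℝ, E) c (Z t).proj with hy
  have hdom : y ∈ coordDomain E c d := (chartVec_change hc hd).1
  have hTy : ∀ ξ : TangentBundle 𝓘(ℝ, E) M, ξ.proj ∈ (chartAt E c).source →
      T (extChartAt 𝓘(ℝ, E) c ξ.proj) = extChartAt 𝓘(ℝ, E) d ξ.proj := fun ξ hξ ↦ by
    have hξ' : ξ.proj ∈ (extChartAt 𝓘(ℝ, E) c).source := by rwa [extChartAt_source]
    simp only [hTdef, coordChange, Function.comp_apply, (extChartAt 𝓘(ℝ, E) c).left_inv hξ']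
  have hev : ∀ᶠ τ in 𝓝[s] t, (Z τ).proj ∈ (chartAt E c).source ∧
      (Z τ).proj ∈ (chartAt E d).source :=
    Filter.inter_mem (hZ.preimage_mem_nhdsWithin ((chartAt E c).open_source.mem_nhds hc))
      (hZ.preimage_mem_nhdsWithin ((chartAt E d).open_source.mem_nhds hd))
  have hTs : ContDiffAt ℝ ∞ T y :=
    (contDiffOn_coordChange c d).contDiffAt ((isOpen_coordDomain c d).mem_nhds hdom)
  have hder := hasDerivWithinAt_pushforward hTs hγ hX
  have hγd : HasDerivWithinAt (fun τ ↦ extChartAt 𝓘(ℝ, E) d (Z τ).proj) (fderiv ℝ T y γ') s t := by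
    refine hder.1.congr_of_eventuallyEq ?_ (hTy _ hc).symm
    filter_upwards [hev] with τ hτ using (hTy _ hτ.1).symm
  have hXd : HasDerivWithinAt (fun τ ↦ chartVec d (Z τ))
      (fderiv ℝ (fderiv ℝ T) y γ' (chartVec c (Z t)) + fderiv ℝ T y X') s t := by
    refine hder.2.congr_of_eventuallyEq ?_
      (chartVec_change hc hd).2
    filter_upwards [hev] with τ hτ using (chartVec_change hτ.1 hτ.2).2
  refine ⟨_, hXd, fun z' ↦ ?_⟩
  obtain ⟨z, rfl⟩ := surjective_fderiv_coordChange hdom z'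
  rw [hγd.derivWithin hs, (chartVec_change hc hd).2, ← hTy _ hc, ← hy, ← hTdef]
  have hdt : T y ∈ (extChartAt 𝓘(ℝ, E) d).target := by
    rw [hy, hTy _ hc]
    exact (extChartAt 𝓘(ℝ, E) d).map_source (by rwa [extChartAt_source])
  have hch := chr_change (g := chartMetricL c) (g' := chartMetricL d) hTs
    (differentiableAt_chartMetricL hdt) (differentiableAt_chartMetricL hdom.1)
    (fun v w ↦ chartMetric_symm d _ v w)
    (by filter_upwards [(isOpen_coordDomain c d).mem_nhds hdom] with y' hy' v w
        exact chartMetricL_change hy' v w) γ' (chartVec c (Z t)) z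
  have h0 := h z
  rw [christoffel_eq_chr hdom.1, ← chartMetricL_apply, hch, chartMetricL_change hdom] at h0
  rw [christoffel_eq_chr hdt, ← chartMetricL_apply, map_add, _root_.add_apply]
  linarith

end ChartMetric

/-! ### Geodesics, parallel fields and lengths: from the manifold to coordinates and back. -/

section Bridge

variable {E : Type*} [NormedAddCommGroup E] [NormedSpace ℝ E] [FiniteDimensional ℝ E]
  {M : Type*} [EMetricSpace M] [ChartedSpace E M] [IsManifold 𝓘(ℝ, E) ∞ M]
  [RiemannianBundle (fun x : M ↦ TangentSpace 𝓘(ℝ, E) x)]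
  [IsContMDiffRiemannianBundle 𝓘(ℝ, E) ∞ E (fun x : M ↦ TangentSpace 𝓘(ℝ, E) x)]

/-- The part of the chart around `p` that corresponds to a ball. -/
def chartDom (E : Type*) [NormedAddCommGroup E] [NormedSpace ℝ E] {M : Type*} [EMetricSpace M]
    [ChartedSpace E M] (p : M) (r : ℝ) : Set M :=
  (chartAt E p).source ∩ extChartAt 𝓘(ℝ, E) p ⁻¹' Metric.ball (extChartAt 𝓘(ℝ, E) p p) r

theorem isOpen_chartDom (p : M) (r : ℝ) : IsOpen (chartDom E p r) := by
  have := (continuousOn_extChartAt (I := 𝓘(ℝ, E)) p).isOpen_inter_preimage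
    (isOpen_extChartAt_source p) (Metric.isOpen_ball (x := extChartAt 𝓘(ℝ, E) p p) (ε := r))
  rwa [extChartAt_source] at this

theorem mem_chartDom_self (p : M) {r : ℝ} (hr : 0 < r) : p ∈ chartDom E p r :=
  ⟨mem_chart_source E p, Metric.mem_ball_self hr⟩

theorem chartDom_mono (p : M) {r r' : ℝ} (h : r ≤ r') : chartDom E p r ⊆ chartDom E p r' :=
  fun _ hx ↦ ⟨hx.1, Metric.ball_subset_ball h hx.2⟩

theorem chartDom.symm_apply {p x : M} {r : ℝ} (hx : x ∈ chartDom E p r) :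
    (extChartAt 𝓘(ℝ, E) p).symm (extChartAt 𝓘(ℝ, E) p x) = x :=
  (extChartAt 𝓘(ℝ, E) p).left_inv (by rw [extChartAt_source]; exact hx.1)

theorem hasDerivWithinAt_chart_comp {c : M} {γ : ℝ → M} {t : ℝ}
    (hγ : MDifferentiableWithinAt 𝓘(ℝ, ℝ) 𝓘(ℝ, E) γ (Icc 0 1) t)
    (hc : γ t ∈ (chartAt E c).source) :
    HasDerivWithinAt (fun τ ↦ extChartAt 𝓘(ℝ, E) c (γ τ)) (chartVec c (velocity (E := E) γ t))
      (Icc 0 1) t := by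
  have h := ((mdifferentiableAt_extChartAt (I := 𝓘(ℝ, E)) hc).hasMFDerivAt.comp_hasMFDerivWithinAt t
    hγ.hasMFDerivWithinAt)
  let A : ℝ →L[ℝ] E := (mfderiv 𝓘(ℝ, E) 𝓘(ℝ, E) (extChartAt 𝓘(ℝ, E) c) (γ t)).comp
    (mfderivWithin 𝓘(ℝ, ℝ) 𝓘(ℝ, E) γ (Icc 0 1) t)
  have h2 : HasFDerivWithinAt (fun τ ↦ extChartAt 𝓘(ℝ, E) c (γ τ)) A (Icc 0 1) t :=
    hasMFDerivWithinAt_iff_hasFDerivWithinAt.1 h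
  exact h2.hasDerivWithinAt

/-- A field that is parallel in one chart is parallel. -/
theorem IsChartMetric.isParallelOn {p : M} {g : E → E →L[ℝ] E →L[ℝ] ℝ} {R : ℝ}
    (hC : IsChartMetric p g R) {Z : ℝ → TangentBundle 𝓘(ℝ, E) M} {w : ℝ → E}
    (hZ : ∀ t ∈ Icc (0 : ℝ) 1, (Z t).proj ∈ chartDom E p R)
    (hw : ∀ t ∈ Icc (0 : ℝ) 1,
      HasDerivWithinAt (fun τ ↦ extChartAt 𝓘(ℝ, E) p (Z τ).proj) (w t) (Icc 0 1) t)
    (hX : ∀ t ∈ Icc (0 : ℝ) 1, HasDerivWithinAt (fun τ ↦ chartVec p (Z τ))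
      (-(spray g (extChartAt 𝓘(ℝ, E) p (Z t).proj) (w t) (chartVec p (Z t)))) (Icc 0 1) t) :
    IsParallelOn Z (Icc 0 1) := by
  intro t ht c hc
  -- Only the coordinates of the base curve are known to be differentiable. Its continuity in the
  -- manifold is recovered through the inverse chart, and is needed to stay inside the other chart
  -- `c`.
  have hcont : ContinuousWithinAt (fun τ ↦ (Z τ).proj) (Icc 0 1) t := by
    have h1 : ContinuousWithinAt (fun τ ↦ (extChartAt 𝓘(ℝ, E) p).symm
        (extChartAt 𝓘(ℝ, E) p (Z τ).proj)) (Icc 0 1) t :=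
      ContinuousAt.comp_continuousWithinAt
        ((continuousOn_extChartAt_symm p).continuousAt
          ((isOpen_extChartAt_target p).mem_nhds (hC.ball_subset (hZ t ht).2)))
        (hw t ht).continuousWithinAt
    exact h1.congr (fun τ hτ ↦ (chartDom.symm_apply (hZ τ hτ)).symm)
      (chartDom.symm_apply (hZ t ht)).symm
  exact parallel_change (uniqueDiffOn_Icc zero_lt_one t ht) hcont (hZ t ht).1 hc (hw t ht)
    (hX t ht) ((hC.parallel_iff (hZ t ht).2).2 rfl)

/-- The parallel transport equation in a chart. -/
theorem IsChartMetric.hasDerivWithinAt_of_isParallelOn {p : M} {g : E → E →L[ℝ] E →L[ℝ] ℝ} {R : ℝ}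
    (hC : IsChartMetric p g R) {Z : ℝ → TangentBundle 𝓘(ℝ, E) M} (hP : IsParallelOn Z (Icc 0 1))
    {t : ℝ} (ht : t ∈ Icc (0 : ℝ) 1) (hZ : (Z t).proj ∈ chartDom E p R) :
    HasDerivWithinAt (fun τ ↦ chartVec p (Z τ))
      (-(spray g (extChartAt 𝓘(ℝ, E) p (Z t).proj)
        (derivWithin (fun τ ↦ extChartAt 𝓘(ℝ, E) p (Z τ).proj) (Icc 0 1) t)
        (chartVec p (Z t)))) (Icc 0 1) t := by
  obtain ⟨X', hX', h⟩ := hP t ht p hZ.1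
  rwa [(hC.parallel_iff hZ.2).1 h] at hX'

theorem IsChartMetric.isGeod_of_isGeodesicSegment {p : M} {g : E → E →L[ℝ] E →L[ℝ] ℝ} {R : ℝ}
    (hC : IsChartMetric p g R) {γ : ℝ → M} {x y : M} (hγ : IsGeodesicSegment E γ x y)
    (hm : MapsTo γ (Icc 0 1) (chartDom E p R)) :
    IsGeod g (fun t ↦ extChartAt 𝓘(ℝ, E) p (γ t)) (fun t ↦ chartVec p (velocity (E := E) γ t)) := by
  have h1 : ∀ t ∈ Icc (0 : ℝ) 1, HasDerivWithinAt (fun τ ↦ extChartAt 𝓘(ℝ, E) p (γ τ))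
      (chartVec p (velocity (E := E) γ t)) (Icc 0 1) t := fun t ht ↦
    hasDerivWithinAt_chart_comp ((hγ.contMDiffOn t ht).mdifferentiableWithinAt one_ne_zero)
      (hm ht).1
  refine ⟨h1, fun t ht ↦ ?_⟩
  have h2 := hC.hasDerivWithinAt_of_isParallelOn hγ.parallel ht (hm ht)
  have h3 : derivWithin (fun τ ↦ extChartAt 𝓘(ℝ, E) p (velocity (E := E) γ τ).proj) (Icc 0 1) t
      = chartVec p (velocity (E := E) γ t) :=
    (h1 t ht).derivWithin (uniqueDiffOn_Icc zero_lt_one t ht)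
  rw [h3] at h2
  exact h2

theorem IsChartMetric.symm_mem {p : M} {g : E → E →L[ℝ] E →L[ℝ] ℝ} {R : ℝ}
    (hC : IsChartMetric p g R) {y : E} {r : ℝ} (hr : r ≤ R)
    (hy : y ∈ Metric.ball (extChartAt 𝓘(ℝ, E) p p) r) :
    (extChartAt 𝓘(ℝ, E) p).symm y ∈ chartDom E p r ∧
      extChartAt 𝓘(ℝ, E) p ((extChartAt 𝓘(ℝ, E) p).symm y) = y := by
  have hyt := hC.ball_subset (Metric.ball_subset_ball hr hy)
  have h := (extChartAt 𝓘(ℝ, E) p).right_inv hyt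
  have h2 := (extChartAt 𝓘(ℝ, E) p).map_target hyt
  rw [extChartAt_source] at h2
  refine ⟨⟨h2, ?_⟩, h⟩
  rw [mem_preimage, h]
  exact hy

theorem IsChartMetric.contMDiffOn_symm_comp {p : M} {g : E → E →L[ℝ] E →L[ℝ] ℝ} {R : ℝ}
    (hC : IsChartMetric p g R) {c : ℝ → E} (hc : ContDiffOn ℝ 1 c (Icc 0 1))
    (hm : MapsTo c (Icc 0 1) (Metric.ball (extChartAt 𝓘(ℝ, E) p p) R)) :
    ContMDiffOn 𝓘(ℝ, ℝ) 𝓘(ℝ, E) 1 (fun t ↦ (extChartAt 𝓘(ℝ, E) p).symm (c t)) (Icc 0 1) := by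
  have h1 : ContMDiffOn 𝓘(ℝ, E) 𝓘(ℝ, E) 1 (extChartAt 𝓘(ℝ, E) p).symm
    (extChartAt 𝓘(ℝ, E) p).target := (contMDiffOn_extChartAt_symm (n := ∞) p).of_le (by simp)
  exact h1.comp hc.contMDiffOn fun t ht ↦ hC.ball_subset (hm ht)

theorem IsGeod.contDiffOn {g : E → E →L[ℝ] E →L[ℝ] ℝ} {c w : ℝ → E} (hc : IsGeod g c w) :
    ContDiffOn ℝ 1 c (Icc 0 1) := by
  have hu := uniqueDiffOn_Icc (zero_lt_one (α := ℝ))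
  rw [show (1 : WithTop ℕ∞) = 0 + 1 from (zero_add 1).symm, contDiffOn_succ_iff_derivWithin hu]
  refine ⟨fun t ht ↦ (hc.deriv t ht).differentiableWithinAt, by simp, ?_⟩
  rw [contDiffOn_zero]
  exact hc.continuousOn_velocity.congr fun t ht ↦ (hc.deriv t ht).derivWithin (hu t ht)

theorem IsChartMetric.chartVec_velocity_symm_comp {p : M} {g : E → E →L[ℝ] E →L[ℝ] ℝ} {R : ℝ}
    (hC : IsChartMetric p g R) {c w : ℝ → E} (hc : IsGeod g c w)
    (hm : MapsTo c (Icc 0 1) (Metric.ball (extChartAt 𝓘(ℝ, E) p p) R)) {t : ℝ}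
    (ht : t ∈ Icc (0 : ℝ) 1) :
    chartVec p (velocity (E := E) (fun t ↦ (extChartAt 𝓘(ℝ, E) p).symm (c t)) t) = w t := by
  have hu := uniqueDiffOn_Icc (zero_lt_one (α := ℝ)) t ht
  have hd := hasDerivWithinAt_chart_comp (c := p)
    (((hC.contMDiffOn_symm_comp hc.contDiffOn hm) t ht).mdifferentiableWithinAt one_ne_zero)
    (hC.symm_mem le_rfl (hm ht)).1.1
  refine hu.eq_deriv _ hd ((hc.deriv t ht).congr (fun τ hτ ↦ ?_) ?_)
  · exact (hC.symm_mem le_rfl (hm hτ)).2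
  · exact (hC.symm_mem le_rfl (hm ht)).2

theorem IsChartMetric.isGeodesicSegment {p : M} {g : E → E →L[ℝ] E →L[ℝ] ℝ} {R : ℝ}
    (hC : IsChartMetric p g R) {c w : ℝ → E} (hc : IsGeod g c w)
    (hm : MapsTo c (Icc 0 1) (Metric.ball (extChartAt 𝓘(ℝ, E) p p) R)) :
    IsGeodesicSegment E (fun t ↦ (extChartAt 𝓘(ℝ, E) p).symm (c t))
      ((extChartAt 𝓘(ℝ, E) p).symm (c 0)) ((extChartAt 𝓘(ℝ, E) p).symm (c 1)) := by
  refine ⟨hC.contMDiffOn_symm_comp hc.contDiffOn hm, ?_, rfl, rfl⟩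
  have hφ : ∀ t ∈ Icc (0 : ℝ) 1,
      extChartAt 𝓘(ℝ, E) p ((extChartAt 𝓘(ℝ, E) p).symm (c t)) = c t :=
    fun t ht ↦ (hC.symm_mem le_rfl (hm ht)).2
  have hv : ∀ t ∈ Icc (0 : ℝ) 1, _ := fun t ht ↦ hC.chartVec_velocity_symm_comp hc hm ht
  refine hC.isParallelOn (w := w) (fun t ht ↦ (hC.symm_mem le_rfl (hm ht)).1) (fun t ht ↦ ?_)
    fun t ht ↦ ?_
  · exact (hc.deriv t ht).congr hφ (hφ t ht)
  · rw [hv t ht]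
    have h1 := (hc.deriv₂ t ht).congr hv (hv t ht)
    have h2 : extChartAt 𝓘(ℝ, E) p (velocity (E := E)
      (fun t ↦ (extChartAt 𝓘(ℝ, E) p).symm (c t)) t).proj = c t := hφ t ht
    rw [h2]
    exact h1

theorem IsChartMetric.inner_eq {p : M} {g : E → E →L[ℝ] E →L[ℝ] ℝ} {R : ℝ}
    (hC : IsChartMetric p g R) {x : M} (hx : x ∈ chartDom E p R) (v w : TangentSpace 𝓘(ℝ, E) x) :
    inner ℝ v w = g (extChartAt 𝓘(ℝ, E) p x) (chartVec p ⟨x, v⟩) (chartVec p ⟨x, w⟩) := by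
  rw [← chartMetric_chartVec hx.1 v w, hC.apply_eq hx.2]

theorem IsChartMetric.norm_eq {p : M} {g : E → E →L[ℝ] E →L[ℝ] ℝ} {R : ℝ}
    (hC : IsChartMetric p g R) {x : M} (hx : x ∈ chartDom E p R) (v : TangentSpace 𝓘(ℝ, E) x) :
    ‖v‖ = √(g (extChartAt 𝓘(ℝ, E) p x) (chartVec p ⟨x, v⟩) (chartVec p ⟨x, v⟩)) := by
  rw [norm_eq_sqrt_real_inner, hC.inner_eq hx]

theorem IsChartMetric.pathELength_eq {p : M} {g : E → E →L[ℝ] E →L[ℝ] ℝ} {R : ℝ}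
    (hC : IsChartMetric p g R) {γ : ℝ → M}
    (hγ : ContMDiffOn 𝓘(ℝ, ℝ) 𝓘(ℝ, E) 1 γ (Icc 0 1))
    (hm : MapsTo γ (Icc 0 1) (chartDom E p R)) :
    pathELength 𝓘(ℝ, E) γ 0 1 = ∫⁻ t in Icc (0 : ℝ) 1, ENNReal.ofReal
      √(g (extChartAt 𝓘(ℝ, E) p (γ t))
        (derivWithin (fun t ↦ extChartAt 𝓘(ℝ, E) p (γ t)) (Icc 0 1) t)
        (derivWithin (fun t ↦ extChartAt 𝓘(ℝ, E) p (γ t)) (Icc 0 1) t)) := by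
  rw [pathELength_eq_lintegral_mfderivWithin_Icc]
  refine MeasureTheory.setLIntegral_congr_fun measurableSet_Icc fun t ht ↦ ?_
  have hd := (hasDerivWithinAt_chart_comp ((hγ t ht).mdifferentiableWithinAt one_ne_zero)
    (hm ht).1).derivWithin (uniqueDiffOn_Icc (zero_lt_one (α := ℝ)) t ht)
  simp only [hd]
  rw [← ofReal_norm, hC.norm_eq (hm ht)]
  rfl

theorem IsChartMetric.contDiffOn_chart_comp {p : M} {γ : ℝ → M}
    (hγ : ContMDiffOn 𝓘(ℝ, ℝ) 𝓘(ℝ, E) 1 γ (Icc 0 1)) {R : ℝ}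
    (hm : MapsTo γ (Icc 0 1) (chartDom E p R)) :
    ContDiffOn ℝ 1 (fun t ↦ extChartAt 𝓘(ℝ, E) p (γ t)) (Icc 0 1) := by
  have h1 : ContMDiffOn 𝓘(ℝ, E) 𝓘(ℝ, E) 1 (extChartAt 𝓘(ℝ, E) p) (chartAt E p).source :=
    (contMDiffOn_extChartAt (n := ∞)).of_le (by simp)
  exact (h1.comp hγ fun t ht ↦ (hm ht).1).contDiffOn

theorem IsChartMetric.pathELength_geodesic {p : M} {g : E → E →L[ℝ] E →L[ℝ] ℝ} {R : ℝ}
    (hC : IsChartMetric p g R) {γ : ℝ → M}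
    (hγ : ContMDiffOn 𝓘(ℝ, ℝ) 𝓘(ℝ, E) 1 γ (Icc 0 1))
    (hm : MapsTo γ (Icc 0 1) (chartDom E p R)) {w : ℝ → E}
    (hc : IsGeod g (fun t ↦ extChartAt 𝓘(ℝ, E) p (γ t)) w) :
    pathELength 𝓘(ℝ, E) γ 0 1
      = ENNReal.ofReal √(g (extChartAt 𝓘(ℝ, E) p (γ 0)) (w 0) (w 0)) := by
  rw [hC.pathELength_eq hγ hm]
  have : ∀ t ∈ Icc (0 : ℝ) 1, ENNReal.ofReal
      √(g (extChartAt 𝓘(ℝ, E) p (γ t))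
        (derivWithin (fun t ↦ extChartAt 𝓘(ℝ, E) p (γ t)) (Icc 0 1) t)
        (derivWithin (fun t ↦ extChartAt 𝓘(ℝ, E) p (γ t)) (Icc 0 1) t))
      = ENNReal.ofReal √(g (extChartAt 𝓘(ℝ, E) p (γ 0)) (w 0) (w 0)) := fun t ht ↦ by
    rw [(hc.deriv t ht).derivWithin (uniqueDiffOn_Icc (zero_lt_one (α := ℝ)) t ht),
      hc.energy_eq hC.metric ht]
  rw [MeasureTheory.setLIntegral_congr_fun measurableSet_Icc this]
  simp

end Bridge

/-! ### The Riemannian distance in a normal neighbourhood. -/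

section Distance

universe u

variable {E : Type u} [NormedAddCommGroup E] [NormedSpace ℝ E] [FiniteDimensional ℝ E]
  [CompleteSpace E]
  {M : Type*} [EMetricSpace M] [ChartedSpace E M] [IsManifold 𝓘(ℝ, E) ∞ M]
  [RiemannianBundle (fun x : M ↦ TangentSpace 𝓘(ℝ, E) x)]
  [IsContMDiffRiemannianBundle 𝓘(ℝ, E) ∞ E (fun x : M ↦ TangentSpace 𝓘(ℝ, E) x)]
  [IsRiemannianManifold 𝓘(ℝ, E) M]

/-- Normal coordinates on a metric ball around `p`, with uniform estimates. -/
structure IsNormalNhd (p : M) (g : E → E →L[ℝ] E →L[ℝ] ℝ) (R ρ σ : ℝ) (X L : E × E → E)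
    (ε κ C : ℝ) : Prop where
  chart : IsChartMetric p g R
  normal : IsNormal g (extChartAt 𝓘(ℝ, E) p p) R ρ σ X L
  ε_pos : 0 < ε
  κ_pos : 0 < κ
  C_pos : 0 < C
  eball_subset : Metric.eball p (ENNReal.ofReal ε) ⊆ chartDom E p ρ
  le_hess : ∀ x ∈ Metric.eball p (ENNReal.ofReal ε), ∀ w, g (extChartAt 𝓘(ℝ, E) p x) w w
    ≤ hessSq g (extChartAt 𝓘(ℝ, E) p p) L (extChartAt 𝓘(ℝ, E) p x) w
  norm_le : ∀ x ∈ Metric.eball p (ENNReal.ofReal ε), ∀ v,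
    κ * ‖v‖ ≤ √(g (extChartAt 𝓘(ℝ, E) p x) v v)
  le_norm : ∀ x ∈ Metric.eball p (ENNReal.ofReal ε), ∀ v,
    √(g (extChartAt 𝓘(ℝ, E) p x) v v) ≤ C * ‖v‖

theorem exists_ofReal_eball_subset {p : M} {s : Set M} (hs : s ∈ 𝓝 p) :
    ∃ r : ℝ, 0 < r ∧ Metric.eball p (ENNReal.ofReal r) ⊆ s := by
  obtain ⟨e, he, hes⟩ := Metric.nhds_basis_eball.mem_iff.1 hs
  obtain ⟨a, ha, ha'⟩ := ENNReal.lt_iff_exists_nnreal_btwn.1 he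
  exact ⟨a, by exact_mod_cast ha, (Metric.eball_subset_eball (by simpa using ha'.le)).trans hes⟩

theorem exists_isNormalNhd (p : M) : ∃ g R ρ σ X L ε κ C,
    IsNormalNhd (E := E) p g R ρ σ X L ε κ C := by
  obtain ⟨g, R, hC⟩ := exists_isChartMetric (E := E) p
  obtain ⟨ρ, σ, X, L, hN⟩ := hC.metric.exists_isNormal (extChartAt 𝓘(ℝ, E) p p) hC.R_pos
  obtain ⟨ρ', hρ', hρ'le, hH⟩ := hN.exists_le_hessSq hC.metric
  obtain ⟨r, hr, κ, hκ, C, hCpos, hb⟩ := hC.metric.exists_norm_sq_bounds (extChartAt 𝓘(ℝ, E) p p)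
  obtain ⟨ε, hε, hsub⟩ := exists_ofReal_eball_subset ((isOpen_chartDom (E := E) p
    (min ρ' r)).mem_nhds (mem_chartDom_self p (lt_min hρ' hr)))
  refine ⟨g, R, ρ, σ, X, L, ε, κ, C, hC, hN, hε, hκ, hCpos,
    hsub.trans (chartDom_mono p ((min_le_left _ _).trans hρ'le)),
    fun x hx w ↦ hH _ (chartDom_mono p (min_le_left _ _) (hsub hx)).2 w, fun x hx v ↦ ?_,
    fun x hx v ↦ ?_⟩
  · have := (hb _ (chartDom_mono p (min_le_right _ _) (hsub hx)).2 v).1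
    exact Real.le_sqrt_of_sq_le (by rwa [mul_pow])
  · have := (hb _ (chartDom_mono p (min_le_right _ _) (hsub hx)).2 v).2
    rw [← mul_pow] at this
    exact Real.sqrt_le_iff.2 ⟨by positivity, this⟩

theorem edist_le_pathELength {γ : ℝ → M} (hγ : ContMDiffOn 𝓘(ℝ, ℝ) 𝓘(ℝ, E) 1 γ (Icc 0 1)) {t : ℝ}
    (ht : t ∈ Icc (0 : ℝ) 1) : edist (γ 0) (γ t) ≤ pathELength 𝓘(ℝ, E) γ 0 1 := by
  rw [IsRiemannianManifold.out (I := 𝓘(ℝ, E)) (γ 0) (γ t)]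
  exact (riemannianEDist_le_pathELength (hγ.mono (Icc_subset_Icc le_rfl ht.2)) rfl rfl ht.1).trans
    (pathELength_mono le_rfl ht.2)

theorem mapsTo_eball {γ : ℝ → M} (hγ : ContMDiffOn 𝓘(ℝ, ℝ) 𝓘(ℝ, E) 1 γ (Icc 0 1)) {p : M}
    {r : ℝ≥0∞} (h : edist (γ 0) p + pathELength 𝓘(ℝ, E) γ 0 1 < r) :
    MapsTo γ (Icc 0 1) (Metric.eball p r) := fun t ht ↦ by
  rw [Metric.mem_eball]
  refine lt_of_le_of_lt ?_ h
  calc edist (γ t) p ≤ edist (γ t) (γ 0) + edist (γ 0) p := edist_triangle _ _ _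
    _ ≤ edist (γ 0) p + pathELength 𝓘(ℝ, E) γ 0 1 := by
      rw [add_comm, edist_comm (γ t)]
      gcongr
      exact edist_le_pathELength hγ ht

/-- The geodesic between two points of a normal neighbourhood. -/
def radial (E : Type*) [NormedAddCommGroup E] [NormedSpace ℝ E] {M : Type*} [EMetricSpace M]
    [ChartedSpace E M] (p : M) (X L : E × E → E) (x y : M) (t : ℝ) : M :=
  (extChartAt 𝓘(ℝ, E) p).symm (X (extChartAt 𝓘(ℝ, E) p x,
    t • L (extChartAt 𝓘(ℝ, E) p x, extChartAt 𝓘(ℝ, E) p y)))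

/-- The length of that geodesic. -/
def logNorm (p : M) (g : E → E →L[ℝ] E →L[ℝ] ℝ) (L : E × E → E) (x y : M) : ℝ :=
  √(g (extChartAt 𝓘(ℝ, E) p x) (L (extChartAt 𝓘(ℝ, E) p x, extChartAt 𝓘(ℝ, E) p y))
    (L (extChartAt 𝓘(ℝ, E) p x, extChartAt 𝓘(ℝ, E) p y)))

theorem isGeodesicSegment_exp {p : M} {g : E → E →L[ℝ] E →L[ℝ] ℝ} {R ρ σ : ℝ} {X L : E × E → E}
    (hC : IsChartMetric p g R) (hN : IsNormal g (extChartAt 𝓘(ℝ, E) p p) R ρ σ X L)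
    {x : M} (hx : x ∈ chartDom E p ρ) {v : E} (hv : v ∈ Metric.ball (0 : E) σ) :
    IsGeodesicSegment E (fun t ↦ (extChartAt 𝓘(ℝ, E) p).symm (X (extChartAt 𝓘(ℝ, E) p x, t • v)))
      x ((extChartAt 𝓘(ℝ, E) p).symm (X (extChartAt 𝓘(ℝ, E) p x, v))) ∧
    chartVec p (velocity (E := E) (fun t ↦ (extChartAt 𝓘(ℝ, E) p).symm
      (X (extChartAt 𝓘(ℝ, E) p x, t • v))) 0) = v ∧
    pathELength 𝓘(ℝ, E) (fun t ↦ (extChartAt 𝓘(ℝ, E) p).symm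
      (X (extChartAt 𝓘(ℝ, E) p x, t • v))) 0 1
      = ENNReal.ofReal √(g (extChartAt 𝓘(ℝ, E) p x) v v) := by
  have hgeod := hN.geod _ hx.2 v hv
  have hm : MapsTo (fun t : ℝ ↦ X (extChartAt 𝓘(ℝ, E) p x, t • v)) (Icc 0 1)
      (Metric.ball (extChartAt 𝓘(ℝ, E) p p) R) := fun t ht ↦
    hN.exp_mem _ hx.2 _ (smul_mem_ball_zero hv ht)
  have h0 : (0 : ℝ) ∈ Icc (0 : ℝ) 1 := left_mem_Icc.2 zero_le_one
  have hx0 : X (extChartAt 𝓘(ℝ, E) p x, (0 : ℝ) • v) = extChartAt 𝓘(ℝ, E) p x := by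
    rw [zero_smul, hN.exp_zero _ hx.2]
  have hw0 : fderiv ℝ (fun u ↦ X (extChartAt 𝓘(ℝ, E) p x, u)) ((0 : ℝ) • v) v = v := by
    rw [zero_smul, hN.fderiv_exp_zero _ hx.2]
  have hseg := hC.isGeodesicSegment hgeod hm
  refine ⟨?_, ?_, ?_⟩
  · simp only [hx0, one_smul, chartDom.symm_apply hx] at hseg
    exact hseg
  · exact (hC.chartVec_velocity_symm_comp hgeod hm h0).trans hw0
  · have hφ : ∀ t ∈ Icc (0 : ℝ) 1, extChartAt 𝓘(ℝ, E) p ((extChartAt 𝓘(ℝ, E) p).symm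
        (X (extChartAt 𝓘(ℝ, E) p x, t • v))) = X (extChartAt 𝓘(ℝ, E) p x, t • v) :=
      fun t ht ↦ (hC.symm_mem le_rfl (hm ht)).2
    rw [hC.pathELength_geodesic hseg.contMDiffOn
      (fun t ht ↦ (hC.symm_mem le_rfl (hm ht)).1) (hgeod.congr hφ fun _ _ ↦ rfl), hφ 0 h0, hx0, hw0]

namespace IsNormalNhd

variable {p : M} {g : E → E →L[ℝ] E →L[ℝ] ℝ} {R ρ σ ε κ C : ℝ} {X L : E × E → E}
  (hU : IsNormalNhd (E := E) p g R ρ σ X L ε κ C)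
include hU

theorem radial_isGeodesicSegment {x y : M} (hx : x ∈ chartDom E p ρ) (hy : y ∈ chartDom E p ρ) :
    IsGeodesicSegment E (radial E p X L x y) x y ∧
    pathELength 𝓘(ℝ, E) (radial E p X L x y) 0 1 = ENNReal.ofReal (logNorm p g L x y) := by
  have h := isGeodesicSegment_exp hU.chart hU.normal hx (hU.normal.log_mem _ hx.2 _ hy.2)
  rw [hU.normal.exp_log _ hx.2 _ hy.2, chartDom.symm_apply hy] at h
  exact ⟨h.1, h.2.2⟩

theorem logNorm_le_pathELength {γ : ℝ → M} (hγ : ContMDiffOn 𝓘(ℝ, ℝ) 𝓘(ℝ, E) 1 γ (Icc 0 1))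
    (hm : MapsTo γ (Icc 0 1) (chartDom E p ρ)) :
    ENNReal.ofReal (logNorm p g L (γ 0) (γ 1)) ≤ pathELength 𝓘(ℝ, E) γ 0 1 := by
  rw [hU.chart.pathELength_eq hγ (hm.mono_right (chartDom_mono p hU.normal.ρ_le))]
  exact hU.normal.le_lintegral hU.chart.metric (IsChartMetric.contDiffOn_chart_comp hγ hm)
    fun t ht ↦ (hm ht).2

theorem edist_le_logNorm {x y : M} (hx : x ∈ chartDom E p ρ) (hy : y ∈ chartDom E p ρ) :
    edist x y ≤ ENNReal.ofReal (logNorm p g L x y) := by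
  obtain ⟨h, hl⟩ := hU.radial_isGeodesicSegment hx hy
  rw [← hl, IsRiemannianManifold.out (I := 𝓘(ℝ, E)) x y]
  exact riemannianEDist_le_pathELength h.contMDiffOn h.source h.target zero_le_one

/-- The radial geodesic gives the upper bound. For the lower one, the hypothesis confines nearly
minimal curves: starting at `x` with length below `ε - d(x, p)`, they cannot leave the normal
neighbourhood, where radial geodesics are shortest. -/
theorem edist_eq {x y : M} (h : edist x p + edist x y < ENNReal.ofReal ε) :
    edist x y = ENNReal.ofReal (logNorm p g L x y) := by
  have hxp : x ∈ Metric.eball p (ENNReal.ofReal ε) := lt_of_le_of_lt le_self_add h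
  have hyp : y ∈ Metric.eball p (ENNReal.ofReal ε) := by
    rw [Metric.mem_eball]
    refine lt_of_le_of_lt (edist_triangle y x p) ?_
    rwa [add_comm, edist_comm y x]
  refine le_antisymm (hU.edist_le_logNorm (hU.eball_subset hxp) (hU.eball_subset hyp)) ?_
  have hxf : edist x p ≠ ⊤ := ((le_self_add.trans_lt h).trans_le le_top).ne
  refine le_of_forall_gt_imp_ge_of_dense fun r hr ↦ ?_
  have hlt : edist x y < min r (ENNReal.ofReal ε - edist x p) :=
    lt_min hr (lt_tsub_iff_left.2 h)
  rw [IsRiemannianManifold.out (I := 𝓘(ℝ, E)) x y] at hlt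
  obtain ⟨γ, rfl, rfl, hγ, hlen⟩ := exists_lt_of_riemannianEDist_lt hlt
  refine le_trans (hU.logNorm_le_pathELength hγ ?_) (hlen.le.trans (min_le_left _ _))
  refine (mapsTo_eball hγ ?_).mono_right hU.eball_subset
  exact lt_tsub_iff_left.1 (hlen.trans_le (min_le_right _ _))

theorem radial_isMinimalGeodesic {x y : M} (h : edist x p + edist x y < ENNReal.ofReal ε) :
    IsMinimalGeodesic E (radial E p X L x y) x y := by
  have hxp : x ∈ Metric.eball p (ENNReal.ofReal ε) := lt_of_le_of_lt le_self_add h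
  have hyp : y ∈ Metric.eball p (ENNReal.ofReal ε) := by
    rw [Metric.mem_eball]
    refine lt_of_le_of_lt (edist_triangle y x p) ?_
    rwa [add_comm, edist_comm y x]
  obtain ⟨h1, h2⟩ := hU.radial_isGeodesicSegment (hU.eball_subset hxp) (hU.eball_subset hyp)
  exact ⟨h1, by rw [h2, hU.edist_eq h]⟩

/-- A geodesic segment in the normal neighbourhood, in coordinates. -/
theorem isGeod {x y : M} {η : ℝ → M} (hη : IsGeodesicSegment E η x y)
    (hm : MapsTo η (Icc 0 1) (Metric.eball p (ENNReal.ofReal ε))) :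
    IsGeod g (fun t ↦ extChartAt 𝓘(ℝ, E) p (η t)) (fun t ↦ chartVec p (velocity (E := E) η t)) ∧
    pathELength 𝓘(ℝ, E) η 0 1 = ENNReal.ofReal √(g (extChartAt 𝓘(ℝ, E) p (η 0))
      (chartVec p (velocity (E := E) η 0)) (chartVec p (velocity (E := E) η 0))) := by
  have hm' := (hm.mono_right hU.eball_subset).mono_right (chartDom_mono p hU.normal.ρ_le)
  have h1 := hU.chart.isGeod_of_isGeodesicSegment hη hm'
  exact ⟨h1, hU.chart.pathELength_geodesic hη.contMDiffOn hm' h1⟩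

theorem norm_velocity_le {x y : M} {η : ℝ → M} (hη : IsGeodesicSegment E η x y)
    (hm : MapsTo η (Icc 0 1) (Metric.eball p (ENNReal.ofReal ε))) {ℓ : ℝ} (hℓ : 0 ≤ ℓ)
    (hlen : pathELength 𝓘(ℝ, E) η 0 1 ≤ ENNReal.ofReal ℓ) {t : ℝ} (ht : t ∈ Icc (0 : ℝ) 1) :
    κ * ‖chartVec p (velocity (E := E) η t)‖ ≤ ℓ := by
  obtain ⟨h1, h2⟩ := hU.isGeod hη hm
  rw [h2, ENNReal.ofReal_le_ofReal_iff hℓ] at hlen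
  refine (hU.norm_le _ (hm ht) _).trans ?_
  have := h1.energy_eq hU.chart.metric ht
  rwa [this]

/-- Short geodesic segments in the normal neighbourhood are determined by their end points. -/
theorem eqOn_radial {x y : M} {η : ℝ → M} (hη : IsGeodesicSegment E η x y)
    (hm : MapsTo η (Icc 0 1) (Metric.eball p (ENNReal.ofReal ε))) {ℓ : ℝ} (hℓ : 0 ≤ ℓ)
    (hlen : pathELength 𝓘(ℝ, E) η 0 1 ≤ ENNReal.ofReal ℓ) (hσ : ℓ < κ * σ) :
    EqOn η (radial E p X L x y) (Icc 0 1) := by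
  have h0 : (0 : ℝ) ∈ Icc (0 : ℝ) 1 := left_mem_Icc.2 zero_le_one
  have h1 : (1 : ℝ) ∈ Icc (0 : ℝ) 1 := right_mem_Icc.2 zero_le_one
  obtain ⟨hG, -⟩ := hU.isGeod hη hm
  have hw : ∀ t ∈ Icc (0 : ℝ) 1, ‖chartVec p (velocity (E := E) η t)‖ < σ := fun t ht ↦
    lt_of_mul_lt_mul_left ((hU.norm_velocity_le hη hm hℓ hlen ht).trans_lt hσ) hU.κ_pos.le
  have hx0 := (hU.eball_subset (hm h0)).2
  have hun := hU.normal.unique _ _ hG hx0 hw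
  simp only [hη.source] at hun hx0
  have hlog : L (extChartAt 𝓘(ℝ, E) p x, extChartAt 𝓘(ℝ, E) p y)
      = chartVec p (velocity (E := E) η 0) := by
    have := hun 1 h1
    rw [one_smul, hη.target] at this
    rw [this]
    exact hU.normal.log_exp _ hx0 _ (mem_ball_zero_iff.2 (hw 0 h0))
  intro t ht
  rw [radial, hlog, ← hun t ht, chartDom.symm_apply (hU.eball_subset (hm ht))]

end IsNormalNhd

end Distance

/-! ### Whitehead's convexity theorem. -/

section Whitehead

universe u

variable {E : Type u} [NormedAddCommGroup E] [NormedSpace ℝ E] [FiniteDimensional ℝ E]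
  [CompleteSpace E]
  {M : Type*} [EMetricSpace M] [ChartedSpace E M] [IsManifold 𝓘(ℝ, E) ∞ M]
  [RiemannianBundle (fun x : M ↦ TangentSpace 𝓘(ℝ, E) x)]
  [IsContMDiffRiemannianBundle 𝓘(ℝ, E) ∞ E (fun x : M ↦ TangentSpace 𝓘(ℝ, E) x)]
  [IsRiemannianManifold 𝓘(ℝ, E) M]

theorem chartVec_injective {p : M} {ξ η : TangentBundle 𝓘(ℝ, E) M} (hξ : ξ.proj ∈ (chartAt E p).source)
    (h : ξ.proj = η.proj) (hv : chartVec p ξ = chartVec p η) : ξ = η := by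
  obtain ⟨x, v⟩ := ξ
  obtain ⟨x', w⟩ := η
  have hx : x ∈ (extChartAt 𝓘(ℝ, E) p).source := by rwa [extChartAt_source]
  obtain rfl : x = x' := h
  obtain ⟨y, hy, rfl⟩ : ∃ y ∈ (extChartAt 𝓘(ℝ, E) p).target,
      (extChartAt 𝓘(ℝ, E) p).symm y = x :=
    ⟨_, (extChartAt 𝓘(ℝ, E) p).map_source hx, (extChartAt 𝓘(ℝ, E) p).left_inv hx⟩
  have h1 := mfderiv_symm_chartVec hy v
  rw [hv, mfderiv_symm_chartVec hy w] at h1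
  rw [h1]

namespace IsNormalNhd

variable {p : M} {g : E → E →L[ℝ] E →L[ℝ] ℝ} {R ρ σ ε κ C : ℝ} {X L : E × E → E}
  (hU : IsNormalNhd (E := E) p g R ρ σ X L ε κ C)
include hU

theorem edist_center_eq {z : M} (hz : z ∈ Metric.eball p (ENNReal.ofReal ε)) :
    edist z p = ENNReal.ofReal (logNorm p g L p z) := by
  rw [edist_comm]
  refine hU.edist_eq ?_
  rwa [edist_self, zero_add, edist_comm]

/-- The squared distance to the center is strongly convex along geodesics. -/
theorem logNorm_sq_le {x y : M} {η : ℝ → M} (hη : IsGeodesicSegment E η x y)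
    (hm : MapsTo η (Icc 0 1) (Metric.eball p (ENNReal.ofReal ε))) {ℓ : ℝ} (hℓ : 0 ≤ ℓ)
    (hlen : pathELength 𝓘(ℝ, E) η 0 1 = ENNReal.ofReal ℓ) {t : ℝ} (ht : t ∈ Icc (0 : ℝ) 1) :
    logNorm p g L p (η t) ^ 2 ≤ (1 - t) * logNorm p g L p x ^ 2 + t * logNorm p g L p y ^ 2
      - ℓ ^ 2 / 2 * (t * (1 - t)) := by
  obtain ⟨hG, hl⟩ := hU.isGeod hη hm
  obtain ⟨a, ha, hb⟩ := hU.normal.exists_hasDerivWithinAt_sq hU.chart.metric hG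
    fun t ht ↦ (hU.eball_subset (hm ht)).2
  have hsq : ∀ z, logNorm p g L p z ^ 2 = g (extChartAt 𝓘(ℝ, E) p p)
      (L (extChartAt 𝓘(ℝ, E) p p, extChartAt 𝓘(ℝ, E) p z))
      (L (extChartAt 𝓘(ℝ, E) p p, extChartAt 𝓘(ℝ, E) p z)) := fun z ↦
    Real.sq_sqrt (hU.chart.metric.nonneg _ _)
  rw [hl, ENNReal.ofReal_eq_ofReal_iff (Real.sqrt_nonneg _) hℓ] at hlen
  have hκ : ∀ t ∈ Icc (0 : ℝ) 1, ℓ ^ 2 ≤ hessSq g (extChartAt 𝓘(ℝ, E) p p) L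
      (extChartAt 𝓘(ℝ, E) p (η t)) (chartVec p (velocity (E := E) η t)) := fun t ht ↦ by
    refine le_trans (le_of_eq ?_) (hU.le_hess _ (hm ht) _)
    rw [hG.energy_eq hU.chart.metric ht, ← hlen, Real.sq_sqrt (hU.chart.metric.nonneg _ _)]
  have := le_chord_of_le_deriv₂ ha hb hκ ht
  rw [hsq, hsq, hsq, ← hη.source, ← hη.target]
  exact this

/-- Convexity of the squared distance to `p` along geodesics keeps the radial geodesic inside the
ball. It also bounds the length of any geodesic running in the ball, and geodesics shorter than `κ *
σ` are determined by their end points. -/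
theorem isStronglyConvex {α : ℝ} (hα : 0 < α) (h1 : 4 * α ≤ ε) (h2 : 4 * α ≤ κ * σ) :
    IsStronglyConvex E (Metric.eball p (ENNReal.ofReal α)) := by
  have hcl : closure (Metric.eball p (ENNReal.ofReal α)) ⊆
      Metric.closedEBall p (ENNReal.ofReal α) :=
    closure_minimal Metric.eball_subset_closedEBall Metric.isClosed_closedEBall
  have hlt : ∀ {a : ℝ}, a < 4 * α → ENNReal.ofReal a < ENNReal.ofReal ε := fun ha ↦
    (ENNReal.ofReal_lt_ofReal_iff hU.ε_pos).2 (ha.trans_le h1)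
  have hmem : ∀ z, edist z p ≤ ENNReal.ofReal α → z ∈ Metric.eball p (ENNReal.ofReal ε) :=
    fun z hz ↦ hz.trans_lt (hlt (by linarith))
  have hle : ∀ z, edist z p ≤ ENNReal.ofReal α → logNorm p g L p z ≤ α := fun z hz ↦ by
    rwa [hU.edist_center_eq (hmem z hz), ENNReal.ofReal_le_ofReal_iff hα.le] at hz
  have hnn : ∀ z, 0 ≤ logNorm p g L p z := fun z ↦ Real.sqrt_nonneg _
  intro x hx y hy hxy
  replace hx : edist x p ≤ ENNReal.ofReal α := hcl hx
  replace hy : edist y p ≤ ENNReal.ofReal α := hcl hy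
  have hxy2 : edist x y ≤ ENNReal.ofReal (2 * α) := by
    rw [two_mul, ENNReal.ofReal_add hα.le hα.le]
    refine (edist_triangle x p y).trans (add_le_add hx ?_)
    rwa [edist_comm]
  have hsum : edist x p + edist x y < ENNReal.ofReal ε := by
    refine (add_le_add hx hxy2).trans_lt ?_
    rw [← ENNReal.ofReal_add hα.le (by positivity)]
    exact hlt (by linarith)
  have hmin := hU.radial_isMinimalGeodesic hsum
  have hmaps : ∀ η, IsMinimalGeodesic E η x y →
      MapsTo η (Icc 0 1) (Metric.eball p (ENNReal.ofReal ε)) := fun η hη ↦ by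
    refine mapsTo_eball hη.contMDiffOn ?_
    rwa [hη.source, hη.length_eq]
  have hdx := hle x hx
  have hdy := hle y hy
  have hdx2 : logNorm p g L p x ^ 2 ≤ α ^ 2 := pow_le_pow_left₀ (hnn x) hdx 2
  have hdy2 : logNorm p g L p y ^ 2 ≤ α ^ 2 := pow_le_pow_left₀ (hnn y) hdy 2
  refine ⟨radial E p X L x y, hmin, fun t ht ↦ ?_, fun η hη hηB ↦ ?_, fun η hη ↦ ?_⟩
  · have ht' : t ∈ Icc (0 : ℝ) 1 := ⟨ht.1.le, ht.2.le⟩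
    have hlen := hmin.length_eq.trans (hU.edist_eq hsum)
    have hconv := hU.logNorm_sq_le hmin.toIsGeodesicSegment (hmaps _ hmin)
      (ℓ := logNorm p g L x y) (Real.sqrt_nonneg _)
      hlen ht'
    rw [Metric.mem_eball, hU.edist_center_eq (hmaps _ hmin ht'), ENNReal.ofReal_lt_ofReal_iff hα]
    refine lt_of_pow_lt_pow_left₀ 2 hα.le (hconv.trans_lt ?_)
    have ht1 : 0 < 1 - t := sub_pos.2 ht.2
    have e1 := mul_le_mul_of_nonneg_left hdy2 ht.1.le
    have e2 := mul_le_mul_of_nonneg_left hdx2 ht1.le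
    have e3 : 0 ≤ logNorm p g L x y ^ 2 / 2 * (t * (1 - t)) :=
      mul_nonneg (by positivity) (mul_pos ht.1 ht1).le
    -- Strict inequality comes from the quadratic correction if the end points differ, and from the
    -- starting point being interior otherwise.
    rcases hxy with hne | hxB
    · have hpos : 0 < logNorm p g L x y := by
        have := edist_pos.2 hne
        rwa [hU.edist_eq hsum, ENNReal.ofReal_pos] at this
      have e3 : 0 < logNorm p g L x y ^ 2 / 2 * (t * (1 - t)) :=
        mul_pos (by positivity) (mul_pos ht.1 ht1)
      linarith
    · have hxB' : logNorm p g L p x < α := by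
        rw [Metric.mem_eball, hU.edist_center_eq (hmem x hx),
          ENNReal.ofReal_lt_ofReal_iff hα] at hxB
        exact hxB
      have e2 := mul_lt_mul_of_pos_left (pow_lt_pow_left₀ hxB' (hnn x) two_ne_zero) ht1
      linarith
  · have hm : MapsTo η (Icc 0 1) (Metric.eball p (ENNReal.ofReal ε)) := fun t ht ↦ by
      rcases eq_endpoints_or_mem_Ioo_of_mem_Icc ht with rfl | rfl | h
      · rw [hη.source]; exact hmem x hx
      · rw [hη.target]; exact hmem y hy
      · exact hmem _ (le_of_lt (hηB h))
    obtain ⟨-, hl⟩ := hU.isGeod hη hm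
    have hconv := hU.logNorm_sq_le hη hm (Real.sqrt_nonneg _) hl
      (t := 1 / 2) ⟨by norm_num, by norm_num⟩
    -- At the midpoint the convexity estimate reads `0 ≤ α² - ℓ² / 8` for the length `ℓ` of `η`, so
    -- `ℓ² ≤ 8 α² ≤ (3 α)²`, and `3 α < 4 α ≤ κ σ`.
    refine hU.eqOn_radial hη hm (ℓ := 3 * α) (by positivity) ?_ (by linarith)
    rw [hl]
    refine ENNReal.ofReal_le_ofReal (le_of_sq_le_sq ?_ (by positivity))
    have := sq_nonneg (logNorm p g L p (η (1 / 2)))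
    have := sq_nonneg α
    linarith
  · refine hU.eqOn_radial hη.toIsGeodesicSegment (hmaps η hη) (ℓ := 2 * α) (by positivity) ?_
      (by linarith)
    rw [hη.length_eq]
    exact hxy2

/-- The exponential map at the center is a diffeomorphism onto small balls. -/
theorem expIsDiffeoOnBall {α : ℝ} (hα : 0 < α) (h1 : 4 * α ≤ ε) (h2 : 4 * α ≤ κ * σ) :
    ExpIsDiffeoOnBall E p α := by
  have hp : p ∈ chartDom E p ρ := mem_chartDom_self p hU.normal.ρ_pos
  have hpt := mem_extChartAt_target (I := 𝓘(ℝ, E)) p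
  have hpε : p ∈ Metric.eball p (ENNReal.ofReal ε) :=
    Metric.mem_eball_self (ENNReal.ofReal_pos.2 hU.ε_pos)
  set x₀ : E := extChartAt 𝓘(ℝ, E) p p with hx₀
  have hps : (extChartAt 𝓘(ℝ, E) p).symm x₀ = p := extChartAt_to_inv p
  let A : TangentSpace 𝓘(ℝ, E) p →L[ℝ] E := mfderiv 𝓘(ℝ, E) 𝓘(ℝ, E) (extChartAt 𝓘(ℝ, E) p) p
  obtain ⟨B, hBA, hAB⟩ : ∃ B : E →L[ℝ] TangentSpace 𝓘(ℝ, E) p, (∀ v, B (A v) = v) ∧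
      ∀ v, A (B v) = v := by
    have hinj : Function.Injective A := fun v w hvw ↦ by
      have := chartVec_injective (E := E) (p := p) (ξ := ⟨p, v⟩) (η := ⟨p, w⟩)
        (mem_chart_source E p) rfl hvw
      simpa using this
    have : FiniteDimensional ℝ (TangentSpace 𝓘(ℝ, E) p) :=
      inferInstanceAs (FiniteDimensional ℝ E)
    let e : TangentSpace 𝓘(ℝ, E) p ≃ₗ[ℝ] E := LinearEquiv.ofInjectiveOfFinrankEq A.toLinearMap hinj
      rfl
    exact ⟨e.symm.toContinuousLinearEquiv, fun v ↦ e.symm_apply_apply v, fun v ↦ e.apply_symm_apply v⟩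
  have hnorm : ∀ v : TangentSpace 𝓘(ℝ, E) p, ‖v‖ = √(g x₀ (A v) (A v)) := fun v ↦
    hU.chart.norm_eq (mem_chartDom_self p hU.chart.R_pos) v
  -- The Riemannian norm of `v` is at least `κ ‖A v‖`, and `α < κ σ`.
  have hAσ : ∀ v ∈ Metric.ball (0 : TangentSpace 𝓘(ℝ, E) p) α, A v ∈ Metric.ball (0 : E) σ := by
    intro v hv
    rw [mem_ball_zero_iff, hnorm] at hv
    have := hU.norm_le p hpε (A v)
    rw [mem_ball_zero_iff]
    refine lt_of_mul_lt_mul_left (a := κ) ?_ hU.κ_pos.le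
    linarith
  have hseg := fun v hv ↦ isGeodesicSegment_exp hU.chart hU.normal hp (hAσ v hv)
  rw [← hx₀] at hseg
  have hεsub : Metric.eball p (ENNReal.ofReal α) ⊆ Metric.eball p (ENNReal.ofReal ε) :=
    Metric.eball_subset_eball (ENNReal.ofReal_le_ofReal (by linarith))
  have hsub : Metric.eball p (ENNReal.ofReal α) ⊆ chartDom E p ρ := hεsub.trans hU.eball_subset
  have hXR : ∀ v ∈ Metric.ball (0 : TangentSpace 𝓘(ℝ, E) p) α,
      X (x₀, A v) ∈ Metric.ball x₀ R := fun v hv ↦ hU.normal.exp_mem _ hp.2 _ (hAσ v hv)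
  have hto : ContMDiffOn 𝓘(ℝ, TangentSpace 𝓘(ℝ, E) p) 𝓘(ℝ, E) ∞
      (fun v : TangentSpace 𝓘(ℝ, E) p ↦ (extChartAt 𝓘(ℝ, E) p).symm (X (x₀, A v)))
      (Metric.ball 0 α) := by
    have s1 : ContMDiffOn 𝓘(ℝ, E) 𝓘(ℝ, E) ∞ (extChartAt 𝓘(ℝ, E) p).symm
      (extChartAt 𝓘(ℝ, E) p).target := contMDiffOn_extChartAt_symm (n := ∞) p
    have s2 : ContDiffOn ℝ ∞ (fun v : TangentSpace 𝓘(ℝ, E) p ↦ X (x₀, A v)) (Metric.ball 0 α) :=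
      (hU.normal.contDiffOn_exp_right hp.2).comp A.contDiff.contDiffOn hAσ
    exact s1.comp s2.contMDiffOn fun v hv ↦ hU.chart.ball_subset (hXR v hv)
  have hinv : ContMDiffOn 𝓘(ℝ, E) 𝓘(ℝ, TangentSpace 𝓘(ℝ, E) p) ∞
      (fun y : M ↦ B (L (x₀, extChartAt 𝓘(ℝ, E) p y))) (Metric.eball p (ENNReal.ofReal α)) := by
    have s1 : ContMDiffOn 𝓘(ℝ, E) 𝓘(ℝ, E) ∞ (extChartAt 𝓘(ℝ, E) p) (chartAt E p).source :=
      contMDiffOn_extChartAt (n := ∞)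
    have s2 : ContDiffOn ℝ ∞ (fun y ↦ B (L (x₀, y))) (Metric.ball x₀ ρ) :=
      B.contDiff.comp_contDiffOn (hU.normal.contDiffOn_log_right hp.2)
    exact s2.contMDiffOn.comp (s1.mono fun y hy ↦ (hsub hy).1) fun y hy ↦ (hsub hy).2
  let Φ : OpenPartialHomeomorph (TangentSpace 𝓘(ℝ, E) p) M :=
    { toFun := fun v ↦ (extChartAt 𝓘(ℝ, E) p).symm (X (x₀, A v))
      invFun := fun y ↦ B (L (x₀, extChartAt 𝓘(ℝ, E) p y))
      source := Metric.ball 0 α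
      target := Metric.eball p (ENNReal.ofReal α)
      map_source' := fun v hv ↦ by
        obtain ⟨s1, -, s3⟩ := hseg v hv
        have s4 : edist p ((extChartAt 𝓘(ℝ, E) p).symm (X (x₀, A v))) ≤ ENNReal.ofReal ‖v‖ := by
          rw [hnorm, ← s3, IsRiemannianManifold.out (I := 𝓘(ℝ, E)) p]
          exact riemannianEDist_le_pathELength s1.contMDiffOn s1.source s1.target zero_le_one
        rw [Metric.mem_eball, edist_comm]
        refine s4.trans_lt ((ENNReal.ofReal_lt_ofReal_iff hα).2 ?_)
        rwa [mem_ball_zero_iff] at hv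
      map_target' := fun y hy ↦ by
        rw [mem_ball_zero_iff, hnorm, hAB]
        rw [Metric.mem_eball, hU.edist_center_eq (hεsub hy), ENNReal.ofReal_lt_ofReal_iff hα] at hy
        exact hy
      left_inv' := fun v hv ↦ by
        rw [(hU.chart.symm_mem le_rfl (hXR v hv)).2, hU.normal.log_exp _ hp.2 _ (hAσ v hv), hBA]
      right_inv' := fun y hy ↦ by
        rw [hAB, hU.normal.exp_log _ hp.2 _ (hsub hy).2, chartDom.symm_apply (hsub hy)]
      open_source := Metric.isOpen_ball
      open_target := Metric.isOpen_eball
      continuousOn_toFun := hto.continuousOn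
      continuousOn_invFun := hinv.continuousOn }
  refine ⟨Φ, rfl, rfl, hto, hinv, fun v hv ↦ ?_⟩
  obtain ⟨s1, s2, -⟩ := hseg v hv
  refine ⟨_, s1, chartVec_injective (p := p) ?_ s1.source ?_⟩
  · have : (velocity (E := E) (fun t : ℝ ↦ (extChartAt 𝓘(ℝ, E) p).symm (X (x₀, t • A v))) 0).proj
      = p := s1.source
    rw [this]
    exact mem_chart_source E p
  · exact s2

end IsNormalNhd

/-- Whitehead's theorem: small balls are strongly convex normal balls. -/
theorem exists_isWhiteheadBall (p : M) :
    ∃ r : ℝ, 0 < r ∧ ∀ α, 0 < α → α ≤ r → IsWhiteheadBall E p α := by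
  obtain ⟨g, R, ρ, σ, X, L, ε, κ, C, hU⟩ := exists_isNormalNhd (E := E) p
  have hσ := mul_pos hU.κ_pos hU.normal.σ_pos
  refine ⟨min ε (κ * σ) / 4, by have := lt_min hU.ε_pos hσ; positivity, fun α hα hαr ↦ ?_⟩
  have h1 : 4 * α ≤ ε := by linarith [min_le_left ε (κ * σ)]
  have h2 : 4 * α ≤ κ * σ := by linarith [min_le_right ε (κ * σ)]
  exact ⟨hU.isStronglyConvex hα h1 h2, hU.expIsDiffeoOnBall hα h1 h2⟩

end Whitehead

/-! ### Linear differential equations with small coefficients. -/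

section LinearODE

universe u

variable {E : Type u} [NormedAddCommGroup E] [NormedSpace ℝ E]

/-- In integrated form the equation is `(1 - T) S = 1` with `‖T‖ ≤ 1 / 2`, solved by inverting `1 -
T`. Small coefficients are all that short geodesics require. -/
theorem exists_fundamental_solution [CompleteSpace E] {A : ℝ → E →L[ℝ] E}
    (hA : ContinuousOn A (Icc 0 1)) (hb : ∀ t ∈ Icc (0 : ℝ) 1, ‖A t‖ ≤ 1 / 2) :
    ∃ S : ℝ → E →L[ℝ] E, S 0 = .id ℝ E ∧
      ∀ t ∈ Icc (0 : ℝ) 1, HasDerivWithinAt S ((A t).comp (S t)) (Icc 0 1) t := by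
  let 𝒜 : C(Icc (0 : ℝ) 1, E →L[ℝ] E) := ⟨fun t ↦ A t, hA.domRestrict⟩
  let B := pointwiseCLM (Icc (0 : ℝ) 1) (ContinuousLinearMap.compL ℝ E E E) 𝒜
  let T := (primitive (E →L[ℝ] E)).comp B
  have hB : ‖B‖ ≤ 1 / 2 := by
    refine (ContinuousLinearMap.le_opNorm _ _).trans ?_
    have h1 : ‖𝒜‖ ≤ 1 / 2 := (ContinuousMap.norm_le _ (by norm_num)).2 fun t ↦ hb t t.2
    have h2 : ‖pointwiseCLM (Icc (0 : ℝ) 1) (ContinuousLinearMap.compL ℝ E E E)‖ ≤ 1 :=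
      (norm_pointwiseCLM_le _).trans (ContinuousLinearMap.norm_compL_le ℝ E E E)
    calc _ ≤ 1 * (1 / 2 : ℝ) := mul_le_mul h2 h1 (norm_nonneg _) zero_le_one
      _ = 1 / 2 := one_mul _
  have hT : ‖T‖ < 1 := by
    refine (ContinuousLinearMap.opNorm_comp_le _ _).trans_lt ?_
    calc _ ≤ 1 * (1 / 2 : ℝ) := mul_le_mul norm_primitive_le hB (norm_nonneg _) zero_le_one
      _ < 1 := by norm_num
  obtain ⟨U, hU⟩ := isUnit_one_sub_of_norm_lt_one hT
  let c : C(Icc (0 : ℝ) 1, E →L[ℝ] E) := ContinuousMap.const _ (.id ℝ E)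
  let S : C(Icc (0 : ℝ) 1, E →L[ℝ] E) := (↑U⁻¹ : C(Icc (0 : ℝ) 1, E →L[ℝ] E) →L[ℝ] _) c
  have hS : S = c + primitive (E →L[ℝ] E) (B S) := by
    have h1 : (1 - T) S = c := by
      rw [← hU]
      exact ContinuousLinearMap.ext_iff.1 U.mul_inv c
    have h2 : (1 - T) S = S - primitive (E →L[ℝ] E) (B S) := rfl
    rw [← h1, h2, sub_add_cancel]
  have hSt : ∀ t ∈ Icc (0 : ℝ) 1, extendIcc S t
      = .id ℝ E + extendIcc (primitive (E →L[ℝ] E) (B S)) t := fun t ht ↦ by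
    rw [extendIcc_of_mem _ ht, extendIcc_of_mem _ ht]
    exact congrArg (fun f : C(Icc (0 : ℝ) 1, E →L[ℝ] E) ↦ f ⟨t, ht⟩) hS
  have h0 : (0 : ℝ) ∈ Icc (0 : ℝ) 1 := left_mem_Icc.2 zero_le_one
  refine ⟨extendIcc S, by rw [hSt 0 h0, extendIcc_primitive_zero, add_zero], fun t ht ↦ ?_⟩
  have h1 := ((hasDerivWithinAt_extendIcc_primitive (B S) ht).const_add
    (ContinuousLinearMap.id ℝ E)).congr hSt (hSt t ht)
  have h2 : extendIcc (B S) t = (A t).comp (extendIcc S t) := by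
    rw [extendIcc_of_mem _ ht, extendIcc_of_mem _ ht]
    rfl
  rwa [h2] at h1

/-- In place of Grönwall's inequality: at a maximum point `s` of `‖X‖` one has `‖X s‖ ≤ ‖X 0‖ + β ‖X
s‖`, whence `‖X s‖ ≤ 2 ‖X 0‖`. -/
theorem norm_sub_le_of_norm_deriv_le_mul {X X' : ℝ → E} {β : ℝ} (hβ : 0 ≤ β) (hβ' : β ≤ 1 / 2)
    (hX : ∀ t ∈ Icc (0 : ℝ) 1, HasDerivWithinAt X (X' t) (Icc 0 1) t)
    (hb : ∀ t ∈ Icc (0 : ℝ) 1, ‖X' t‖ ≤ β * ‖X t‖) : ‖X 1 - X 0‖ ≤ 2 * β * ‖X 0‖ := by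
  have h0 : (0 : ℝ) ∈ Icc (0 : ℝ) 1 := left_mem_Icc.2 zero_le_one
  have h1 : (1 : ℝ) ∈ Icc (0 : ℝ) 1 := right_mem_Icc.2 zero_le_one
  have hc : ContinuousOn (fun t ↦ ‖X t‖) (Icc 0 1) :=
    ContinuousOn.norm fun t ht ↦ (hX t ht).continuousWithinAt
  obtain ⟨s, hs, hmax⟩ := isCompact_Icc.exists_isMaxOn ⟨0, h0⟩ hc
  have hmax' : ∀ t ∈ Icc (0 : ℝ) 1, ‖X t‖ ≤ ‖X s‖ := hmax
  have key : ∀ t ∈ Icc (0 : ℝ) 1, ‖X t - X 0‖ ≤ β * ‖X s‖ := fun t ht ↦ by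
    have := norm_image_sub_le_of_norm_deriv_le_segment' (C := β * ‖X s‖) hX
      (fun t ht ↦ (hb t ⟨ht.1, ht.2.le⟩).trans
        (mul_le_mul_of_nonneg_left (hmax' t ⟨ht.1, ht.2.le⟩) hβ)) t ht
    refine this.trans (mul_le_of_le_one_right (by positivity) ?_)
    linarith [ht.2]
  have h2 : ‖X s‖ ≤ 2 * ‖X 0‖ := by
    have e1 := key s hs
    have e2 : ‖X s‖ ≤ ‖X s - X 0‖ + ‖X 0‖ := by
      simpa using norm_add_le (X s - X 0) (X 0)
    have e3 := mul_le_mul_of_nonneg_right hβ' (norm_nonneg (X s))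
    linarith
  refine (key 1 h1).trans ?_
  have := mul_le_mul_of_nonneg_left h2 hβ
  linarith

end LinearODE

/-! ### Parallel translation between nearby points. -/

section ParallelTranslation

universe u

variable {E : Type u} [NormedAddCommGroup E] [NormedSpace ℝ E] [FiniteDimensional ℝ E]
  {M : Type*} [EMetricSpace M] [ChartedSpace E M] [IsManifold 𝓘(ℝ, E) ∞ M]
  [RiemannianBundle (fun x : M ↦ TangentSpace 𝓘(ℝ, E) x)]
  [IsContMDiffRiemannianBundle 𝓘(ℝ, E) ∞ E (fun x : M ↦ TangentSpace 𝓘(ℝ, E) x)]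
  [IsRiemannianManifold 𝓘(ℝ, E) M]

/-- The differential of the chart around `p`, as an isomorphism of `T_x M` with the model space. -/
def chartEquiv {p x : M} (hx : x ∈ (chartAt E p).source) : TangentSpace 𝓘(ℝ, E) x ≃L[ℝ] E :=
  have : FiniteDimensional ℝ (TangentSpace 𝓘(ℝ, E) x) := inferInstanceAs (FiniteDimensional ℝ E)
  let A : TangentSpace 𝓘(ℝ, E) x →L[ℝ] E := mfderiv 𝓘(ℝ, E) 𝓘(ℝ, E) (extChartAt 𝓘(ℝ, E) p) x
  (LinearEquiv.ofInjectiveOfFinrankEq A.toLinearMap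
    (fun v w hvw ↦ by
      have := chartVec_injective (E := E) (p := p) (ξ := ⟨x, v⟩) (η := ⟨x, w⟩) hx rfl hvw
      simpa using this) rfl).toContinuousLinearEquiv

theorem chartEquiv_apply {p x : M} (hx : x ∈ (chartAt E p).source) (v : TangentSpace 𝓘(ℝ, E) x) :
    chartEquiv hx v = chartVec p ⟨x, v⟩ := rfl

namespace IsNormalNhd

variable {p : M} {g : E → E →L[ℝ] E →L[ℝ] ℝ} {R ρ σ ε κ C : ℝ} {X L : E × E → E}
  (hU : IsNormalNhd (E := E) p g R ρ σ X L ε κ C)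
include hU

/-- Along short geodesics the coefficients of the parallel transport equation are small. -/
theorem exists_norm_spray_velocity_le {θ : ℝ} (hθ : 0 < θ) :
    ∃ r : ℝ, 0 < r ∧ ∀ x ∈ Metric.eball p (ENNReal.ofReal r),
      ∀ y ∈ Metric.eball p (ENNReal.ofReal r), ∀ γ, IsMinimalGeodesic E γ x y →
      MapsTo γ (Icc 0 1) (chartDom E p R) ∧
      IsGeod g (fun t ↦ extChartAt 𝓘(ℝ, E) p (γ t)) (fun t ↦ chartVec p (velocity (E := E) γ t)) ∧
      ∀ t ∈ Icc (0 : ℝ) 1, ‖spray g (extChartAt 𝓘(ℝ, E) p (γ t))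
        (chartVec p (velocity (E := E) γ t))‖ ≤ θ := by
  set x₀ := extChartAt 𝓘(ℝ, E) p p with hx₀
  have hcont : ContinuousAt (fun y ↦ ‖spray g y‖) x₀ :=
    (hU.chart.metric.contDiff_spray.continuous.norm).continuousAt
  set K := ‖spray g x₀‖ + 1 with hK
  have hKpos : 0 < K := by positivity
  obtain ⟨s, hs, hsK⟩ := Metric.eventually_nhds_iff_ball.1
    (hcont.eventually (gt_mem_nhds (show ‖spray g x₀‖ < K by linarith)))
  obtain ⟨e, he, hes⟩ := exists_ofReal_eball_subset ((isOpen_chartDom (E := E) p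
    s).mem_nhds (mem_chartDom_self p hs))
  have hκ := hU.κ_pos
  -- A minimal geodesic between points of the `r`-ball has length below `2 r`, so it stays in the `3
  -- r`-ball, where the spray is bounded by `K`. Its coordinate speed is at most `2 r / κ`, so the
  -- coefficient is at most `2 r K / κ ≤ θ`.
  set r := min (min (ε / 3) (e / 3)) (κ * θ / (2 * K)) with hr
  have hrpos : 0 < r := lt_min (lt_min (div_pos hU.ε_pos three_pos) (by positivity)) (by positivity)
  have hr0 : r ≤ min (ε / 3) (e / 3) := min_le_left _ _
  have hr1 : 3 * r ≤ ε := by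
    have := hr0.trans (min_le_left _ _)
    linarith
  have hr2 : 3 * r ≤ e := by
    have := hr0.trans (min_le_right _ _)
    linarith
  have hr3 : K * (2 * r) ≤ κ * θ := by
    have : r ≤ κ * θ / (2 * K) := min_le_right _ _
    rw [le_div_iff₀ (by positivity)] at this
    linarith
  refine ⟨r, hrpos, fun x hx y hy γ hγ ↦ ?_⟩
  rw [Metric.mem_eball] at hx hy
  have hlen : pathELength 𝓘(ℝ, E) γ 0 1 < ENNReal.ofReal (2 * r) := by
    rw [hγ.length_eq, two_mul, ENNReal.ofReal_add hrpos.le hrpos.le]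
    refine (edist_triangle x p y).trans_lt (ENNReal.add_lt_add hx ?_)
    rwa [edist_comm]
  have hm : MapsTo γ (Icc 0 1) (Metric.eball p (ENNReal.ofReal (3 * r))) := by
    refine mapsTo_eball hγ.contMDiffOn ?_
    rw [hγ.source, show 3 * r = r + 2 * r by ring, ENNReal.ofReal_add hrpos.le (by positivity)]
    exact ENNReal.add_lt_add hx hlen
  have hmε : MapsTo γ (Icc 0 1) (Metric.eball p (ENNReal.ofReal ε)) :=
    hm.mono_right (Metric.eball_subset_eball (ENNReal.ofReal_le_ofReal hr1))
  have hme : MapsTo γ (Icc 0 1) (chartDom E p s) :=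
    (hm.mono_right (Metric.eball_subset_eball
      (ENNReal.ofReal_le_ofReal hr2))).mono_right hes
  refine ⟨(hmε.mono_right hU.eball_subset).mono_right (chartDom_mono p hU.normal.ρ_le),
    (hU.isGeod hγ.toIsGeodesicSegment hmε).1, fun t ht ↦ ?_⟩
  have h1 := hU.norm_velocity_le hγ.toIsGeodesicSegment hmε (by positivity) hlen.le ht
  have h2 : ‖spray g (extChartAt 𝓘(ℝ, E) p (γ t))‖ ≤ K := (hsK _ (hme ht).2).le
  refine (ContinuousLinearMap.le_opNorm _ _).trans ?_
  refine (mul_le_mul_of_nonneg_right h2 (norm_nonneg _)).trans ?_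
  refine le_of_mul_le_mul_left ?_ hκ
  have := mul_le_mul_of_nonneg_left h1 hKpos.le
  linarith

/-- In the chart, parallel translations between nearby points are close to the identity. -/
theorem exists_norm_parallel_sub_le {θ : ℝ} (hθ : 0 < θ) :
    ∃ r : ℝ, 0 < r ∧ ∀ x ∈ Metric.eball p (ENNReal.ofReal r),
      ∀ y ∈ Metric.eball p (ENNReal.ofReal r), ∀ P, IsParallelTranslation x y P →
      ∀ v : TangentSpace 𝓘(ℝ, E) x,
        ‖chartVec (E := E) p ⟨y, P v⟩ - chartVec (E := E) p ⟨x, v⟩‖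
          ≤ θ * ‖chartVec (E := E) p ⟨x, v⟩‖ := by
  set β := min (θ / 2) (1 / 2) with hβ
  have hβpos : 0 < β := lt_min (by positivity) (by norm_num)
  obtain ⟨r, hr, H⟩ := hU.exists_norm_spray_velocity_le hβpos
  refine ⟨r, hr, fun x hx y hy P hP v ↦ ?_⟩
  obtain ⟨γ, hγ, -, hZ⟩ := hP
  obtain ⟨Z, hZγ, hZp, hZ0, hZ1⟩ := hZ v
  obtain ⟨hm, hG, hsp⟩ := H x hx y hy γ hγ
  have hX : ∀ t ∈ Icc (0 : ℝ) 1, HasDerivWithinAt (fun τ ↦ chartVec p (Z τ))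
      (-(spray g (extChartAt 𝓘(ℝ, E) p (γ t)) (chartVec p (velocity (E := E) γ t))
        (chartVec p (Z t)))) (Icc 0 1) t := fun t ht ↦ by
    have h1 := hU.chart.hasDerivWithinAt_of_isParallelOn hZp ht (by rw [hZγ t ht]; exact hm ht)
    have h2 : derivWithin (fun τ ↦ extChartAt 𝓘(ℝ, E) p (Z τ).proj) (Icc 0 1) t
        = chartVec p (velocity (E := E) γ t) := by
      rw [← (hG.deriv t ht).derivWithin (uniqueDiffOn_Icc zero_lt_one t ht)]
      exact derivWithin_congr (fun τ hτ ↦ by rw [hZγ τ hτ]) (by rw [hZγ t ht])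
    rwa [h2, hZγ t ht] at h1
  have key := norm_sub_le_of_norm_deriv_le_mul hβpos.le (min_le_right _ _) hX fun t ht ↦ by
    rw [norm_neg]
    exact (ContinuousLinearMap.le_opNorm _ _).trans
      (mul_le_mul_of_nonneg_right (hsp t ht) (norm_nonneg _))
  rw [hZ0, hZ1] at key
  refine key.trans (mul_le_mul_of_nonneg_right ?_ (norm_nonneg _))
  linarith [min_le_left (θ / 2) (1 / 2)]

/-- Strong convexity of a small ball supplies the unique minimal geodesic. Along it the coordinate
equation has coefficient at most `1 / 2`, so its fundamental solution at time `1`, conjugated by the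
charts, is the translation. -/
theorem exists_isParallelTranslation :
    ∃ r : ℝ, 0 < r ∧ ∀ y ∈ Metric.eball p (ENNReal.ofReal r),
      ∀ x ∈ Metric.eball p (ENNReal.ofReal r),
      ∃ P : TangentSpace 𝓘(ℝ, E) y →L[ℝ] TangentSpace 𝓘(ℝ, E) x, IsParallelTranslation y x P := by
  obtain ⟨r₁, hr₁, H⟩ := hU.exists_norm_spray_velocity_le (θ := 1 / 2) (by norm_num)
  have := FiniteDimensional.complete ℝ E
  obtain ⟨r₂, hr₂, hW⟩ := exists_isWhiteheadBall (E := E) p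
  refine ⟨min r₁ r₂, lt_min hr₁ hr₂, fun y hy x hx ↦ ?_⟩
  have hx1 : x ∈ Metric.eball p (ENNReal.ofReal r₁) :=
    Metric.eball_subset_eball (ENNReal.ofReal_le_ofReal (min_le_left _ _)) hx
  have hx2 : x ∈ Metric.eball p (ENNReal.ofReal r₂) :=
    Metric.eball_subset_eball (ENNReal.ofReal_le_ofReal (min_le_right _ _)) hx
  have hy1 : y ∈ Metric.eball p (ENNReal.ofReal r₁) :=
    Metric.eball_subset_eball (ENNReal.ofReal_le_ofReal (min_le_left _ _)) hy
  have hy2 : y ∈ Metric.eball p (ENNReal.ofReal r₂) :=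
    Metric.eball_subset_eball (ENNReal.ofReal_le_ofReal (min_le_right _ _)) hy
  obtain ⟨γ, hγ, -, -, hun⟩ := (hW r₂ hr₂ le_rfl).stronglyConvex y (subset_closure hy2) x
    (subset_closure hx2) (Or.inr hy2)
  obtain ⟨hm, hG, hsp⟩ := H y hy1 x hx1 γ hγ
  set c : ℝ → E := fun t ↦ extChartAt 𝓘(ℝ, E) p (γ t) with hc
  set w : ℝ → E := fun t ↦ chartVec p (velocity (E := E) γ t) with hw
  have hA : ContinuousOn (fun t ↦ -(spray g (c t) (w t))) (Icc 0 1) :=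
    ((hU.chart.metric.contDiff_spray.continuous.comp_continuousOn hG.continuousOn).clm_apply
      hG.continuousOn_velocity).neg
  obtain ⟨S, hS0, hS⟩ := exists_fundamental_solution hA fun t ht ↦ by
    rw [norm_neg]; exact hsp t ht
  have h0 : (0 : ℝ) ∈ Icc (0 : ℝ) 1 := left_mem_Icc.2 zero_le_one
  have h1 : (1 : ℝ) ∈ Icc (0 : ℝ) 1 := right_mem_Icc.2 zero_le_one
  have hxs : x ∈ (chartAt E p).source := by
    have := (hm h1).1
    rwa [hγ.target] at this
  have hys : y ∈ (chartAt E p).source := by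
    have := (hm h0).1
    rwa [hγ.source] at this
  refine ⟨((chartEquiv hxs).symm : E →L[ℝ] TangentSpace 𝓘(ℝ, E) x).comp
    ((S 1).comp (chartEquiv hys : TangentSpace 𝓘(ℝ, E) y →L[ℝ] E)),
    γ, hγ, hun, fun v ↦ ?_⟩
  have hct : ∀ t ∈ Icc (0 : ℝ) 1, c t ∈ (extChartAt 𝓘(ℝ, E) p).target := fun t ht ↦
    hU.chart.ball_subset (hm ht).2
  have hsymm : ∀ t ∈ Icc (0 : ℝ) 1, (extChartAt 𝓘(ℝ, E) p).symm (c t) = γ t := fun t ht ↦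
    chartDom.symm_apply (hm ht)
  let Z : ℝ → TangentBundle 𝓘(ℝ, E) M := fun t ↦ ⟨(extChartAt 𝓘(ℝ, E) p).symm (c t),
    mfderiv 𝓘(ℝ, E) 𝓘(ℝ, E) (extChartAt 𝓘(ℝ, E) p).symm (c t) (S t (chartVec p ⟨y, v⟩))⟩
  have hZv : ∀ t ∈ Icc (0 : ℝ) 1, chartVec p (Z t) = S t (chartVec p ⟨y, v⟩) := fun t ht ↦
    chartVec_symm (hct t ht) _
  have hZc : ∀ t ∈ Icc (0 : ℝ) 1, extChartAt 𝓘(ℝ, E) p (Z t).proj = c t := fun t ht ↦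
    (extChartAt 𝓘(ℝ, E) p).right_inv (hct t ht)
  refine ⟨Z, hsymm, hU.chart.isParallelOn (w := w) (fun t ht ↦ ?_) (fun t ht ↦ ?_) (fun t ht ↦ ?_),
    ?_, ?_⟩
  · have : (Z t).proj = γ t := hsymm t ht
    rw [this]
    exact hm ht
  · exact (hG.deriv t ht).congr hZc (hZc t ht)
  · rw [hZc t ht, hZv t ht]
    have h2 := (hS t ht).clm_apply (hasDerivWithinAt_const t (Icc 0 1) (chartVec p ⟨y, v⟩))
    simp only [map_zero, add_zero] at h2
    exact h2.congr hZv (hZv t ht)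
  · have hp0 : (Z 0).proj = y := (hsymm 0 h0).trans hγ.source
    refine chartVec_injective (p := p) (by rw [hp0]; exact hys) hp0 ?_
    rw [hZv 0 h0, hS0]
    rfl
  · have hp1 : (Z 1).proj = x := (hsymm 1 h1).trans hγ.target
    refine chartVec_injective (p := p) (by rw [hp1]; exact hxs) hp1 ?_
    rw [hZv 1 h1, ← chartEquiv_apply hxs]
    exact ((chartEquiv hxs).apply_symm_apply (S 1 (chartVec p ⟨y, v⟩))).symm

end IsNormalNhd

end ParallelTranslation

/-! ### Cluster points of bounded functions. -/

section Cluster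

variable {Y V : Type*} [TopologicalSpace Y] [NormedAddCommGroup V] [ProperSpace V]
  {l : Filter Y} {f : Y → V}

theorem isCompact_setOf_mapClusterPt {B : ℝ} (hb : ∀ᶠ z in l, ‖f z‖ ≤ B) :
    IsCompact {A | MapClusterPt A l f} := by
  refine (isCompact_closedBall (0 : V) B).of_isClosed_subset isClosed_setOfPred_clusterPt fun A hA ↦ ?_
  refine isClosed_iff_clusterPt.1 Metric.isClosed_closedBall A (ClusterPt.mono hA ?_)
  rw [le_principal_iff, mem_map]
  filter_upwards [hb] with z hz
  simpa using hz

/-- Otherwise `f` is frequently in the part of a closed ball outside the thickening. That part is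
compact, so it would contain a cluster point. -/
theorem eventually_mem_thickening_mapClusterPt {B : ℝ} (hb : ∀ᶠ z in l, ‖f z‖ ≤ B) {η : ℝ}
    (hη : 0 < η) : ∀ᶠ z in l, f z ∈ Metric.thickening η {A | MapClusterPt A l f} := by
  by_contra hne
  have hfr : ∃ᶠ z in l, f z ∈ Metric.closedBall (0 : V) B \
      Metric.thickening η {A | MapClusterPt A l f} := by
    refine ((not_eventually.1 hne).and_eventually hb).mono fun z hz ↦
      ⟨by simpa using hz.2, hz.1⟩
  obtain ⟨A, hA, hcl⟩ := ((isCompact_closedBall (0 : V) B).diff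
    Metric.isOpen_thickening).exists_mapClusterPt_of_frequently hfr
  exact hA.2 (Metric.self_subset_thickening hη _ hcl)

theorem exists_seq_of_mapClusterPt [l.IsCountablyGenerated] {A : V} (h : MapClusterPt A l f) :
    ∃ z : ℕ → Y, Tendsto z atTop l ∧ Tendsto (fun i ↦ f (z i)) atTop (𝓝 A) := by
  have : (l ⊓ comap f (𝓝 A)).NeBot := by
    rw [inf_comm, ← map_neBot_iff f, Filter.push_pull']
    exact h
  obtain ⟨z, hz⟩ := exists_seq_tendsto (l ⊓ comap f (𝓝 A))
  exact ⟨z, (tendsto_inf.1 hz).1, tendsto_comap_iff.1 (tendsto_inf.1 hz).2⟩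

end Cluster

/-! ### Convex hulls of compact sets. -/

section ConvexHull

/-- The convex hull of a compact set in a finite-dimensional space is compact. -/
theorem isCompact_convexHull {V : Type*} [NormedAddCommGroup V]
    [NormedSpace ℝ V] [FiniteDimensional ℝ V] {s : Set V} (hs : IsCompact s) :
    IsCompact (convexHull ℝ s) := by
  rcases s.eq_empty_or_nonempty with rfl | ⟨x₀, hx₀⟩
  · simp
  -- Carathéodory: `dim V + 1` points suffice, so the hull is the continuous image of a simplex
  -- times a power of `s`. Shorter combinations are padded with zero weights at `x₀`.
  set n := Module.finrank ℝ V + 1 with hn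
  have hK : IsCompact (stdSimplex ℝ (Fin n) ×ˢ Set.univ.pi fun _ : Fin n ↦ s) :=
    (isCompact_stdSimplex ℝ (Fin n)).prod (isCompact_univ_pi fun _ ↦ hs)
  have hc : Continuous fun a : (Fin n → ℝ) × (Fin n → V) ↦ ∑ i, a.1 i • a.2 i := by fun_prop
  convert! hK.image hc
  refine Subset.antisymm (fun x hx ↦ ?_) ?_
  · obtain ⟨ι, _, z, w, hz, haff, hw, hw1, rfl⟩ := eq_pos_convex_span_of_mem_convexHull hx
    have hcard : Fintype.card ι ≤ Fintype.card (Fin n) := by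
      rw [Fintype.card_fin]
      exact haff.card_le_finrank_succ.trans
        (Nat.add_le_add_right (Submodule.finrank_le _) 1)
    obtain ⟨f⟩ := Function.Embedding.nonempty_of_card_le hcard
    have hoff : ∀ j, j ∉ Set.range f → Function.extend f w 0 j = 0 := fun j hj ↦ by
      rw [Function.extend_apply' _ _ _ (by simpa using hj)]
      rfl
    refine ⟨(Function.extend f w 0, Function.extend f z fun _ ↦ x₀), ⟨⟨fun j ↦ ?_, ?_⟩, fun j _ ↦ ?_⟩,
      ?_⟩
    · by_cases hj : j ∈ Set.range f
      · obtain ⟨i, rfl⟩ := hj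
        simp only [f.injective.extend_apply]
        exact (hw i).le
      · exact (hoff j hj).ge
    · rw [← hw1]
      refine (Fintype.sum_of_injective f f.injective _ _ (fun j hj ↦ hoff j hj) fun i ↦ ?_).symm
      rw [f.injective.extend_apply]
    · by_cases hj : j ∈ Set.range f
      · obtain ⟨i, rfl⟩ := hj
        simp only [f.injective.extend_apply]
        exact hz ⟨i, rfl⟩
      · simp only
        rw [Function.extend_apply' _ _ _ (by simpa using hj)]
        exact hx₀
    · refine (Fintype.sum_of_injective f f.injective _ _ (fun j hj ↦ ?_) fun i ↦ ?_).symm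
      · simp only [hoff j hj, zero_smul]
      · simp only [f.injective.extend_apply]
  · rintro _ ⟨⟨w, z⟩, ⟨⟨hw0, hw1⟩, hz⟩, rfl⟩
    exact (convex_convexHull ℝ s).sum_mem (fun i _ ↦ hw0 i) hw1
      fun i _ ↦ subset_convexHull ℝ s (hz i (mem_univ i))

end ConvexHull

/-! ### Separation and perturbation of sets of surjections. -/

section Separation

variable {E E' : Type*} [NormedAddCommGroup E] [NormedSpace ℝ E] [FiniteDimensional ℝ E]
  [NormedAddCommGroup E'] [NormedSpace ℝ E'] [FiniteDimensional ℝ E']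

/-- Reflexivity turns a separating functional on covectors into an actual direction `v`. -/
theorem exists_eval_eq (f : (E →L[ℝ] ℝ) →L[ℝ] ℝ) : ∃ v : E, ∀ ℓ, f ℓ = ℓ v := by
  let F : Module.Dual ℝ (Module.Dual ℝ E) :=
    f.toLinearMap ∘ₗ (LinearMap.toContinuousLinearMap : (E →ₗ[ℝ] ℝ) ≃ₗ[ℝ] E →L[ℝ] ℝ).toLinearMap
  obtain ⟨v, hv⟩ := (Module.evalEquiv ℝ E).surjective F
  refine ⟨v, fun ℓ ↦ ?_⟩
  have h := LinearMap.congr_fun hv ℓ.toLinearMap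
  simp only [Module.evalEquiv_apply, Module.Dual.eval_apply] at h
  exact h.symm

/-- A compact convex set of surjections admits a direction in which they all increase a given
functional. -/
theorem exists_pos_le_apply [Nontrivial E] {𝒞 : Set (E →L[ℝ] E')} (hc : IsCompact 𝒞)
    (hconv : Convex ℝ 𝒞) (hs : ∀ A ∈ 𝒞, Function.Surjective A) {ℓ : E' →L[ℝ] ℝ} (hℓ : ℓ ≠ 0) :
    ∃ v : E, ‖v‖ = 1 ∧ ∃ s > 0, ∀ A ∈ 𝒞, s ≤ ℓ (A v) := by
  rcases 𝒞.eq_empty_or_nonempty with rfl | ⟨A₀, hA₀⟩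
  · obtain ⟨v, hv⟩ := exists_norm_eq E zero_le_one
    exact ⟨v, hv, 1, one_pos, by simp⟩
  let Λ : (E →L[ℝ] E') →L[ℝ] (E →L[ℝ] ℝ) := ContinuousLinearMap.compL ℝ E E' ℝ ℓ
  -- A functional that vanishes on the range of a surjection is zero.
  have h0 : (0 : E →L[ℝ] ℝ) ∉ Λ '' 𝒞 := by
    rintro ⟨A, hA, h⟩
    refine hℓ (ContinuousLinearMap.ext fun w ↦ ?_)
    obtain ⟨v, rfl⟩ := hs A hA w
    exact ContinuousLinearMap.ext_iff.1 h v
  obtain ⟨f, u, hu, hfu⟩ := geometric_hahn_banach_point_closed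
    (hconv.linear_image Λ.toLinearMap) (hc.image Λ.continuous).isClosed h0
  obtain ⟨v, hv⟩ := exists_eval_eq f
  rw [map_zero] at hu
  have hpos : ∀ A ∈ 𝒞, u < ℓ (A v) := fun A hA ↦ by
    have := hfu _ (mem_image_of_mem Λ hA)
    rwa [hv] at this
  have hv0 : 0 < ‖v‖ := norm_pos_iff.2 fun h ↦ by
    have := hpos A₀ hA₀
    rw [h, map_zero, map_zero] at this
    linarith
  refine ⟨‖v‖⁻¹ • v, by rw [norm_smul, norm_inv, norm_norm, inv_mul_cancel₀ hv0.ne'], ‖v‖⁻¹ * u,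
    by positivity, fun A hA ↦ ?_⟩
  rw [map_smul, map_smul, smul_eq_mul]
  exact mul_le_mul_of_nonneg_left (hpos A hA).le (by positivity)

/-- The direction found for one `ℓ₀` with margin `s` also serves nearby covectors and a thickening
of `𝒞`: each perturbation costs at most `s / 4`, leaving `s / 2`. Compactness of `Λ` needs finitely
many such choices. -/
theorem exists_uniform_pos_le_apply [Nontrivial E] {𝒞 : Set (E →L[ℝ] E')} (hc : IsCompact 𝒞)
    (hconv : Convex ℝ 𝒞) (hs : ∀ A ∈ 𝒞, Function.Surjective A) {Λ : Set (E' →L[ℝ] ℝ)}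
    (hΛ : IsCompact Λ) (h0 : (0 : E' →L[ℝ] ℝ) ∉ Λ) :
    ∃ δ > 0, ∃ η > 0, ∀ ℓ ∈ Λ, ∃ v : E, ‖v‖ = 1 ∧ ∀ A ∈ Metric.cthickening η 𝒞, δ ≤ ℓ (A v) := by
  refine hΛ.induction_on (p := fun S ↦ ∃ δ > 0, ∃ η > 0, ∀ ℓ ∈ S, ∃ v : E, ‖v‖ = 1 ∧
    ∀ A ∈ Metric.cthickening η 𝒞, δ ≤ ℓ (A v)) ?_ ?_ ?_ ?_
  · exact ⟨1, one_pos, 1, one_pos, by simp⟩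
  · rintro s t hst ⟨δ, hδ, η, hη, h⟩
    exact ⟨δ, hδ, η, hη, fun ℓ hℓ ↦ h ℓ (hst hℓ)⟩
  · rintro s t ⟨δ, hδ, η, hη, h⟩ ⟨δ', hδ', η', hη', h'⟩
    refine ⟨min δ δ', lt_min hδ hδ', min η η', lt_min hη hη', ?_⟩
    rintro ℓ (hℓ | hℓ)
    · obtain ⟨v, hv, H⟩ := h ℓ hℓ
      exact ⟨v, hv, fun A hA ↦ (min_le_left _ _).trans
        (H A (Metric.cthickening_mono (min_le_left _ _) _ hA))⟩
    · obtain ⟨v, hv, H⟩ := h' ℓ hℓ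
      exact ⟨v, hv, fun A hA ↦ (min_le_right _ _).trans
        (H A (Metric.cthickening_mono (min_le_right _ _) _ hA))⟩
  · intro ℓ₀ hℓ₀
    obtain ⟨v, hv, s, hs0, H⟩ := exists_pos_le_apply hc hconv hs
      (fun h ↦ h0 (h ▸ hℓ₀) : ℓ₀ ≠ 0)
    obtain ⟨B, hB⟩ := hc.isBounded.exists_norm_le
    set B' := max B 0 + 1 with hB'
    have hB'1 : 1 ≤ B' := by linarith [le_max_right B 0]
    set η := min 1 (s / (4 * (‖ℓ₀‖ + 1))) with hη
    have hηpos : 0 < η := lt_min one_pos (by positivity)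
    set τ := s / (4 * B') with hτ
    have hτpos : 0 < τ := by positivity
    refine ⟨Metric.ball ℓ₀ τ, mem_nhdsWithin_of_mem_nhds (Metric.ball_mem_nhds _ hτpos),
      s / 2, by positivity, η, hηpos, fun ℓ hℓ ↦ ⟨v, hv, fun A hA ↦ ?_⟩⟩
    rw [hc.cthickening_eq_biUnion_closedBall hηpos.le, mem_iUnion₂] at hA
    obtain ⟨A₀, hA₀, hAA₀⟩ := hA
    rw [mem_closedBall_iff_norm] at hAA₀
    rw [mem_ball_iff_norm] at hℓ
    have e1 : ‖A‖ ≤ B' := by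
      have t1 : ‖A‖ ≤ ‖A - A₀‖ + ‖A₀‖ := by simpa using norm_add_le (A - A₀) A₀
      have := hB A₀ hA₀
      have := min_le_left 1 (s / (4 * (‖ℓ₀‖ + 1)))
      have := le_max_left B 0
      linarith
    have e2 : ‖(ℓ - ℓ₀) (A v)‖ ≤ s / 4 := by
      calc ‖(ℓ - ℓ₀) (A v)‖ ≤ ‖ℓ - ℓ₀‖ * ‖A v‖ := ContinuousLinearMap.le_opNorm _ _
        _ ≤ τ * (B' * 1) := by
          refine mul_le_mul hℓ.le ?_ (norm_nonneg _) hτpos.le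
          rw [← hv]
          exact A.le_of_opNorm_le e1 v
        _ = s / 4 := by rw [hτ]; field_simp
    have e3 : ‖ℓ₀ ((A - A₀) v)‖ ≤ s / 4 := by
      calc ‖ℓ₀ ((A - A₀) v)‖ ≤ ‖ℓ₀‖ * ‖(A - A₀) v‖ := ContinuousLinearMap.le_opNorm _ _
        _ ≤ (‖ℓ₀‖ + 1) * (s / (4 * (‖ℓ₀‖ + 1)) * 1) := by
          refine mul_le_mul (by linarith) ?_ (norm_nonneg _) (by positivity)
          have := (A - A₀).le_of_opNorm_le (hAA₀.trans (min_le_right _ _)) v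
          rwa [hv] at this
        _ = s / 4 := by field_simp
    have e4 := H A₀ hA₀
    have e5 : ℓ (A v) = (ℓ - ℓ₀) (A v) + ℓ₀ ((A - A₀) v) + ℓ₀ (A₀ v) := by
      simp only [_root_.sub_apply, map_sub]
      ring
    rw [Real.norm_eq_abs] at e2 e3
    have := (abs_le.1 e2).1
    have := (abs_le.1 e3).1
    linarith

/-- A proper subspace of `E'` is killed by a nonzero functional, which can be rescaled to norm `a`.
-/
theorem surjective_of_forall_functional {A : E →L[ℝ] E'} {a : ℝ} (ha : 0 < a)
    (h : ∀ ℓ : E' →L[ℝ] ℝ, ‖ℓ‖ = a → ∃ v, 0 < ℓ (A v)) : Function.Surjective A := by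
  by_contra hA
  have hlt : LinearMap.range A.toLinearMap < ⊤ :=
    lt_top_iff_ne_top.2 fun h ↦ hA (LinearMap.range_eq_top.1 h)
  obtain ⟨f, hf0, hf⟩ := Submodule.exists_le_ker_of_lt_top _ hlt
  let f' : E' →L[ℝ] ℝ := LinearMap.toContinuousLinearMap f
  have hf'0 : 0 < ‖f'‖ := norm_pos_iff.2 fun h ↦ hf0 (by
    ext w
    exact ContinuousLinearMap.ext_iff.1 h w)
  obtain ⟨v, hv⟩ := h ((a / ‖f'‖) • f') (by
    rw [norm_smul, Real.norm_of_nonneg (by positivity), div_mul_cancel₀ _ hf'0.ne'])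
  have : f' (A v) = 0 := hf ⟨v, rfl⟩
  rw [_root_.smul_apply, this, smul_zero] at hv
  exact lt_irrefl _ hv

/-- `QDP - D = (Q - 1)D(P - 1) + (Q - 1)D + D(P - 1)`, and each summand is at most `B θ` since `θ ≤
1`. -/
theorem norm_comp_comp_sub_le {Q : E' →L[ℝ] E'} {D : E →L[ℝ] E'} {P : E →L[ℝ] E} {θ B : ℝ}
    (hθ1 : θ ≤ 1) (hQ : ‖Q - .id ℝ E'‖ ≤ θ) (hP : ‖P - .id ℝ E‖ ≤ θ) (hD : ‖D‖ ≤ B) :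
    ‖Q.comp (D.comp P) - D‖ ≤ 3 * B * θ := by
  have hθ : 0 ≤ θ := (norm_nonneg _).trans hP
  have hB : 0 ≤ B := (norm_nonneg _).trans hD
  have e : Q.comp (D.comp P) - D = (Q - .id ℝ E').comp (D.comp (P - .id ℝ E))
      + (Q - .id ℝ E').comp D + D.comp (P - .id ℝ E) := by
    ext v
    simp
  have h1 : ‖D.comp (P - .id ℝ E)‖ ≤ B * θ :=
    (ContinuousLinearMap.opNorm_comp_le _ _).trans (mul_le_mul hD hP (norm_nonneg _) hB)
  have h2 : ‖(Q - .id ℝ E').comp D‖ ≤ θ * B :=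
    (ContinuousLinearMap.opNorm_comp_le _ _).trans (mul_le_mul hQ hD (norm_nonneg _) hθ)
  have h3 : ‖(Q - .id ℝ E').comp (D.comp (P - .id ℝ E))‖ ≤ 1 * (B * θ) :=
    (ContinuousLinearMap.opNorm_comp_le _ _).trans
      (mul_le_mul (hQ.trans hθ1) h1 (norm_nonneg _) zero_le_one)
  rw [e]
  refine (norm_add₃_le).trans ?_
  linarith

end Separation

/-! ### Riemannian distance versus coordinate distance. -/

section Comparison

universe u

variable {E : Type u} [NormedAddCommGroup E] [NormedSpace ℝ E] [FiniteDimensional ℝ E]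

/-- `L` and `X` are locally Lipschitz; compare `L (a, b)` with `L (a, a) = 0`, and `X (a, L (a, b))
= b` with `X (a, 0) = a`. -/
theorem IsNormal.exists_norm_log_bounds {g : E → E →L[ℝ] E →L[ℝ] ℝ} {x₀ : E} {R ρ σ : ℝ}
    {X L : E × E → E} (hN : IsNormal g x₀ R ρ σ X L) :
    ∃ s > 0, s ≤ ρ ∧ ∃ A > 0, ∀ a ∈ Metric.ball x₀ s, ∀ b ∈ Metric.ball x₀ s,
      ‖L (a, b)‖ ≤ A * ‖b - a‖ ∧ ‖b - a‖ ≤ A * ‖L (a, b)‖ := by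
  have hx₀ := hN.mem_center
  have h0 : (0 : E) ∈ Metric.ball (0 : E) σ := Metric.mem_ball_self hN.σ_pos
  have hL : ContDiffAt ℝ ∞ L (x₀, x₀) := hN.contDiffOn_log.contDiffAt
    (prod_mem_nhds (Metric.isOpen_ball.mem_nhds hx₀) (Metric.isOpen_ball.mem_nhds hx₀))
  have hX : ContDiffAt ℝ ∞ X (x₀, 0) := hN.contDiffOn_exp.contDiffAt
    (prod_mem_nhds (Metric.isOpen_ball.mem_nhds hx₀) (Metric.isOpen_ball.mem_nhds h0))
  obtain ⟨K, t, ht, hK⟩ := (hL.of_le (m := 1) (by simp)).exists_lipschitzOnWith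
  obtain ⟨K', t', ht', hK'⟩ := (hX.of_le (m := 1) (by simp)).exists_lipschitzOnWith
  have c1 : Tendsto (fun z : E × E ↦ (z.1, z.1)) (𝓝 (x₀, x₀)) (𝓝 (x₀, x₀)) :=
    (continuous_fst.prodMk continuous_fst).continuousAt
  have c2 : Tendsto (fun z : E × E ↦ (z.1, L z)) (𝓝 (x₀, x₀)) (𝓝 (x₀, 0)) := by
    have : ContinuousAt (fun z : E × E ↦ (z.1, L z)) (x₀, x₀) :=
      continuousAt_fst.prodMk hL.continuousAt
    rw [ContinuousAt, hN.log_self hx₀] at this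
    exact this
  have c3 : Tendsto (fun z : E × E ↦ (z.1, (0 : E))) (𝓝 (x₀, x₀)) (𝓝 (x₀, 0)) :=
    (continuous_fst.prodMk continuous_const).continuousAt
  have hev : ∀ᶠ z in 𝓝 (x₀, x₀), z ∈ t ∧ (z.1, z.1) ∈ t ∧ (z.1, L z) ∈ t' ∧ (z.1, (0 : E)) ∈ t' :=
    (Filter.Eventually.and ht ((c1.eventually ht).and ((c2.eventually ht').and (c3.eventually ht'))))
  obtain ⟨s, hs, H⟩ := Metric.eventually_nhds_iff_ball.1 hev
  refine ⟨min s ρ, lt_min hs hN.ρ_pos, min_le_right _ _, max (K : ℝ) K' + 1, by positivity,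
    fun a ha b hb ↦ ?_⟩
  have ha' := Metric.ball_subset_ball (min_le_right s ρ) ha
  have hb' := Metric.ball_subset_ball (min_le_right s ρ) hb
  obtain ⟨i1, i2, i3, i4⟩ := H (a, b) (by
    rw [← ball_prod_same]
    exact ⟨Metric.ball_subset_ball (min_le_left s ρ) ha,
      Metric.ball_subset_ball (min_le_left s ρ) hb⟩)
  have hKK : (K : ℝ) ≤ max (K : ℝ) K' + 1 := by linarith [le_max_left (K : ℝ) K']
  have hKK' : (K' : ℝ) ≤ max (K : ℝ) K' + 1 := by linarith [le_max_right (K : ℝ) K']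
  constructor
  · have := hK.norm_sub_le i1 i2
    rw [hN.log_self ha', sub_zero, Prod.mk_sub_mk, sub_self, Prod.norm_mk, norm_zero,
      max_eq_right (norm_nonneg _)] at this
    exact this.trans (mul_le_mul_of_nonneg_right hKK (norm_nonneg _))
  · have := hK'.norm_sub_le i3 i4
    rw [hN.exp_log a ha' b hb', hN.exp_zero a ha', Prod.mk_sub_mk, sub_self, Prod.norm_mk,
      norm_zero, sub_zero, max_eq_right (norm_nonneg _)] at this
    exact this.trans (mul_le_mul_of_nonneg_right hKK' (norm_nonneg _))

variable {M : Type*} [EMetricSpace M] [ChartedSpace E M] [IsManifold 𝓘(ℝ, E) ∞ M]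
  [RiemannianBundle (fun x : M ↦ TangentSpace 𝓘(ℝ, E) x)]
  [IsContMDiffRiemannianBundle 𝓘(ℝ, E) ∞ E (fun x : M ↦ TangentSpace 𝓘(ℝ, E) x)]
  [IsRiemannianManifold 𝓘(ℝ, E) M]

theorem ofReal_eball_mem_nhds (p : M) {r : ℝ} (hr : 0 < r) :
    Metric.eball p (ENNReal.ofReal r) ∈ 𝓝 p :=
  Metric.eball_mem_nhds p (ENNReal.ofReal_pos.2 hr)

/-- Near `p` the Riemannian distance is equivalent to the distance in the chart. -/
theorem IsNormalNhd.exists_dist_bounds {p : M} {g : E → E →L[ℝ] E →L[ℝ] ℝ} {R ρ σ ε κ C : ℝ}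
    {X L : E × E → E} (hU : IsNormalNhd (E := E) p g R ρ σ X L ε κ C) :
    ∃ A > 0, ∃ s ∈ 𝓝 p, ∀ x ∈ s, ∀ y ∈ s,
      edist x y ≤ ENNReal.ofReal (A * ‖extChartAt 𝓘(ℝ, E) p y - extChartAt 𝓘(ℝ, E) p x‖) ∧
      ENNReal.ofReal ‖extChartAt 𝓘(ℝ, E) p y - extChartAt 𝓘(ℝ, E) p x‖
        ≤ ENNReal.ofReal A * edist x y := by
  obtain ⟨s, hs, hsρ, A, hA, H⟩ := hU.normal.exists_norm_log_bounds
  have hε := hU.ε_pos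
  have hκ := hU.κ_pos
  have hC := hU.C_pos
  refine ⟨max (C * A) (A / κ), by positivity, chartDom E p s ∩
    Metric.eball p (ENNReal.ofReal (ε / 3)), Filter.inter_mem
      ((isOpen_chartDom p s).mem_nhds (mem_chartDom_self p hs))
      (ofReal_eball_mem_nhds p (by positivity)), fun x hx y hy ↦ ?_⟩
  have hxε : x ∈ Metric.eball p (ENNReal.ofReal ε) :=
    Metric.eball_subset_eball (ENNReal.ofReal_le_ofReal (by linarith)) hx.2
  have hx2 := Metric.mem_eball.1 hx.2
  have hy2 := Metric.mem_eball.1 hy.2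
  have hsum : edist x p + edist x y < ENNReal.ofReal ε := by
    rw [show ε = ε / 3 + (ε / 3 + ε / 3) by ring, ENNReal.ofReal_add (by positivity) (by positivity),
      ENNReal.ofReal_add (by positivity) (by positivity)]
    refine ENNReal.add_lt_add hx2 ((edist_triangle x p y).trans_lt (ENNReal.add_lt_add hx2 ?_))
    rwa [edist_comm]
  obtain ⟨b1, b2⟩ := H _ hx.1.2 _ hy.1.2
  set ℓ := L (extChartAt 𝓘(ℝ, E) p x, extChartAt 𝓘(ℝ, E) p y) with hℓ
  have b3 := hU.norm_le x hxε ℓ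
  have b4 := hU.le_norm x hxε ℓ
  rw [hU.edist_eq hsum, logNorm, ← hℓ, ← ENNReal.ofReal_mul (by positivity)]
  constructor
  · refine ENNReal.ofReal_le_ofReal (b4.trans ?_)
    calc C * ‖ℓ‖ ≤ C * (A * ‖extChartAt 𝓘(ℝ, E) p y - extChartAt 𝓘(ℝ, E) p x‖) :=
          mul_le_mul_of_nonneg_left b1 hC.le
      _ = C * A * ‖extChartAt 𝓘(ℝ, E) p y - extChartAt 𝓘(ℝ, E) p x‖ := by ring
      _ ≤ _ := mul_le_mul_of_nonneg_right (le_max_left _ _) (norm_nonneg _)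
  · refine ENNReal.ofReal_le_ofReal (b2.trans ?_)
    calc A * ‖ℓ‖ = A / κ * (κ * ‖ℓ‖) := by field_simp
      _ ≤ A / κ * √(g (extChartAt 𝓘(ℝ, E) p x) ℓ ℓ) :=
          mul_le_mul_of_nonneg_left b3 (by positivity)
      _ ≤ _ := mul_le_mul_of_nonneg_right (le_max_right _ _) (Real.sqrt_nonneg _)

end Comparison

/-! ### The map and its Jacobian in charts. -/

section CoordinateMap

universe u u'

variable {E : Type u} [NormedAddCommGroup E] [NormedSpace ℝ E] [FiniteDimensional ℝ E]
  {M : Type*} [EMetricSpace M] [ChartedSpace E M] [IsManifold 𝓘(ℝ, E) ∞ M]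
  [RiemannianBundle (fun x : M ↦ TangentSpace 𝓘(ℝ, E) x)]
  [IsContMDiffRiemannianBundle 𝓘(ℝ, E) ∞ E (fun x : M ↦ TangentSpace 𝓘(ℝ, E) x)]
  [IsRiemannianManifold 𝓘(ℝ, E) M]
  {E' : Type u'} [NormedAddCommGroup E'] [NormedSpace ℝ E'] [FiniteDimensional ℝ E']
  {N : Type*} [EMetricSpace N] [ChartedSpace E' N] [IsManifold 𝓘(ℝ, E') ∞ N]
  [RiemannianBundle (fun y : N ↦ TangentSpace 𝓘(ℝ, E') y)]
  [IsContMDiffRiemannianBundle 𝓘(ℝ, E') ∞ E' (fun y : N ↦ TangentSpace 𝓘(ℝ, E') y)]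
  [IsRiemannianManifold 𝓘(ℝ, E') N]

variable (E E') in
/-- The map `F` in the charts around `p` and `F p`. -/
def coordMap (F : M → N) (p : M) (y : E) : E' :=
  extChartAt 𝓘(ℝ, E') (F p) (F ((extChartAt 𝓘(ℝ, E) p).symm y))

variable (E E') in
/-- The Jacobian of `F` in the charts around `p` and `F p`. -/
def coordDeriv (F : M → N) (p z : M) : E →L[ℝ] E' :=
  fderiv ℝ (coordMap E E' F p) (extChartAt 𝓘(ℝ, E) p z)

theorem coordDeriv_chartVec {F : M → N} {p z : M} (hz : z ∈ (chartAt E p).source)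
    (hFz : F z ∈ (chartAt E' (F p)).source) (hd : MDifferentiableAt 𝓘(ℝ, E) 𝓘(ℝ, E') F z)
    (v : TangentSpace 𝓘(ℝ, E) z) :
    chartVec (E := E') (F p) ⟨F z, mfderiv 𝓘(ℝ, E) 𝓘(ℝ, E') F z v⟩
      = coordDeriv E E' F p z (chartVec p ⟨z, v⟩) := by
  have hz' : z ∈ (extChartAt 𝓘(ℝ, E) p).source := by rwa [extChartAt_source]
  obtain ⟨y, hy, rfl⟩ : ∃ y ∈ (extChartAt 𝓘(ℝ, E) p).target,
      (extChartAt 𝓘(ℝ, E) p).symm y = z :=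
    ⟨_, (extChartAt 𝓘(ℝ, E) p).map_source hz', (extChartAt 𝓘(ℝ, E) p).left_inv hz'⟩
  rw [coordDeriv, (extChartAt 𝓘(ℝ, E) p).right_inv hy]
  have hs := mdifferentiableAt_symm (E := E) hy
  have h1 := mfderiv_comp (I := 𝓘(ℝ, E)) (I' := 𝓘(ℝ, E)) (I'' := 𝓘(ℝ, E')) y hd hs
  have h2 := mfderiv_comp (I := 𝓘(ℝ, E)) (I' := 𝓘(ℝ, E')) (I'' := 𝓘(ℝ, E')) y
    (mdifferentiableAt_extChartAt (I := 𝓘(ℝ, E')) (x := F p) hFz) (hd.comp y hs)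
  rw [h1, mfderiv_eq_fderiv] at h2
  have h3 := ContinuousLinearMap.ext_iff.1 h2
    (chartVec (E := E) p ⟨(extChartAt 𝓘(ℝ, E) p).symm y, v⟩)
  refine Eq.trans ?_ h3.symm
  have h4 := mfderiv_symm_chartVec hy v
  exact congrArg (fun u ↦ chartVec (E := E') (F p) ⟨F ((extChartAt 𝓘(ℝ, E) p).symm y),
    mfderiv 𝓘(ℝ, E) 𝓘(ℝ, E') F ((extChartAt 𝓘(ℝ, E) p).symm y) u⟩) h4.symm

/-- Comparing distances in both charts makes the coordinate map Lipschitz near `p`. The bound holds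
at all nearby points, since `fderiv` is `0` where the map is not differentiable. -/
theorem exists_norm_coordDeriv_le {F : M → N} (hF : LocallyLipschitz F) (p : M) :
    ∃ B : ℝ, ∀ᶠ z in 𝓝 p, ‖coordDeriv E E' F p z‖ ≤ B := by
  have := FiniteDimensional.complete ℝ E
  have := FiniteDimensional.complete ℝ E'
  obtain ⟨g, R, ρ, σ, X, L, ε, κ, C, hU⟩ := exists_isNormalNhd (E := E) p
  obtain ⟨g', R', ρ', σ', X', L', ε', κ', C', hU'⟩ := exists_isNormalNhd (E := E') (F p)
  obtain ⟨A, hA, s, hs, H⟩ := hU.exists_dist_bounds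
  obtain ⟨A', hA', s', hs', H'⟩ := hU'.exists_dist_bounds
  obtain ⟨K, t, ht, hK⟩ := hF p
  obtain ⟨W, hWsub, hWo, hpW⟩ := mem_nhds_iff.1
    (Filter.inter_mem (Filter.inter_mem hs ht) (hF.continuous.continuousAt hs'))
  set S : Set E := (extChartAt 𝓘(ℝ, E) p).target ∩ (extChartAt 𝓘(ℝ, E) p).symm ⁻¹' W with hS
  have hSo : IsOpen S := (continuousOn_extChartAt_symm p).isOpen_inter_preimage
    (isOpen_extChartAt_target p) hWo
  have hlip : LipschitzOnWith (A'.toNNReal * K * A.toNNReal) (coordMap E E' F p) S := by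
    intro a ha b hb
    have e1 := (H' _ (hWsub hb.2).2 _ (hWsub ha.2).2).2
    have e2 := hK (hWsub hb.2).1.2 (hWsub ha.2).1.2
    have e3 := (H _ (hWsub hb.2).1.1 _ (hWsub ha.2).1.1).1
    rw [(extChartAt 𝓘(ℝ, E) p).right_inv ha.1, (extChartAt 𝓘(ℝ, E) p).right_inv hb.1,
      ENNReal.ofReal_mul hA.le] at e3
    rw [edist_eq_enorm_sub, edist_eq_enorm_sub, ← ofReal_norm, ← ofReal_norm]
    refine e1.trans ?_
    calc ENNReal.ofReal A' * edist (F ((extChartAt 𝓘(ℝ, E) p).symm b))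
          (F ((extChartAt 𝓘(ℝ, E) p).symm a))
        ≤ ENNReal.ofReal A' * (K * (ENNReal.ofReal A * ENNReal.ofReal ‖a - b‖)) := by
          gcongr
          exact e2.trans (by gcongr)
      _ = _ := by
          simp only [ENNReal.ofReal, ENNReal.coe_mul]
          ring
  refine ⟨(A'.toNNReal * K * A.toNNReal : ℝ≥0), ?_⟩
  filter_upwards [hWo.mem_nhds hpW, (chartAt E p).open_source.mem_nhds (mem_chart_source E p)]
    with z hzW hzs
  have hz' : z ∈ (extChartAt 𝓘(ℝ, E) p).source := by rwa [extChartAt_source]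
  refine norm_fderiv_le_of_lipschitzOn ℝ (hSo.mem_nhds ⟨(extChartAt 𝓘(ℝ, E) p).map_source hz', ?_⟩)
    hlip
  rw [mem_preimage, (extChartAt 𝓘(ℝ, E) p).left_inv hz']
  exact hzW

end CoordinateMap

/-! ### Linear maps between tangent spaces in charts. -/

section CoordRep

universe u u'

variable {E : Type u} [NormedAddCommGroup E] [NormedSpace ℝ E] [FiniteDimensional ℝ E]
  {M : Type*} [EMetricSpace M] [ChartedSpace E M] [IsManifold 𝓘(ℝ, E) ∞ M]
  [RiemannianBundle (fun x : M ↦ TangentSpace 𝓘(ℝ, E) x)]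
  [IsContMDiffRiemannianBundle 𝓘(ℝ, E) ∞ E (fun x : M ↦ TangentSpace 𝓘(ℝ, E) x)]
  [IsRiemannianManifold 𝓘(ℝ, E) M]
  {E' : Type u'} [NormedAddCommGroup E'] [NormedSpace ℝ E'] [FiniteDimensional ℝ E']
  {N : Type*} [EMetricSpace N] [ChartedSpace E' N] [IsManifold 𝓘(ℝ, E') ∞ N]
  [RiemannianBundle (fun y : N ↦ TangentSpace 𝓘(ℝ, E') y)]
  [IsContMDiffRiemannianBundle 𝓘(ℝ, E') ∞ E' (fun y : N ↦ TangentSpace 𝓘(ℝ, E') y)]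
  [IsRiemannianManifold 𝓘(ℝ, E') N]

/-- The matrix, in the charts around `p` and `q`, of a linear map between tangent spaces. -/
def coordRep {p x : M} {q y : N} (hx : x ∈ (chartAt E p).source) (hy : y ∈ (chartAt E' q).source) :
    (TangentSpace 𝓘(ℝ, E) x →L[ℝ] TangentSpace 𝓘(ℝ, E') y) ≃L[ℝ] (E →L[ℝ] E') :=
  (chartEquiv hx).arrowCongr (chartEquiv hy)

theorem coordRep_apply {p x : M} {q y : N} (hx : x ∈ (chartAt E p).source)
    (hy : y ∈ (chartAt E' q).source) (G : TangentSpace 𝓘(ℝ, E) x →L[ℝ] TangentSpace 𝓘(ℝ, E') y)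
    (v : E) : coordRep hx hy G v = chartEquiv hy (G ((chartEquiv hx).symm v)) := rfl

theorem coordRep_chartVec {p x : M} {q y : N} (hx : x ∈ (chartAt E p).source)
    (hy : y ∈ (chartAt E' q).source) (G : TangentSpace 𝓘(ℝ, E) x →L[ℝ] TangentSpace 𝓘(ℝ, E') y)
    (v : TangentSpace 𝓘(ℝ, E) x) :
    coordRep hx hy G (chartVec p ⟨x, v⟩) = chartVec q ⟨y, G v⟩ := by
  rw [coordRep_apply, ← chartEquiv_apply hx, ContinuousLinearEquiv.symm_apply_apply]
  rfl

theorem surjective_coordRep_iff {p x : M} {q y : N} (hx : x ∈ (chartAt E p).source)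
    (hy : y ∈ (chartAt E' q).source)
    (G : TangentSpace 𝓘(ℝ, E) x →L[ℝ] TangentSpace 𝓘(ℝ, E') y) :
    Function.Surjective (coordRep hx hy G) ↔ Function.Surjective G := by
  have h : (coordRep hx hy G : E → E') = chartEquiv hy ∘ G ∘ (chartEquiv hx).symm := rfl
  rw [h, Function.Surjective.of_comp_iff' (chartEquiv hy).bijective,
    Function.Surjective.of_comp_iff _ (chartEquiv hx).symm.surjective]

theorem coordRep_mfderiv {F : M → N} {p z : M} (hz : z ∈ (chartAt E p).source)
    (hFz : F z ∈ (chartAt E' (F p)).source) (hd : MDifferentiableAt 𝓘(ℝ, E) 𝓘(ℝ, E') F z) :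
    coordRep hz hFz (mfderiv 𝓘(ℝ, E) 𝓘(ℝ, E') F z) = coordDeriv E E' F p z := by
  ext v
  obtain ⟨w, rfl⟩ := (chartEquiv hz).surjective v
  rw [chartEquiv_apply, coordRep_chartVec]
  exact coordDeriv_chartVec hz hFz hd w

/-- The parallel translations between points near `p` are close to the identity in the chart. -/
theorem eventually_norm_coordRep_parallel_sub_le (p : M) {θ : ℝ} (hθ : 0 < θ) :
    ∃ s ∈ 𝓝 p, ∀ x ∈ s, ∀ y ∈ s, ∀ (hx : x ∈ (chartAt E p).source)
      (hy : y ∈ (chartAt E p).source) (P : TangentSpace 𝓘(ℝ, E) x →L[ℝ] TangentSpace 𝓘(ℝ, E) y),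
      IsParallelTranslation x y P → ‖coordRep hx hy P - .id ℝ E‖ ≤ θ := by
  have := FiniteDimensional.complete ℝ E
  obtain ⟨g, R, ρ, σ, X, L, ε, κ, C, hU⟩ := exists_isNormalNhd (E := E) p
  obtain ⟨r, hr, H⟩ := hU.exists_norm_parallel_sub_le hθ
  refine ⟨_, ofReal_eball_mem_nhds p hr, fun x hx' y hy' hx hy P hP ↦ ?_⟩
  refine ContinuousLinearMap.opNorm_le_bound _ hθ.le fun v ↦ ?_
  obtain ⟨w, rfl⟩ := (chartEquiv hx).surjective v
  rw [chartEquiv_apply, _root_.sub_apply, coordRep_chartVec, ContinuousLinearMap.id_apply]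
  exact H x hx' y hy' P hP w

theorem eventually_exists_isParallelTranslation (p : M) :
    ∃ s ∈ 𝓝 p, ∀ x ∈ s, ∀ y ∈ s,
      ∃ P : TangentSpace 𝓘(ℝ, E) x →L[ℝ] TangentSpace 𝓘(ℝ, E) y, IsParallelTranslation x y P := by
  have := FiniteDimensional.complete ℝ E
  obtain ⟨g, R, ρ, σ, X, L, ε, κ, C, hU⟩ := exists_isNormalNhd (E := E) p
  obtain ⟨r, hr, H⟩ := hU.exists_isParallelTranslation
  exact ⟨_, ofReal_eball_mem_nhds p hr, H⟩

end CoordRep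

/-! ### The generalized differential in charts: upper semicontinuity. -/

section GeneralizedDifferential

universe u u'

variable {E : Type u} [NormedAddCommGroup E] [NormedSpace ℝ E] [FiniteDimensional ℝ E]
  {M : Type*} [EMetricSpace M] [ChartedSpace E M] [IsManifold 𝓘(ℝ, E) ∞ M]
  [RiemannianBundle (fun x : M ↦ TangentSpace 𝓘(ℝ, E) x)]
  [IsContMDiffRiemannianBundle 𝓘(ℝ, E) ∞ E (fun x : M ↦ TangentSpace 𝓘(ℝ, E) x)]
  [IsRiemannianManifold 𝓘(ℝ, E) M]
  {E' : Type u'} [NormedAddCommGroup E'] [NormedSpace ℝ E'] [FiniteDimensional ℝ E']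
  {N : Type*} [EMetricSpace N] [ChartedSpace E' N] [IsManifold 𝓘(ℝ, E') ∞ N]
  [RiemannianBundle (fun y : N ↦ TangentSpace 𝓘(ℝ, E') y)]
  [IsContMDiffRiemannianBundle 𝓘(ℝ, E') ∞ E' (fun y : N ↦ TangentSpace 𝓘(ℝ, E') y)]
  [IsRiemannianManifold 𝓘(ℝ, E') N]

variable (E E') in
/-- The limits of the Jacobians of `F` at points of differentiability tending to `p`. -/
def limitJacobians (F : M → N) (p : M) : Set (E →L[ℝ] E') :=
  {A | MapClusterPt A (𝓝[{z | MDifferentiableAt 𝓘(ℝ, E) 𝓘(ℝ, E') F z}] p) (coordDeriv E E' F p)}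

theorem coordRep_comp_mfderiv_comp {F : M → N} {p x z : M} (hx : x ∈ (chartAt E p).source)
    (hFx : F x ∈ (chartAt E' (F p)).source) (hz : z ∈ (chartAt E p).source)
    (hFz : F z ∈ (chartAt E' (F p)).source) (hd : MDifferentiableAt 𝓘(ℝ, E) 𝓘(ℝ, E') F z)
    (P : TangentSpace 𝓘(ℝ, E) x →L[ℝ] TangentSpace 𝓘(ℝ, E) z)
    (Q : TangentSpace 𝓘(ℝ, E') (F z) →L[ℝ] TangentSpace 𝓘(ℝ, E') (F x)) :
    coordRep hx hFx (Q.comp ((mfderiv 𝓘(ℝ, E) 𝓘(ℝ, E') F z).comp P))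
      = (coordRep hFz hFx Q).comp ((coordDeriv E E' F p z).comp (coordRep hx hz P)) := by
  ext v
  obtain ⟨w, rfl⟩ := (chartEquiv hx).surjective v
  rw [chartEquiv_apply, coordRep_chartVec]
  change _ = coordRep hFz hFx Q
    (coordDeriv E E' F p z (coordRep hx hz P (chartVec p ⟨x, w⟩)))
  rw [coordRep_chartVec, ← coordRep_mfderiv hz hFz hd, coordRep_chartVec, coordRep_chartVec]
  rfl

/-- Along a sequence realizing the cluster point the translations exist and tend to the identity in
the charts, so inserting them does not change the limit of the bounded Jacobians. -/
theorem limitJacobians_subset {F : M → N} (hF : LocallyLipschitz F) (p : M) :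
    limitJacobians E E' F p ⊆
      coordRep (mem_chart_source E p) (mem_chart_source E' (F p)) '' mixture F p := by
  intro A hA
  obtain ⟨z, hz, hzA⟩ := exists_seq_of_mapClusterPt hA
  obtain ⟨hzp, hzd⟩ := tendsto_nhdsWithin_iff.1 hz
  obtain ⟨s, hs, hP⟩ := eventually_exists_isParallelTranslation (E := E) p
  obtain ⟨s', hs', hQ⟩ := eventually_exists_isParallelTranslation (E := E') (F p)
  obtain ⟨B, hB⟩ := exists_norm_coordDeriv_le (E := E) (E' := E') hF p
  have hFc := hF.continuous
  have hsrc : (chartAt E p).source ∈ 𝓝 p :=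
    (chartAt E p).open_source.mem_nhds (mem_chart_source E p)
  have hsrc' : F ⁻¹' (chartAt E' (F p)).source ∈ 𝓝 p := hFc.continuousAt
    ((chartAt E' (F p)).open_source.mem_nhds (mem_chart_source E' (F p)))
  have hgood : ∀ᶠ i in atTop, MDifferentiableAt 𝓘(ℝ, E) 𝓘(ℝ, E') F (z i) ∧ z i ∈ s ∧ F (z i) ∈ s' ∧
      z i ∈ (chartAt E p).source ∧ F (z i) ∈ (chartAt E' (F p)).source ∧
      ‖coordDeriv E E' F p (z i)‖ ≤ B := by
    filter_upwards [hzd, hzp hs, hzp (hFc.continuousAt hs'), hzp hsrc, hzp hsrc', hzp.eventually hB]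
      with i h1 h2 h3 h4 h5 h6 using ⟨h1, h2, h3, h4, h5, h6⟩
  -- The mixture requires differentiability and translations at every index, so an initial part of
  -- the sequence is dropped.
  obtain ⟨n, hn⟩ := eventually_atTop.1 hgood
  set y : ℕ → M := fun i ↦ z (i + n) with hy
  have hyp : Tendsto y atTop (𝓝 p) := (tendsto_add_atTop_iff_nat n).2 hzp
  have hyA : Tendsto (fun i ↦ coordDeriv E E' F p (y i)) atTop (𝓝 A) :=
    (tendsto_add_atTop_iff_nat (f := fun i ↦ coordDeriv E E' F p (z i)) n).2 hzA
  have hy' : ∀ i, _ := fun i ↦ hn (i + n) (Nat.le_add_left n i)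
  choose P hP' using fun i ↦ hP p (mem_of_mem_nhds hs) (y i) (hy' i).2.1
  choose Q hQ' using fun i ↦ hQ (F (y i)) (hy' i).2.2.1 (F p) (mem_of_mem_nhds hs')
  set e := coordRep (E := E) (E' := E') (mem_chart_source E p) (mem_chart_source E' (F p)) with he
  have hlim : Tendsto (fun i ↦ e ((Q i).comp ((mfderiv 𝓘(ℝ, E) 𝓘(ℝ, E') F (y i)).comp (P i))))
      atTop (𝓝 A) := by
    have h0 : Tendsto (fun i ↦ e ((Q i).comp ((mfderiv 𝓘(ℝ, E) 𝓘(ℝ, E') F (y i)).comp (P i)))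
        - coordDeriv E E' F p (y i)) atTop (𝓝 0) := by
      refine Metric.tendsto_nhds.2 fun η hη ↦ ?_
      set θ := min 1 (η / (2 * (3 * |B| + 1))) with hθ
      have hθpos : 0 < θ := lt_min one_pos (by positivity)
      obtain ⟨t, ht, hPt⟩ := eventually_norm_coordRep_parallel_sub_le (E := E) p hθpos
      obtain ⟨t', ht', hQt⟩ := eventually_norm_coordRep_parallel_sub_le (E := E') (F p) hθpos
      filter_upwards [hyp ht, hyp (hFc.continuousAt ht')] with i hi hi'
      obtain ⟨j1, -, -, j4, j5, j6⟩ := hy' i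
      have k1 := hPt p (mem_of_mem_nhds ht) (y i) hi (mem_chart_source E p) j4 (P i) (hP' i)
      have k2 := hQt (F (y i)) hi' (F p) (mem_of_mem_nhds ht') j5 (mem_chart_source E' (F p))
        (Q i) (hQ' i)
      rw [dist_zero_right, he, coordRep_comp_mfderiv_comp _ _ j4 j5 j1]
      refine (norm_comp_comp_sub_le (min_le_left _ _) k2 k1 (j6.trans (le_abs_self B))).trans_lt ?_
      have : θ * (2 * (3 * |B| + 1)) ≤ η := by
        rw [← le_div_iff₀ (by positivity)]
        exact min_le_right _ _
      nlinarith [abs_nonneg B]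
    simpa using h0.add hyA
  refine ⟨e.symm A, ⟨y, P, Q, hyp, fun i ↦ (hy' i).1, hP', hQ', ?_⟩, e.apply_symm_apply A⟩
  have := (e.symm.continuous.tendsto A).comp hlim
  refine this.congr fun i ↦ ?_
  exact e.symm_apply_apply _

theorem surjective_of_finrank_range {x : M} {y : N} (hdim : Module.finrank ℝ E' ≤ Module.finrank ℝ E)
    (G : TangentSpace 𝓘(ℝ, E) x →L[ℝ] TangentSpace 𝓘(ℝ, E') y) :
    Module.finrank ℝ (LinearMap.range G.toLinearMap)
      = min (Module.finrank ℝ E) (Module.finrank ℝ E') ↔ Function.Surjective G := by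
  have : FiniteDimensional ℝ (TangentSpace 𝓘(ℝ, E') y) := inferInstanceAs (FiniteDimensional ℝ E')
  have hE' : Module.finrank ℝ (TangentSpace 𝓘(ℝ, E') y) = Module.finrank ℝ E' := rfl
  rw [min_eq_right hdim, ← hE']
  constructor
  · intro h
    exact LinearMap.range_eq_top.1 (Submodule.eq_top_of_finrank_eq h)
  · intro h
    have hr : LinearMap.range G.toLinearMap = ⊤ := LinearMap.range_eq_top.2 h
    rw [hr, finrank_top]

/-- Taking convex hulls commutes with the linear map `coordRep`, so `A` represents an element of
`∂F(p)`. -/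
theorem surjective_of_mem_convexHull_limitJacobians {F : M → N} (hF : LocallyLipschitz F) {p : M}
    (hdim : Module.finrank ℝ E' ≤ Module.finrank ℝ E) (hp : IsNonsingular E E' F p)
    {A : E →L[ℝ] E'} (hA : A ∈ convexHull ℝ (limitJacobians E E' F p)) :
    Function.Surjective A := by
  set e := coordRep (E := E) (E' := E') (mem_chart_source E p) (mem_chart_source E' (F p)) with he
  have h1 : A ∈ e.toLinearEquiv.toLinearMap '' convexHull ℝ (mixture F p) := by
    rw [LinearMap.image_convexHull]
    exact convexHull_mono (limitJacobians_subset hF p) hA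
  obtain ⟨G, hG, rfl⟩ := h1
  exact (surjective_coordRep_iff _ _ G).2 ((surjective_of_finrank_range hdim G).1 (hp G hG))

theorem mem_cthickening_convexHull {V : Type*} [NormedAddCommGroup V] [NormedSpace ℝ V] {𝒦 : Set V}
    {D D' : V} {η : ℝ} (h : ‖D' - D‖ ≤ η / 2) (hD : D ∈ Metric.thickening (η / 2) 𝒦) :
    D' ∈ Metric.cthickening η (convexHull ℝ 𝒦) := by
  obtain ⟨A, hA, hAd⟩ := Metric.mem_thickening_iff.1 hD
  refine Metric.mem_cthickening_of_dist_le _ A _ _ (subset_convexHull ℝ 𝒦 hA) ?_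
  have := dist_triangle D' D A
  rw [← dist_eq_norm] at h
  linarith

/-- Near `p`, the generalized differential is contained in a neighbourhood of the convex hull of
the limits of Jacobians at `p`. -/
theorem eventually_coordRep_mem_cthickening {F : M → N} (hF : LocallyLipschitz F) (p : M) {η : ℝ}
    (hη : 0 < η) :
    ∀ᶠ x in 𝓝 p, ∀ (hx : x ∈ (chartAt E p).source) (hFx : F x ∈ (chartAt E' (F p)).source),
      ∀ G, (G ∈ genDiff F x ∨ MDifferentiableAt 𝓘(ℝ, E) 𝓘(ℝ, E') F x ∧
        G = mfderiv 𝓘(ℝ, E) 𝓘(ℝ, E') F x) → coordRep hx hFx G ∈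
          Metric.cthickening η (convexHull ℝ (limitJacobians E E' F p)) := by
  obtain ⟨B, hB⟩ := exists_norm_coordDeriv_le (E := E) (E' := E') hF p
  have hFc := hF.continuous
  set 𝒦 := limitJacobians E E' F p with h𝒦
  set θ := min 1 (η / (2 * (3 * |B| + 1))) with hθ
  have hθpos : 0 < θ := lt_min one_pos (by positivity)
  have hθη : 3 * |B| * θ ≤ η / 2 := by
    have : θ * (2 * (3 * |B| + 1)) ≤ η := by
      rw [← le_div_iff₀ (by positivity)]
      exact min_le_right _ _
    nlinarith [abs_nonneg B]
  obtain ⟨t, ht, hPt⟩ := eventually_norm_coordRep_parallel_sub_le (E := E) p hθpos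
  obtain ⟨t', ht', hQt⟩ := eventually_norm_coordRep_parallel_sub_le (E := E') (F p) hθpos
  have hth := eventually_nhdsWithin_iff.1 (eventually_mem_thickening_mapClusterPt
    (f := coordDeriv E E' F p) (l := 𝓝[{z | MDifferentiableAt 𝓘(ℝ, E) 𝓘(ℝ, E') F z}] p)
    (hB.filter_mono nhdsWithin_le_nhds) (half_pos hη))
  have hsrc : (chartAt E p).source ∈ 𝓝 p :=
    (chartAt E p).open_source.mem_nhds (mem_chart_source E p)
  have hsrc' : F ⁻¹' (chartAt E' (F p)).source ∈ 𝓝 p := hFc.continuousAt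
    ((chartAt E' (F p)).open_source.mem_nhds (mem_chart_source E' (F p)))
  have hgood : ∀ᶠ z in 𝓝 p, z ∈ t ∧ F z ∈ t' ∧
      z ∈ (chartAt E p).source ∧ F z ∈ (chartAt E' (F p)).source ∧
      ‖coordDeriv E E' F p z‖ ≤ |B| ∧ (MDifferentiableAt 𝓘(ℝ, E) 𝓘(ℝ, E') F z →
        coordDeriv E E' F p z ∈ Metric.thickening (η / 2) 𝒦) := by
    filter_upwards [ht, hFc.continuousAt ht', hsrc, hsrc', hB, hth]
      with z h1 h2 h3 h4 h5 h6 using ⟨h1, h2, h3, h4, h5.trans (le_abs_self B), h6⟩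
  -- The estimates are needed at the points of sequences converging to `x`, hence on a whole
  -- neighbourhood of `x`.
  filter_upwards [eventually_eventually_nhds.2 hgood] with x hxev hx hFx G hG
  have hxself := hxev.self_of_nhds
  obtain ⟨hxt, hxt', -, -, -, hxd⟩ := hxself
  rcases hG with hG | ⟨hd, rfl⟩
  -- The closed thickening of a convex set is closed and convex, so it suffices to place in it the
  -- terms of the sequences defining the mixture. The budget `η` is split between translation error
  -- and distance to the cluster points.
  · have hconv : Convex ℝ ((coordRep hx hFx).toLinearEquiv.toLinearMap ⁻¹'
        Metric.cthickening η (convexHull ℝ 𝒦)) :=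
      ((convex_convexHull ℝ 𝒦).cthickening η).linear_preimage _
    refine convexHull_min (fun G hG ↦ ?_) hconv hG
    obtain ⟨z, P, Q, hz, hd, hP, hQ, hlim⟩ := hG
    have hlim' : Tendsto (fun i ↦ coordRep hx hFx
        ((Q i).comp ((mfderiv 𝓘(ℝ, E) 𝓘(ℝ, E') F (z i)).comp (P i)))) atTop
        (𝓝 (coordRep hx hFx G)) := ((coordRep hx hFx).continuous.tendsto G).comp hlim
    change coordRep hx hFx G ∈ Metric.cthickening η (convexHull ℝ 𝒦)
    have hcl : IsClosed (Metric.cthickening η (convexHull ℝ 𝒦)) := Metric.isClosed_cthickening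
    refine hcl.mem_of_tendsto hlim' ?_
    filter_upwards [hz.eventually hxev] with i hi
    obtain ⟨j1, j2, j3, j4, j5, j6⟩ := hi
    have k1 := hPt x hxt (z i) j1 hx j3 (P i) (hP i)
    have k2 := hQt (F (z i)) j2 (F x) hxt' j4 hFx (Q i) (hQ i)
    have k3 := norm_comp_comp_sub_le (min_le_left _ _) k2 k1 j5
    have k4 := mem_cthickening_convexHull (k3.trans hθη) (j6 (hd i))
    rw [← coordRep_comp_mfderiv_comp hx hFx j3 j4 (hd i)] at k4
    exact k4
  · rw [coordRep_mfderiv hx hFx hd]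
    refine mem_cthickening_convexHull (D := coordDeriv E E' F p x) ?_ (hxd hd)
    rw [sub_self, norm_zero]
    positivity

end GeneralizedDifferential

/-! ### The uniform direction near a nonsingular point. -/

section Uniform

universe u u'

variable {E : Type u} [NormedAddCommGroup E] [NormedSpace ℝ E] [FiniteDimensional ℝ E]
  {M : Type*} [EMetricSpace M] [ChartedSpace E M] [IsManifold 𝓘(ℝ, E) ∞ M]
  [RiemannianBundle (fun x : M ↦ TangentSpace 𝓘(ℝ, E) x)]
  [IsContMDiffRiemannianBundle 𝓘(ℝ, E) ∞ E (fun x : M ↦ TangentSpace 𝓘(ℝ, E) x)]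
  [IsRiemannianManifold 𝓘(ℝ, E) M]
  {E' : Type u'} [NormedAddCommGroup E'] [NormedSpace ℝ E'] [FiniteDimensional ℝ E']
  {N : Type*} [EMetricSpace N] [ChartedSpace E' N] [IsManifold 𝓘(ℝ, E') ∞ N]
  [RiemannianBundle (fun y : N ↦ TangentSpace 𝓘(ℝ, E') y)]
  [IsContMDiffRiemannianBundle 𝓘(ℝ, E') ∞ E' (fun y : N ↦ TangentSpace 𝓘(ℝ, E') y)]
  [IsRiemannianManifold 𝓘(ℝ, E') N]

theorem inner_tangentAdjoint {x : M} {y : N}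
    (G : TangentSpace 𝓘(ℝ, E) x →L[ℝ] TangentSpace 𝓘(ℝ, E') y) (V : TangentSpace 𝓘(ℝ, E) x)
    (w : TangentSpace 𝓘(ℝ, E') y) : inner ℝ V (tangentAdjoint G w) = inner ℝ (G V) w := by
  have : FiniteDimensional ℝ (TangentSpace 𝓘(ℝ, E) x) := inferInstanceAs (FiniteDimensional ℝ E)
  have : FiniteDimensional ℝ (TangentSpace 𝓘(ℝ, E') y) := inferInstanceAs (FiniteDimensional ℝ E')
  have := FiniteDimensional.complete ℝ (TangentSpace 𝓘(ℝ, E) x)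
  have := FiniteDimensional.complete ℝ (TangentSpace 𝓘(ℝ, E') y)
  exact ContinuousLinearMap.adjoint_inner_right G V w

/-- The covector dual to the parallel translate of a unit vector, read in the chart, has norm
bounded above and away from zero. -/
theorem exists_norm_dual_parallel_bounds (q : N) :
    ∃ (g : E' → E' →L[ℝ] E' →L[ℝ] ℝ) (R a b : ℝ), IsChartMetric q g R ∧ 0 < a ∧
      ∀ᶠ y in 𝓝 q, y ∈ chartDom E' q R ∧
        ∀ T : TangentSpace 𝓘(ℝ, E') q →L[ℝ] TangentSpace 𝓘(ℝ, E') y,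
          IsParallelTranslation q y T → ∀ u : TangentSpace 𝓘(ℝ, E') q, ‖u‖ = 1 →
          a ≤ ‖g (extChartAt 𝓘(ℝ, E') q y) (chartVec (E := E') q ⟨y, T u⟩)‖ ∧
          ‖g (extChartAt 𝓘(ℝ, E') q y) (chartVec (E := E') q ⟨y, T u⟩)‖ ≤ b := by
  have := FiniteDimensional.complete ℝ E'
  obtain ⟨g, R, ρ, σ, X, L, ε, κ, C, hU⟩ := exists_isNormalNhd (E := E') q
  obtain ⟨r, hr, H⟩ := hU.exists_norm_parallel_sub_le (θ := 1 / 2) (by norm_num)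
  have hκ := hU.κ_pos
  have hC := hU.C_pos
  -- A unit vector has coordinate norm between `1 / C` and `1 / κ`, and translation changes it by at
  -- most half. Lowering the index costs a factor between `κ²` and `C²`. That translations are
  -- isometries is not needed.
  refine ⟨g, R, κ ^ 2 * (1 / (2 * C)), C ^ 2 * (3 / (2 * κ)), hU.chart, by positivity, ?_⟩
  filter_upwards [ofReal_eball_mem_nhds q hU.ε_pos, ofReal_eball_mem_nhds q hr] with y hyε hyr
  have hqε := mem_of_mem_nhds (ofReal_eball_mem_nhds q hU.ε_pos)
  have hqr := mem_of_mem_nhds (ofReal_eball_mem_nhds q hr)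
  have hyR := chartDom_mono q hU.normal.ρ_le (hU.eball_subset hyε)
  refine ⟨hyR, fun T hT u hu ↦ ?_⟩
  have h1 := H q hqr y hyr T hT u
  have h2 := hU.norm_le q hqε (chartVec q ⟨q, u⟩)
  have h3 := hU.le_norm q hqε (chartVec q ⟨q, u⟩)
  rw [← hU.chart.norm_eq (mem_chartDom_self q hU.chart.R_pos) u, hu] at h2 h3
  set û : E' := chartVec q ⟨q, u⟩ with hû
  set w : E' := chartVec q ⟨y, T u⟩ with hw
  have h4 : ‖w‖ ≤ ‖w - û‖ + ‖û‖ := by simpa using norm_add_le (w - û) û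
  have h5 : ‖û‖ ≤ ‖w - û‖ + ‖w‖ := by
    have := norm_sub_le w (w - û)
    rw [sub_sub_cancel] at this
    linarith
  have h6 : 1 / (2 * C) ≤ ‖w‖ := by
    rw [div_le_iff₀ (by positivity)]
    have : ‖û‖ * C ≤ 2 * ‖w‖ * C := mul_le_mul_of_nonneg_right (by linarith) hC.le
    linarith
  have h7 : ‖w‖ ≤ 3 / (2 * κ) := by
    rw [le_div_iff₀ (by positivity)]
    have : ‖w‖ * (2 * κ) ≤ 3 / 2 * ‖û‖ * (2 * κ) :=
      mul_le_mul_of_nonneg_right (by linarith) (by positivity)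
    linarith
  have hw0 : 0 < ‖w‖ := lt_of_lt_of_le (by positivity) h6
  set z := extChartAt 𝓘(ℝ, E') q y with hz
  constructor
  · refine (mul_le_mul_of_nonneg_left h6 (by positivity)).trans ?_
    refine le_of_mul_le_mul_right ?_ hw0
    have e1 : κ ^ 2 * ‖w‖ * ‖w‖ ≤ g z w w := by
      have := pow_le_pow_left₀ (by positivity) (hU.norm_le y hyε w) 2
      rw [Real.sq_sqrt (hU.chart.metric.nonneg _ _)] at this
      calc κ ^ 2 * ‖w‖ * ‖w‖ = (κ * ‖w‖) ^ 2 := by ring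
        _ ≤ _ := this
    exact e1.trans ((le_abs_self _).trans ((g z w).le_opNorm w))
  · refine ContinuousLinearMap.opNorm_le_bound _ (by positivity) fun v ↦ ?_
    have e1 := hU.chart.metric.abs_apply_le z w v
    have e2 := hU.le_norm y hyε w
    have e3 := hU.le_norm y hyε v
    rw [Real.norm_eq_abs]
    refine e1.trans ((mul_le_mul e2 e3 (Real.sqrt_nonneg _) (by positivity)).trans ?_)
    calc C * ‖w‖ * (C * ‖v‖) = C ^ 2 * ‖w‖ * ‖v‖ := by ring
      _ ≤ C ^ 2 * (3 / (2 * κ)) * ‖v‖ := by gcongr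

/-- Near a nonsingular point the generalized differential consists of
surjections, and a unit tangent vector can be chosen uniformly for all its elements. -/
theorem exists_uniform_direction {F : M → N} (hF : LocallyLipschitz F) {p : M}
    (hdim : Module.finrank ℝ E' ≤ Module.finrank ℝ E) (hp : IsNonsingular E E' F p) :
    ∃ δ : ℝ, 0 < δ ∧ ∀ᶠ x in 𝓝 p,
      (∀ G ∈ genDiff (E := E) (E' := E') F x, Function.Surjective G) ∧
      ∀ T : TangentSpace 𝓘(ℝ, E') (F p) →L[ℝ] TangentSpace 𝓘(ℝ, E') (F x),
        IsParallelTranslation (F p) (F x) T → ∀ u : TangentSpace 𝓘(ℝ, E') (F p), ‖u‖ = 1 →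
        ∃ V : TangentSpace 𝓘(ℝ, E) x, ‖V‖ = 1 ∧ ∀ G, (G ∈ genDiff F x ∨
          MDifferentiableAt 𝓘(ℝ, E) 𝓘(ℝ, E') F x ∧ G = mfderiv 𝓘(ℝ, E) 𝓘(ℝ, E') F x) →
          δ ≤ inner ℝ (G V) (T u) := by
  have hFc := hF.continuous
  rcases subsingleton_or_nontrivial E' with hE' | hE'
  -- In the zero space every map is onto and there are no unit vectors `u`.
  · refine ⟨1, one_pos, Eventually.of_forall fun x ↦ ⟨fun G _ y ↦ ⟨0, ?_⟩, fun T _ u hu ↦ ?_⟩⟩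
    · have : Subsingleton (TangentSpace 𝓘(ℝ, E') (F x)) := hE'
      exact Subsingleton.elim _ _
    · have : Subsingleton (TangentSpace 𝓘(ℝ, E') (F p)) := hE'
      rw [Subsingleton.elim u 0, norm_zero] at hu
      exact absurd hu zero_ne_one
  have hE : Nontrivial E := Module.nontrivial_of_finrank_pos (R := ℝ)
    (lt_of_lt_of_le Module.finrank_pos hdim)
  have := FiniteDimensional.complete ℝ E
  obtain ⟨g, R, a, b, hC, ha, hdual⟩ := exists_norm_dual_parallel_bounds (E' := E') (F p)
  obtain ⟨gM, RM, ρ, σ, X, L, ε, κ, C, hU⟩ := exists_isNormalNhd (E := E) p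
  obtain ⟨B, hB⟩ := exists_norm_coordDeriv_le (E := E) (E' := E') hF p
  have hprop : ProperSpace (E →L[ℝ] E') := FiniteDimensional.proper ℝ _
  have hprop' : ProperSpace (E' →L[ℝ] ℝ) := FiniteDimensional.proper ℝ _
  have hcpt : IsCompact (limitJacobians E E' F p) :=
    isCompact_setOf_mapClusterPt (hB.filter_mono nhdsWithin_le_nhds)
  -- The outer radius `max a b` ensures that the shell contains the sphere of radius `a`, which is
  -- used for surjectivity.
  set Λ : Set (E' →L[ℝ] ℝ) := Metric.closedBall 0 (max a b) \ Metric.ball 0 a with hΛ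
  have hmemΛ : ∀ ℓ : E' →L[ℝ] ℝ, ℓ ∈ Λ ↔ ‖ℓ‖ ≤ max a b ∧ a ≤ ‖ℓ‖ := fun ℓ ↦ by
    rw [hΛ, Set.mem_sdiff, mem_closedBall_zero_iff, mem_ball_zero_iff, not_lt]
  obtain ⟨δ, hδ, η, hη, hdir⟩ := exists_uniform_pos_le_apply (isCompact_convexHull hcpt)
    (convex_convexHull ℝ _)
    (fun A hA ↦ surjective_of_mem_convexHull_limitJacobians hF hdim hp hA)
    (((isCompact_closedBall _ _).diff Metric.isOpen_ball) : IsCompact Λ)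
    (fun h ↦ by have := ((hmemΛ 0).1 h).2; rw [norm_zero] at this; linarith)
  have hCpos := hU.C_pos
  -- The direction `v` has coordinate norm `1`, hence Riemannian norm at most `C`; normalizing it
  -- divides the bound by at most `C`.
  refine ⟨δ / C, by positivity, ?_⟩
  filter_upwards [eventually_coordRep_mem_cthickening (E := E) (E' := E') hF p hη,
    hFc.continuousAt.eventually hdual, ofReal_eball_mem_nhds p hU.ε_pos] with x hx hFx hxε
  have hxs : x ∈ chartDom E p RM := chartDom_mono p hU.normal.ρ_le (hU.eball_subset hxε)
  obtain ⟨hFxs, hTu⟩ := hFx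
  have hth := hx hxs.1 hFxs.1
  constructor
  · intro G hG
    rw [← surjective_coordRep_iff hxs.1 hFxs.1]
    refine surjective_of_forall_functional ha fun ℓ hℓ ↦ ?_
    obtain ⟨v, -, hv⟩ := hdir ℓ ((hmemΛ ℓ).2 ⟨hℓ ▸ le_max_left a b, hℓ.ge⟩)
    exact ⟨v, hδ.trans_le (hv _ (hth G (Or.inl hG)))⟩
  · intro T hT u hu
    obtain ⟨b1, b2⟩ := hTu T hT u hu
    obtain ⟨v, hv1, hv⟩ := hdir _ ((hmemΛ _).2 ⟨b2.trans (le_max_right a b), b1⟩)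
    set V₀ : TangentSpace 𝓘(ℝ, E) x := (chartEquiv hxs.1).symm v with hV₀
    have hV₀v : chartVec p ⟨x, V₀⟩ = v := (chartEquiv hxs.1).apply_symm_apply v
    have hn : ‖V₀‖ ≤ C := by
      rw [hU.chart.norm_eq hxs, hV₀v]
      have := hU.le_norm x hxε v
      rwa [hv1, mul_one] at this
    have hn0 : 0 < ‖V₀‖ := by
      have := hU.norm_le x hxε v
      rw [hU.chart.norm_eq hxs, hV₀v]
      rw [hv1, mul_one] at this
      exact hU.κ_pos.trans_le this
    refine ⟨‖V₀‖⁻¹ • V₀, ?_, fun G hG ↦ ?_⟩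
    · rw [norm_smul, norm_inv, norm_norm, inv_mul_cancel₀ hn0.ne']
    · have h1 := hv _ (hth G hG)
      have h2 : inner ℝ (G V₀) (T u) = g (extChartAt 𝓘(ℝ, E') (F p) (F x))
          (chartVec (E := E') (F p) ⟨F x, T u⟩) (coordRep hxs.1 hFxs.1 G v) := by
        rw [hC.inner_eq hFxs, hC.metric.symm, ← hV₀v, coordRep_chartVec]
      rw [map_smul, real_inner_smul_left, h2, div_eq_inv_mul]
      exact mul_le_mul (inv_anti₀ hn0 hn) h1 hδ.le (by positivity)

end Uniform

end Clarke

end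

/-! ### The main theorem. -/

theorem proposition3p11
    {E : Type*} [NormedAddCommGroup E] [NormedSpace ℝ E] [FiniteDimensional ℝ E]
    {M : Type*} [EMetricSpace M] [ChartedSpace E M] [IsManifold 𝓘(ℝ, E) ∞ M]
    [RiemannianBundle (fun x : M ↦ TangentSpace 𝓘(ℝ, E) x)]
    [IsContMDiffRiemannianBundle 𝓘(ℝ, E) ∞ E (fun x : M ↦ TangentSpace 𝓘(ℝ, E) x)]
    [IsRiemannianManifold 𝓘(ℝ, E) M]
    {E' : Type*} [NormedAddCommGroup E'] [NormedSpace ℝ E'] [FiniteDimensional ℝ E']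
    {N : Type*} [EMetricSpace N] [ChartedSpace E' N] [IsManifold 𝓘(ℝ, E') ∞ N]
    [RiemannianBundle (fun y : N ↦ TangentSpace 𝓘(ℝ, E') y)]
    [IsContMDiffRiemannianBundle 𝓘(ℝ, E') ∞ E' (fun y : N ↦ TangentSpace 𝓘(ℝ, E') y)]
    [IsRiemannianManifold 𝓘(ℝ, E') N]
    (hdim : Module.finrank ℝ E' ≤ Module.finrank ℝ E)
    (F : M → N) (hF : LocallyLipschitz F)
    (p : M) (hp : Clarke.IsNonsingular E E' F p) :
    (∃ t : ℝ, 0 < t ∧ Clarke.IsWhiteheadBall E' (F p) t) ∧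
    ∀ t : ℝ, 0 < t → ∃ lam : ℝ, 0 < lam ∧ ∃ δ : ℝ, 0 < δ ∧
      Clarke.IsWhiteheadBall E p (2 * lam) ∧
      (MapsTo F (Metric.eball p (ENNReal.ofReal (2 * lam)))
          (Metric.eball (F p) (ENNReal.ofReal t)) ∧
        ∃ K : ℝ≥0, LipschitzOnWith K F (Metric.eball p (ENNReal.ofReal (2 * lam)))) ∧
      (∀ x ∈ Metric.eball p (ENNReal.ofReal (2 * lam)),
        ∃ T : TangentSpace 𝓘(ℝ, E') (F p) →L[ℝ] TangentSpace 𝓘(ℝ, E') (F x),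
          Clarke.IsParallelTranslation (F p) (F x) T ∧
          ∀ u : TangentSpace 𝓘(ℝ, E') (F p), ‖u‖ = 1 →
            ∃ V : TangentSpace 𝓘(ℝ, E) x, ‖V‖ = 1 ∧
              (∀ A ∈ Clarke.adjGenDiff (E := E) (E' := E') F x, δ ≤ inner ℝ V (A (T u))) ∧
              (MDifferentiableAt 𝓘(ℝ, E) 𝓘(ℝ, E') F x →
                δ ≤ inner ℝ V (Clarke.tangentAdjoint
                  (mfderiv 𝓘(ℝ, E) 𝓘(ℝ, E') F x) (T u)))) ∧
      ∀ x ∈ Metric.eball p (ENNReal.ofReal (2 * lam)), Clarke.IsNonsingular E E' F x := by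
  have := FiniteDimensional.complete ℝ E
  have := FiniteDimensional.complete ℝ E'
  obtain ⟨t₀, ht₀, hW'⟩ := Clarke.exists_isWhiteheadBall (E := E') (F p)
  refine ⟨⟨t₀, ht₀, hW' t₀ ht₀ le_rfl⟩, fun t ht ↦ ?_⟩
  obtain ⟨r₀, hr₀, hW⟩ := Clarke.exists_isWhiteheadBall (E := E) p
  obtain ⟨K, s, hs, hK⟩ := hF p
  obtain ⟨s', hs', hT⟩ := Clarke.eventually_exists_isParallelTranslation (E := E') (F p)
  obtain ⟨δ, hδ, hev⟩ := Clarke.exists_uniform_direction (E := E) (E' := E') hF hdim hp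
  have hFc : ContinuousAt F p := hF.continuous.continuousAt
  -- All conditions other than the Whitehead property hold on a neighbourhood of `p`, so a ball of
  -- some radius `r` serves them at once. Whitehead balls exist for every radius up to `r₀`, so `2λ
  -- = min r r₀` is admissible.
  obtain ⟨r, hr, hsub⟩ := Clarke.exists_ofReal_eball_subset (Filter.inter_mem
    (Filter.inter_mem hs (hFc (Clarke.ofReal_eball_mem_nhds (F p) ht)))
    (Filter.inter_mem (hFc hs') hev))
  have hpos : 0 < min r r₀ := lt_min hr hr₀
  have h2 : 2 * (min r r₀ / 2) = min r r₀ := by ring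
  have hball : Metric.eball p (ENNReal.ofReal (2 * (min r r₀ / 2))) ⊆
      Metric.eball p (ENNReal.ofReal r) :=
    Metric.eball_subset_eball (ENNReal.ofReal_le_ofReal (h2.trans_le (min_le_left _ _)))
  refine ⟨min r r₀ / 2, half_pos hpos, δ, hδ, ?_, ⟨fun x hx ↦ (hsub (hball hx)).1.2, K,
    hK.mono fun x hx ↦ (hsub (hball hx)).1.1⟩, fun x hx ↦ ?_, fun x hx G hG ↦ ?_⟩
  · rw [h2]
    exact hW _ hpos (min_le_right _ _)
  · obtain ⟨-, hxT, -, hdir⟩ := hsub (hball hx)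
    obtain ⟨T, hTx⟩ := hT (F p) (mem_of_mem_nhds hs') (F x) hxT
    refine ⟨T, hTx, fun u hu ↦ ?_⟩
    obtain ⟨V, hV, hG⟩ := hdir T hTx u hu
    refine ⟨V, hV, ?_, fun hd ↦ ?_⟩
    · rintro A ⟨G, hGx, rfl⟩
      rw [Clarke.inner_tangentAdjoint]
      exact hG G (Or.inl hGx)
    · rw [Clarke.inner_tangentAdjoint]
      exact hG _ (Or.inr ⟨hd, rfl⟩)
  · obtain ⟨-, -, hsurj, -⟩ := hsub (hball hx)
    exact (Clarke.surjective_of_finrank_range hdim G).2 (hsurj G hG)
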